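/- Theorem 3.1. Let $m\ge 2$, $n\ge 1$, $x_0\in\mathbb R^m$, $y_0\in\mathbb R^n$, $a,b>0$, $0<\bar a\le a$. Put $P_1=\{x\in\mathbb R^m:\|x-x_0\|_\infty\le a\}$, $P_2=\{y\in\mathbb R^n:\|y-y_0\|_\infty\le b\}$, $P=P_1\times P_2$, $$V=\{x\in P_1: x_m=x_{0m},\ |x_l-x_{0l}|\le\bar a\ (1\le l\le m-1)\},\qquad V_{int}=\{x\in P_1: x_m=x_{0m},\ |x_l-x_{0l}|<\bar a\ (1\le l\le m-1)\}.$$ Let $C_{il},D_i:P\to\mathbb R$ ($1\le i\le n$, $1\le l\le m-1$) and $I:V\to P_2$ be Lipschitz continuous (respectively $C^r$, where $r\ge 1$ is an integer), with $\|I(u)-y_0\|_\infty<b$ for all $u\in V$. Consider the system $$\sum_{l=1}^{m-1}C_{il}(x,y)\frac{\partial y_i}{\partial x_l}+\frac{\partial y_i}{\partial x_m}=D_i(x,y),\qquad i=1,\dots,n. \tag{1}$$ For a set $B$ with $V\subseteq B\subseteq P_1$ that contains an open neighbourhood of $V_{int}$ (a *local domain*), a Lipschitz (respectively $C^r$) *solution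 on $B$* is a Lipschitz (respectively $C^r$) function $f:B\to P_2$ with $f=I$ on $V$ that satisfies (1) at every point of $B$ at which it is differentiable relative to $B$ with a unique derivative. (A $C^r$ solution thus satisfies (1) at every point of $B$ where derivatives relative to $B$ are unique. On the domains $B$ and $S$ produced below this is every point.) **(a) Unique local solution.** There are a local domain $B$, at every point of which derivatives relative to $B$ are unique, and a Lipschitz (respectively $C^r$) solution $f$ on $B$, such that every Lipschitz (respectively $C^r$) solution on $B$ equals $f$. Moreover, every Lipschitz (respectively $C^r$) solution on any local domain $B'$ agrees with $f$ on some open neighbourhood of $V_{int}$ contained in $B\cap B'$. **(b) Explicit domain and Lipschitz constants.** Let $L_C,L_D$ be Lipschitz constants, for the 1-norm, of all $C_{il}$ and of all $D_i$ on $P$, and let $L_I$ be one of all $I_i$ on $V$. Let $M_{\|C\|},M_{\|D\|}$ be bounds for all $|C_{il}|$, $|D_i|$ on $P$, let $M_I$ be a bound for $\|I-y_0\|_\infty$ on $V$ (for example its maximum), and let $m_{C_l}\le C_{il}\le M_{C_l}$ on $P$ for all $i,l$. Put $c_1=nL_D-(m-1)L_C$, let $\theta$ be the unit step function, and let $\alpha>0$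 satisfy $$n(m-1)L_C\,\alpha\,(L_I+\tfrac1n)\,e^{\theta(c_1)c_1\alpha}<1,\qquad \alpha\le a,\qquad \alpha M_{\|D\|}\le b-M_I,\qquad -\bar a+M_{C_l}\alpha\le\bar a+m_{C_l}\alpha\ \ (1\le l\le m-1).$$ Let $S=S_+\cup S_-$, where $$S_+=\{x\in P_1: 0\le t\le\alpha,\ -\bar a+M_{C_l}t\le x_l-x_{0l}\le\bar a+m_{C_l}t\ (1\le l\le m-1)\},$$ $$S_-=\{x\in P_1: -\alpha\le t\le 0,\ -\bar a+m_{C_l}t\le x_l-x_{0l}\le\bar a+M_{C_l}t\ (1\le l\le m-1)\},\qquad t=x_m-x_{0m}.$$ Then $S$ is a local domain, derivatives relative to $S$ are unique at every point of $S$, and there is exactly one Lipschitz (respectively $C^r$) solution $f$ on $S$. For every $i$, $|f_i(x)-f_i(x')|\le L_f\|x-x'\|_1$ whenever $x,x'\in S$ and $x_m=x'_m$, and $|f_i(x)-f_i(x')|\le L_{Ufs}\|x-x'\|_1$ for all $x,x'\in S$, where $$L_f=\frac{(L_I+\frac1n)e^{c_1\alpha}}{1-n(m-1)L_C\,\alpha\,(L_I+\frac1n)e^{\theta(c_1)c_1\alpha}}-\frac1n,\qquad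 L_{Ufs}=\max\{L_f,\ M_{\|D\|}+L_f(m-1)M_{\|C\|}\}.$$ -/

import Mathlib

open Set

noncomputable section

namespace CharSystem

/-- The space `ℝ^m` of independent variables, written as `ℝ^(m-1) × ℝ`: a point is
`x = ((x_1, …, x_{m-1}), x_m)`.  The norm is the maximum norm. -/
abbrev Dom (m : ℕ) : Type := (Fin (m - 1) → ℝ) × ℝ

/-- The space `ℝ^n` of dependent variables, with the maximum norm. -/
abbrev Cod (n : ℕ) : Type := Fin n → ℝ

/-- The 1-norm distance on `ℝ^m`. -/
def dist1 {m : ℕ} (x x' : Dom m) : ℝ := (∑ l, |x.1 l - x'.1 l|) + |x.2 - x'.2|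

/-- The 1-norm distance on `ℝ^m × ℝ^n`. -/
def dist1Prod {m n : ℕ} (p q : Dom m × Cod n) : ℝ := dist1 p.1 q.1 + ∑ s, |p.2 s - q.2 s|

/-- The data of the initial value problem: centres, side lengths, coefficients and initial
condition.  Only the values of `C` and `D` on `P` and of `I` on `V` matter. -/
structure Problem (m n : ℕ) where
  x0 : Dom m
  y0 : Cod n
  a : ℝ
  b : ℝ
  abar : ℝ
  C : Fin n → Fin (m - 1) → Dom m × Cod n → ℝ
  D : Fin n → Dom m × Cod n → ℝ
  I : Dom m → Cod n

namespace Problem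

variable {m n : ℕ} (p : Problem m n)

/-- `P_1 = {x : ‖x - x_0‖_∞ ≤ a}`. -/
def P1 : Set (Dom m) := {x | ‖x - p.x0‖ ≤ p.a}

/-- `P_2 = {y : ‖y - y_0‖_∞ ≤ b}`. -/
def P2 : Set (Cod n) := {y | ‖y - p.y0‖ ≤ p.b}

/-- `P = P_1 × P_2`. -/
def P : Set (Dom m × Cod n) := p.P1 ×ˢ p.P2

/-- The piece of the initial hyperplane on which the initial condition is given. -/
def V : Set (Dom m) := {x | x ∈ p.P1 ∧ x.2 = p.x0.2 ∧ ∀ l, |x.1 l - p.x0.1 l| ≤ p.abar}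

/-- The relative interior of `V`. -/
def Vint : Set (Dom m) := {x | x ∈ p.P1 ∧ x.2 = p.x0.2 ∧ ∀ l, |x.1 l - p.x0.1 l| < p.abar}

/-- `V ⊆ B ⊆ P_1` and `B` contains a neighbourhood of `V_int`. -/
def IsLocalDomain (B : Set (Dom m)) : Prop :=
  p.V ⊆ B ∧ B ⊆ p.P1 ∧ ∃ U : Set (Dom m), IsOpen U ∧ p.Vint ⊆ U ∧ U ⊆ B

/-- The system `∑_l C_il(x, y) ∂y_i/∂x_l + ∂y_i/∂x_m = D_i(x, y)`, `i = 1, …, n`, at a point `x`,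
for the value `y` and the total derivative `f'`. -/
def Equations (x : Dom m) (y : Cod n) (f' : Dom m →L[ℝ] Cod n) : Prop :=
  ∀ i, (∑ l, p.C i l (x, y) * f' (Pi.single l 1, 0) i) + f' (0, 1) i = p.D i (x, y)

/-- `f : B → P_2` reduces to `I` on `V` and satisfies the system at every point of `B` at which it
is differentiable (relative to `B`, at points where such a derivative is unique; all interior
points are of this kind, and if `UniqueDiffOn ℝ B`, all points of `B` are). -/
structure IsSolution (B : Set (Dom m)) (f : Dom m → Cod n) : Prop where
  mapsTo : MapsTo f B p.P2
  initial : EqOn f p.I p.V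
  equations : ∀ x ∈ B, UniqueDiffWithinAt ℝ B x → DifferentiableWithinAt ℝ f B x →
    p.Equations x (f x) (fderivWithin ℝ f B x)

/-- The coefficients and the initial condition are Lipschitz continuous. -/
def LipschitzData : Prop :=
  (∀ i l, ∃ K, LipschitzOnWith K (p.C i l) p.P) ∧ (∀ i, ∃ K, LipschitzOnWith K (p.D i) p.P) ∧
    ∃ K, LipschitzOnWith K p.I p.V

/-- The coefficients and the initial condition are of class `C^r`. -/
def CrData (r : ℕ) : Prop :=
  (∀ i l, ContDiffOn ℝ r (p.C i l) p.P) ∧ (∀ i, ContDiffOn ℝ r (p.D i) p.P) ∧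
    ContDiffOn ℝ r p.I p.V

/-- `f` is a solution on `B` in the regularity class `Reg`, and the only one (as a function
on `B`). -/
def IsUniqueSolution (Reg : Set (Dom m) → (Dom m → Cod n) → Prop) (B : Set (Dom m))
    (f : Dom m → Cod n) : Prop :=
  p.IsSolution B f ∧ Reg B f ∧ ∀ g, p.IsSolution B g → Reg B g → EqOn g f B

/-- There is a unique local solution in the class `Reg`: a solution on some admissible domain `B`,
unique on `B`, and agreeing near `V_int` with every other local solution of the class. -/
def HasUniqueLocalSolution (Reg : Set (Dom m) → (Dom m → Cod n) → Prop) : Prop :=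
  ∃ B f, p.IsLocalDomain B ∧ UniqueDiffOn ℝ B ∧ p.IsUniqueSolution Reg B f ∧
    ∀ B' g, p.IsLocalDomain B' → p.IsSolution B' g → Reg B' g →
      ∃ U : Set (Dom m), IsOpen U ∧ p.Vint ⊆ U ∧ U ⊆ B ∩ B' ∧ EqOn g f U

end Problem

/-- The class of Lipschitz continuous functions on `B`. -/
def LipschitzReg {m n : ℕ} (B : Set (Dom m)) (f : Dom m → Cod n) : Prop :=
  ∃ K, LipschitzOnWith K f B

/-- The class of `C^r` functions on `B`. -/
def CrReg {m n : ℕ} (r : ℕ) (B : Set (Dom m)) (f : Dom m → Cod n) : Prop :=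
  ContDiffOn ℝ r f B

/-- The constants in which the domain and the Lipschitz constants of the solution are expressed. -/
structure Constants (m : ℕ) where
  LC : ℝ
  LD : ℝ
  LI : ℝ
  MC : ℝ
  MD : ℝ
  MI : ℝ
  lowC : Fin (m - 1) → ℝ
  uppC : Fin (m - 1) → ℝ

/-- The constants are what they should be for the problem `p`: `LC`, `LD`, `LI` are Lipschitz
constants for the 1-norm of all `C_il`, `D_i` on `P` and all `I_i` on `V`; `MC`, `MD`, `MI` are
bounds for `|C_il|`, `|D_i|` on `P` and for `‖I - y_0‖_∞` on `V`; and `lowC l ≤ C_il ≤ uppC l`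
on `P` for all `i`. -/
structure Constants.IsFor {m n : ℕ} (c : Constants m) (p : Problem m n) : Prop where
  lipC : ∀ i l, ∀ z ∈ p.P, ∀ w ∈ p.P, |p.C i l z - p.C i l w| ≤ c.LC * dist1Prod z w
  lipD : ∀ i, ∀ z ∈ p.P, ∀ w ∈ p.P, |p.D i z - p.D i w| ≤ c.LD * dist1Prod z w
  lipI : ∀ i, ∀ u ∈ p.V, ∀ v ∈ p.V, |p.I u i - p.I v i| ≤ c.LI * dist1 u v
  boundC : ∀ i l, ∀ z ∈ p.P, |p.C i l z| ≤ c.MC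
  boundD : ∀ i, ∀ z ∈ p.P, |p.D i z| ≤ c.MD
  boundI : ∀ u ∈ p.V, ‖p.I u - p.y0‖ ≤ c.MI
  low_le : ∀ i l, ∀ z ∈ p.P, c.lowC l ≤ p.C i l z
  le_upp : ∀ i l, ∀ z ∈ p.P, p.C i l z ≤ c.uppC l

/-- The unit step function. -/
def step (t : ℝ) : ℝ := if 0 ≤ t then 1 else 0

namespace Constants

variable {m : ℕ} (c : Constants m)

/-- `c_1 = n L_D - (m - 1) L_C`. -/
def c1 (n : ℕ) : ℝ := n * c.LD - ((m : ℝ) - 1) * c.LC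

/-- `n (m - 1) L_C α (L_I + 1/n) exp(θ(c_1) c_1 α)`. -/
def q (n : ℕ) (α : ℝ) : ℝ :=
  n * ((m : ℝ) - 1) * c.LC * α * (c.LI + 1 / n) * Real.exp (step (c.c1 n) * c.c1 n * α)

/-- The Lipschitz constant of the solution along the hyperplanes `x_m = const`. -/
def Lf (n : ℕ) (α : ℝ) : ℝ :=
  (c.LI + 1 / n) * Real.exp (c.c1 n * α) / (1 - c.q n α) - 1 / n

/-- The total Lipschitz constant of the solution. -/
def LUfs (n : ℕ) (α : ℝ) : ℝ :=
  max (c.Lf n α) (c.MD + c.Lf n α * ((m : ℝ) - 1) * c.MC)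

end Constants

namespace Problem

variable {m n : ℕ} (p : Problem m n)

/-- The conditions on the height `α` of the standard domain.  The first one is the locality
condition `α < 1 / (n (m-1) L_C (L_I + 1/n) exp(θ(c_1) c_1 α))`, the next two are
`α ≤ min {a, (b - M_I) / M_D}`, both written so that a zero denominator means no restriction;
the last one says that the inequalities for the `x_l` that define the standard domain are
consistent up to height `α`. -/
structure Admissible (c : Constants m) (α : ℝ) : Prop where
  pos : 0 < α
  locality : c.q n α < 1
  le_a : α ≤ p.a
  le_b : α * c.MD ≤ p.b - c.MI
  consistent : ∀ l, -p.abar + c.uppC l * α ≤ p.abar + c.lowC l * α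

/-- The standard domain above the initial hyperplane. -/
def Splus (c : Constants m) (α : ℝ) : Set (Dom m) :=
  {x | x ∈ p.P1 ∧ 0 ≤ x.2 - p.x0.2 ∧ x.2 - p.x0.2 ≤ α ∧
    ∀ l, -p.abar + c.uppC l * (x.2 - p.x0.2) ≤ x.1 l - p.x0.1 l ∧
      x.1 l - p.x0.1 l ≤ p.abar + c.lowC l * (x.2 - p.x0.2)}

/-- The standard domain below the initial hyperplane. -/
def Sminus (c : Constants m) (α : ℝ) : Set (Dom m) :=
  {x | x ∈ p.P1 ∧ -α ≤ x.2 - p.x0.2 ∧ x.2 - p.x0.2 ≤ 0 ∧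
    ∀ l, -p.abar + c.lowC l * (x.2 - p.x0.2) ≤ x.1 l - p.x0.1 l ∧
      x.1 l - p.x0.1 l ≤ p.abar + c.uppC l * (x.2 - p.x0.2)}

/-- The standard domain `S = S_+ ∪ S_-`. -/
def S (c : Constants m) (α : ℝ) : Set (Dom m) := p.Splus c α ∪ p.Sminus c α

/-- For all valid constants and all heights `α` satisfying the explicit conditions, there is a
unique solution of the class `Reg` on the standard domain `S` of height `α`, with the explicit
Lipschitz constants (for the 1-norm). -/
def HasUniqueSolutionOnStandardDomains (Reg : Set (Dom m) → (Dom m → Cod n) → Prop) : Prop :=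
  ∀ (c : Constants m) (α : ℝ), c.IsFor p → p.Admissible c α →
    p.IsLocalDomain (p.S c α) ∧ UniqueDiffOn ℝ (p.S c α) ∧
    ∃ f, p.IsUniqueSolution Reg (p.S c α) f ∧
      (∀ x ∈ p.S c α, ∀ x' ∈ p.S c α, x.2 = x'.2 →
        ∀ i, |f x i - f x' i| ≤ c.Lf n α * dist1 x x') ∧
      (∀ x ∈ p.S c α, ∀ x' ∈ p.S c α, ∀ i, |f x i - f x' i| ≤ c.LUfs n α * dist1 x x')

end Problem

end CharSystem

end

/-! The `i`-th equation prescribes the derivative of `y_i` along the curves with velocity `C_i(x,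
y)`. Each equation has its own family of characteristics, all parametrized by the time `x_m`. Such a
curve is rescaled to `σ ∈ [0,1]`, running from the plane `t = t0` to its end point; this treats both
sides of the plane at once.

Existence. The data are extended to the whole space by clamping coordinates, which preserves every
constant, and the problem is posed on a slab. Given `f`, the Picard operator integrates `D_i(x, f)`
along the characteristics of `C_i(x, f)`. If `λ(τ)` bounds the Lipschitz constant of `f` along
planes at distance `τ`, with `λ' = K(1+nλ)λ + L_D(1+nλ)` and `K = (m-1)L_C`, then the image obeys
the same bound (`GlobalData.picard_slice`). In `μ = 1 + nλ` this is the Bernoulli equation `μ' =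
μ(Kμ + c_1)`. Its explicit solution gives `L_f`, and the locality condition excludes blow-up
(`exists_slice_bound`). On this class the operator is a contraction for the weight `exp(κ|t - t0|)`
with `κ` large. Velocities between `lowC` and `uppC` keep backward characteristics inside `S`, where
clamping changes nothing. Transport along characteristics implies the differential equation wherever
`f` is differentiable, even on the boundary (`Transported.apply_fderivWithin`).

Uniqueness. A competitor `g` is only known to satisfy the system where it is differentiable, and a
given curve may avoid all such points. By Rademacher and Fubini, almost every translate of a curve
meets the bad set at almost no time, and translations can be made small
(`abs_increment_sub_integral_le`). Hence `g` can be followed along the characteristics of `f`. The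
error is at most `Lip(g)·|C(x,f) - C(x,g)|`, and a weighted Gronwall argument gives `f = g`
(`eqOn_of_transported`).

Regularity. Formal differentiation gives a system for the spatial derivatives `p` along the same
characteristics, with a source quadratic in `p`. It is solved with `p` clamped at the Lipschitz
constant `L` of `u`. A Gronwall estimate over pairs of nearby characteristics then shows that `p` is
the spatial derivative of `u` (`remainder_isLittleO`), so that the clamp was inactive. The equation
supplies the time derivative. For higher `r`, the pair `(u, p)` solves a larger system of the same
kind with data of one class less, and one inducts (`QuasilinearSolution.contDiffOn`). -/

open Set Filter Topology MeasureTheory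

noncomputable section

namespace CharSystem

/-! ### Scalar comparison principles for curves in a normed space. -/

section Comparison

variable {F : Type*} [NormedAddCommGroup F] [NormedSpace ℝ F]

/-- Comparison principle: a curve whose speed is at most `a ‖f‖ + β` is dominated by any
supersolution `b` of the corresponding scalar equation. -/
theorem norm_le_of_norm_deriv_le {f f' : ℝ → F} {a β b b' : ℝ → ℝ} {A : ℝ}
    (hf : ∀ σ ∈ Icc (0 : ℝ) 1, HasDerivWithinAt f (f' σ) (Icc 0 1) σ)
    (hb : ∀ σ ∈ Icc (0 : ℝ) 1, HasDerivWithinAt b (b' σ) (Icc 0 1) σ)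
    (h0 : ‖f 0‖ ≤ b 0) (ha : ∀ σ ∈ Icc (0 : ℝ) 1, a σ ≤ A)
    (hbound : ∀ σ ∈ Icc (0 : ℝ) 1, ‖f' σ‖ ≤ a σ * ‖f σ‖ + β σ)
    (hsuper : ∀ σ ∈ Icc (0 : ℝ) 1, a σ * b σ + β σ ≤ b' σ) :
    ∀ σ ∈ Icc (0 : ℝ) 1, ‖f σ‖ ≤ b σ := by
  -- The comparison theorem for curves wants a strict inequality at contact points. The added term
  -- grows at rate `A + 1 > a`, which makes the supersolution strict; afterwards `δ → 0`.
  have key : ∀ δ : ℝ, 0 < δ → ∀ σ ∈ Icc (0 : ℝ) 1,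
      ‖f σ‖ ≤ b σ + δ * Real.exp ((A + 1) * σ) := by
    intro δ hδ
    have hder : ∀ σ, HasDerivAt (fun σ => δ * Real.exp ((A + 1) * σ))
        (δ * (Real.exp ((A + 1) * σ) * (A + 1))) σ := by
      intro σ
      have := ((hasDerivAt_id σ).const_mul (A + 1)).exp.const_mul δ
      simpa using this
    refine fun σ hσ => image_norm_le_of_norm_deriv_right_lt_deriv_boundary' (f' := f')
      (B := fun σ => b σ + δ * Real.exp ((A + 1) * σ))
      (B' := fun σ => b' σ + δ * (Real.exp ((A + 1) * σ) * (A + 1)))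
      (fun σ hσ => (hf σ hσ).continuousWithinAt) ?_ ?_ ?_ ?_ ?_ hσ
    · intro x hx
      exact (hf x (Ico_subset_Icc_self hx)).mono_of_mem_nhdsWithin (Icc_mem_nhdsGE_of_mem hx)
    · simp only [mul_zero, Real.exp_zero, mul_one]
      linarith
    · exact fun x hx => (((hb x hx).continuousWithinAt).add
        (hder x).continuousAt.continuousWithinAt)
    · intro x hx
      exact ((hb x (Ico_subset_Icc_self hx)).mono_of_mem_nhdsWithin
        (Icc_mem_nhdsGE_of_mem hx)).add (hder x).hasDerivWithinAt
    · intro x hx hfx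
      have hx' := Ico_subset_Icc_self hx
      have h1 := hbound x hx'
      have h2 := hsuper x hx'
      have h3 := ha x hx'
      rw [hfx] at h1
      have he : 0 < δ * Real.exp ((A + 1) * x) := by positivity
      have h4 : a x * (δ * Real.exp ((A + 1) * x)) ≤ A * (δ * Real.exp ((A + 1) * x)) := by
        gcongr
      nlinarith
  intro σ hσ
  refine le_of_forall_pos_le_add fun η hη => ?_
  have := key (η / Real.exp ((A + 1) * σ)) (by positivity) σ hσ
  rwa [div_mul_cancel₀ _ (Real.exp_pos _).ne'] at this

theorem hasDerivWithinAt_comp_one_sub {f : ℝ → F} {f' : F} {σ : ℝ}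
    (h : HasDerivWithinAt f f' (Icc 0 1) (1 - σ)) :
    HasDerivWithinAt (fun s => f (1 - s)) (-f') (Icc 0 1) σ := by
  have h1 : HasDerivWithinAt (fun s : ℝ => 1 - s) (-1) (Icc 0 1) σ := by
    simpa using (hasDerivWithinAt_id σ (Icc (0 : ℝ) 1)).const_sub 1
  have := h.scomp σ h1 (fun s hs => ⟨by linarith [hs.2], by linarith [hs.1]⟩)
  simpa [Function.comp_def] using this

/-- The comparison principle, starting from the right end point. -/
theorem norm_le_of_norm_deriv_le_backward {f f' : ℝ → F} {a β b b' : ℝ → ℝ} {A : ℝ}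
    (hf : ∀ σ ∈ Icc (0 : ℝ) 1, HasDerivWithinAt f (f' σ) (Icc 0 1) σ)
    (hb : ∀ σ ∈ Icc (0 : ℝ) 1, HasDerivWithinAt b (b' σ) (Icc 0 1) σ)
    (h1 : ‖f 1‖ ≤ b 1) (ha : ∀ σ ∈ Icc (0 : ℝ) 1, a σ ≤ A)
    (hbound : ∀ σ ∈ Icc (0 : ℝ) 1, ‖f' σ‖ ≤ a σ * ‖f σ‖ + β σ)
    (hsuper : ∀ σ ∈ Icc (0 : ℝ) 1, b' σ ≤ -(a σ * b σ + β σ)) :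
    ∀ σ ∈ Icc (0 : ℝ) 1, ‖f σ‖ ≤ b σ := by
  have hflip : ∀ σ ∈ Icc (0 : ℝ) 1, 1 - σ ∈ Icc (0 : ℝ) 1 :=
    fun s hs => ⟨by linarith [hs.2], by linarith [hs.1]⟩
  intro σ hσ
  have := norm_le_of_norm_deriv_le (f := fun s => f (1 - s)) (f' := fun s => -f' (1 - s))
    (a := fun s => a (1 - s)) (β := fun s => β (1 - s)) (b := fun s => b (1 - s))
    (b' := fun s => -b' (1 - s)) (A := A)
    (fun s hs => hasDerivWithinAt_comp_one_sub (hf _ (hflip s hs)))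
    (fun s hs => hasDerivWithinAt_comp_one_sub (hb _ (hflip s hs)))
    (by simpa using h1) (fun s hs => ha _ (hflip s hs))
    (fun s hs => by simpa using hbound _ (hflip s hs))
    (fun s hs => by linarith [hsuper _ (hflip s hs)]) (1 - σ) (hflip σ hσ)
  simpa using this

theorem norm_sub_le_of_norm_deriv_le {f f' : ℝ → F} {B : ℝ}
    (hf : ∀ σ ∈ Icc (0 : ℝ) 1, HasDerivWithinAt f (f' σ) (Icc 0 1) σ)
    (hbound : ∀ σ ∈ Icc (0 : ℝ) 1, ‖f' σ‖ ≤ B) {ρ σ : ℝ} (hρ : ρ ∈ Icc (0 : ℝ) 1)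
    (hσ : σ ∈ Icc (0 : ℝ) 1) : ‖f σ - f ρ‖ ≤ B * |σ - ρ| :=
  (convex_Icc (0 : ℝ) 1).norm_image_sub_le_of_norm_hasDerivWithin_le hf hbound hρ hσ

/-- Growth of a curve whose speed is bounded by an exponential weight. -/
theorem norm_le_of_norm_deriv_le_exp {f f' : ℝ → F} {τ a b κ : ℝ} (hτ : 0 ≤ τ) (ha : 0 ≤ a)
    (hb : 0 ≤ b) (hκ : 0 < κ)
    (hf : ∀ σ ∈ Icc (0 : ℝ) 1, HasDerivWithinAt f (f' σ) (Icc 0 1) σ)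
    (hbound : ∀ σ ∈ Icc (0 : ℝ) 1, ‖f' σ‖ ≤ τ * (a + b * Real.exp (κ * (σ * τ)))) :
    ∀ σ ∈ Icc (0 : ℝ) 1, ‖f σ‖ ≤ ‖f 0‖ + τ * a + b / κ * Real.exp (κ * (σ * τ)) := by
  intro σ hσ
  have hder : ∀ σ, HasDerivAt (fun σ => ‖f 0‖ + σ * (τ * a) + b / κ * Real.exp (κ * (σ * τ)))
        (τ * (a + b * Real.exp (κ * (σ * τ)))) σ := by
    intro σ
    have h1 := (((hasDerivAt_id σ).mul_const τ).const_mul κ).exp.const_mul (b / κ)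
    have h2 := ((hasDerivAt_id σ).mul_const (τ * a)).const_add ‖f 0‖
    refine (h2.add h1).congr_deriv ?_
    simp only [id, one_mul]
    field_simp
  have := norm_le_of_norm_deriv_le (a := fun _ => 0)
    (β := fun σ => τ * (a + b * Real.exp (κ * (σ * τ)))) (A := 0)
    hf (fun σ _ => (hder σ).hasDerivWithinAt) (by simp; positivity) (by simp)
    (by simpa using hbound) (by simp) σ hσ
  have h3 : σ * (τ * a) ≤ 1 * (τ * a) := by
    have := hσ.2
    gcongr
  linarith

end Comparison

/-! ### Weighted bootstrapping and fixed points. -/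

section Abstract

/-- A bounded nonnegative quantity that reproduces itself up to `η` with half the weight is
bounded by twice `η`. -/
theorem le_of_weighted_bound {A : Type*} {Φ τ : A → ℝ} {η κ M T : ℝ} (hκ : 0 ≤ κ) (hη : 0 ≤ η)
    (hτ : ∀ x, 0 ≤ τ x) (hT : ∀ x, τ x ≤ T) (hM : ∀ x, Φ x ≤ M)
    (h : ∀ B, 0 ≤ B → (∀ x, Φ x ≤ B * Real.exp (κ * τ x)) →
      ∀ x, Φ x ≤ η + B / 2 * Real.exp (κ * τ x)) :
    ∀ x, Φ x ≤ 2 * η * Real.exp (κ * T) := by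
  have hone : ∀ x, 1 ≤ Real.exp (κ * τ x) := fun x =>
    Real.one_le_exp (mul_nonneg hκ (hτ x))
  -- The bound `B_k = 2η + |M|/2^k` improves itself, since `η + B_k/2 = B_{k+1}`; the weight is at
  -- least `1` and so absorbs `η`.
  have key : ∀ k : ℕ, ∀ x, Φ x ≤ (2 * η + |M| / 2 ^ k) * Real.exp (κ * τ x) := by
    intro k
    induction k with
    | zero =>
      intro x
      have h1 := hM x
      have h2 := le_abs_self M
      have h3 : |M| * 1 ≤ |M| * Real.exp (κ * τ x) := by have := hone x; gcongr
      have h4 : 0 ≤ 2 * η * Real.exp (κ * τ x) := by positivity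
      simp only [pow_zero, div_one]
      linarith
    | succ k ih =>
      intro x
      have h1 := h _ (by positivity) ih x
      have h2 : η * 1 ≤ η * Real.exp (κ * τ x) := by have := hone x; gcongr
      calc Φ x ≤ η + (2 * η + |M| / 2 ^ k) / 2 * Real.exp (κ * τ x) := h1
        _ ≤ η * Real.exp (κ * τ x) + (2 * η + |M| / 2 ^ k) / 2 * Real.exp (κ * τ x) := by linarith
        _ = _ := by rw [pow_succ]; ring
  intro x
  have hlim : Tendsto (fun k : ℕ => (2 * η + |M| / 2 ^ k) * Real.exp (κ * τ x)) atTop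
      (𝓝 ((2 * η + 0) * Real.exp (κ * τ x))) := by
    refine (Tendsto.const_add _ ?_).mul_const _
    exact tendsto_const_nhds.div_atTop (tendsto_pow_atTop_atTop_of_one_lt one_lt_two)
  have h1 := ge_of_tendsto' hlim (fun k => key k x)
  have h2 : Real.exp (κ * τ x) ≤ Real.exp (κ * T) := by
    have := hT x
    gcongr
  calc Φ x ≤ _ := h1
    _ ≤ _ := by rw [add_zero]; gcongr

/-- Fixed points of weighted contractions on a class of functions that is closed under weighted
uniform convergence. -/
theorem exists_fixedPoint_of_weighted {X F : Type*} [NormedAddCommGroup F] [CompleteSpace F]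
    (w : X → ℝ) (T : (X → F) → X → F) (P : (X → F) → Prop)
    (hP : ∀ f, P f → P (T f))
    (hclosed : ∀ (u : ℕ → X → F) (f : X → F) (B : ℝ), (∀ k, P (u k)) →
      (∀ k x, ‖f x - u k x‖ ≤ B * (1 / 2) ^ k * w x) → P f)
    (f₀ : X → F) (hf₀ : P f₀) (B₀ : ℝ) (hB₀ : ∀ x, ‖T f₀ x - f₀ x‖ ≤ B₀ * w x)
    (hcontr : ∀ f g B, P f → P g → (∀ x, ‖f x - g x‖ ≤ B * w x) →
      ∀ x, ‖T f x - T g x‖ ≤ B / 2 * w x) :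
    ∃ f, P f ∧ T f = f := by
  set u : ℕ → X → F := fun k => T^[k] f₀ with hu
  have hus : ∀ k, u (k + 1) = T (u k) := fun k => Function.iterate_succ_apply' T k f₀
  have huP : ∀ k, P (u k) := by
    intro k
    induction k with
    | zero => exact hf₀
    | succ k ih => rw [hus]; exact hP _ ih
  have hstep : ∀ k x, ‖u (k + 1) x - u k x‖ ≤ B₀ * w x / 2 ^ k := by
    intro k
    induction k with
    | zero => intro x; simpa [hu] using hB₀ x
    | succ k ih =>
      intro x
      have := hcontr (u (k + 1)) (u k) (B₀ / 2 ^ k) (huP _) (huP _)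
        (fun x => (ih x).trans_eq (by ring)) x
      rw [hus (k + 1), hus k] at *
      refine this.trans_eq ?_
      rw [pow_succ]; ring
  have hdist : ∀ x k, dist (u k x) (u (k + 1) x) ≤ 2 * B₀ * w x / 2 / 2 ^ k := by
    intro x k
    rw [dist_comm, dist_eq_norm]
    exact (hstep k x).trans_eq (by ring)
  have hlim : ∀ x, ∃ y, Tendsto (fun k => u k x) atTop (𝓝 y) := fun x =>
    cauchySeq_tendsto_of_complete (cauchySeq_of_le_geometric_two (hdist x))
  choose f hf using hlim
  have hfu : ∀ k x, ‖f x - u k x‖ ≤ (2 * B₀) * (1 / 2) ^ k * w x := by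
    intro k x
    have := dist_le_of_le_geometric_two_of_tendsto (hdist x) (hf x) k
    rw [dist_comm, dist_eq_norm] at this
    refine this.trans_eq ?_
    rw [one_div, inv_pow]; ring
  have hPf := hclosed u f _ huP hfu
  refine ⟨f, hPf, funext fun x => ?_⟩
  refine tendsto_nhds_unique (f := fun k => u (k + 1) x) (l := atTop) ?_
    ((tendsto_add_atTop_iff_nat 1).2 (hf x))
  rw [tendsto_iff_norm_sub_tendsto_zero]
  have hb : ∀ k, ‖u (k + 1) x - T f x‖ ≤ (2 * B₀ * w x / 2) * (1 / 2) ^ k := by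
    intro k
    rw [hus, norm_sub_rev]
    refine (hcontr f (u k) _ hPf (huP k) (hfu k) x).trans_eq ?_
    ring
  refine squeeze_zero (fun _ => norm_nonneg _) hb ?_
  simpa using (tendsto_pow_atTop_nhds_zero_of_lt_one (by norm_num : (0 : ℝ) ≤ 1 / 2)
    (by norm_num)).const_mul (2 * B₀ * w x / 2)

end Abstract

/-! ### Characteristics: existence, restriction, dependence on the end point. -/

section Characteristics

set_option linter.unusedSectionVars false

variable {E : Type*} [NormedAddCommGroup E] [NormedSpace ℝ E]

/-- The point at parameter `σ` on the curve `Y` that joins the initial plane to `z`. -/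
def pt (t0 : ℝ) (z : E × ℝ) (Y : ℝ → E) (σ : ℝ) : E × ℝ := (Y σ, t0 + σ * (z.2 - t0))

/-- `Y` is the characteristic of the velocity field `c` that ends at `z`, with time rescaled such
that it starts in the plane `{t = t0}` at parameter `0` and reaches `z` at parameter `1`. -/
structure IsChar (t0 : ℝ) (c : E × ℝ → E) (z : E × ℝ) (Y : ℝ → E) : Prop where
  end_eq : Y 1 = z.1
  deriv : ∀ σ ∈ Icc (0 : ℝ) 1,
    HasDerivWithinAt Y ((z.2 - t0) • c (pt t0 z Y σ)) (Icc 0 1) σ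

/-- All characteristics that end in `S` exist and stay in `S`. -/
structure CharDomain (t0 : ℝ) (S : Set (E × ℝ)) (c : E × ℝ → E) : Prop where
  exists_char : ∀ z ∈ S, ∃ Y, IsChar t0 c z Y
  mem : ∀ z ∈ S, ∀ Y, IsChar t0 c z Y → ∀ σ ∈ Icc (0 : ℝ) 1, pt t0 z Y σ ∈ S
  lip : ∃ K, LipschitzOnWith K c S

/-- `w` has derivative `D` along the characteristics of `c` in `S`. -/
def Transported (t0 : ℝ) (S : Set (E × ℝ)) (c : E × ℝ → E) (D w : E × ℝ → ℝ) : Prop :=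
  ∀ z ∈ S, ∀ Y, IsChar t0 c z Y → ∀ σ ∈ Icc (0 : ℝ) 1,
    HasDerivWithinAt (fun s => w (pt t0 z Y s)) ((z.2 - t0) * D (pt t0 z Y σ)) (Icc 0 1) σ

/-- The layer of half-height `α` around the initial plane. -/
def slab (E : Type*) (t0 α : ℝ) : Set (E × ℝ) := {z | |z.2 - t0| ≤ α}

variable {t0 α : ℝ} {S : Set (E × ℝ)} {c : E × ℝ → E} {z z' : E × ℝ} {Y Y' : ℝ → E} {σ ρ : ℝ}

@[simp] theorem pt_fst : (pt t0 z Y σ).1 = Y σ := rfl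

@[simp] theorem pt_snd : (pt t0 z Y σ).2 = t0 + σ * (z.2 - t0) := rfl

theorem pt_snd_sub : (pt t0 z Y σ).2 - t0 = σ * (z.2 - t0) := by simp

theorem abs_pt_snd_sub (hσ : σ ∈ Icc (0 : ℝ) 1) :
    |(pt t0 z Y σ).2 - t0| = σ * |z.2 - t0| := by
  rw [pt_snd_sub, abs_mul, abs_of_nonneg hσ.1]

theorem IsChar.pt_one (h : IsChar t0 c z Y) : pt t0 z Y 1 = z := by
  ext1 <;> simp [h.end_eq]

theorem pt_zero : pt t0 z Y 0 = (Y 0, t0) := by simp [pt]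

theorem IsChar.continuousOn (h : IsChar t0 c z Y) : ContinuousOn Y (Icc 0 1) :=
  fun σ hσ => (h.deriv σ hσ).continuousWithinAt

theorem IsChar.continuousOn_pt (h : IsChar t0 c z Y) :
    ContinuousOn (pt t0 z Y) (Icc 0 1) :=
  h.continuousOn.prodMk (by fun_prop)

theorem mul_mem_unit {a b : ℝ} (ha : a ∈ Icc (0 : ℝ) 1) (hb : b ∈ Icc (0 : ℝ) 1) :
    a * b ∈ Icc (0 : ℝ) 1 :=
  ⟨mul_nonneg ha.1 hb.1, mul_le_one₀ ha.2 hb.1 hb.2⟩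

theorem pt_pt : pt t0 (pt t0 z Y ρ) (fun s => Y (ρ * s)) σ = pt t0 z Y (ρ * σ) := by
  ext1 <;> simp; ring

/-- A part of a characteristic is a characteristic. -/
theorem IsChar.restrict (h : IsChar t0 c z Y) (hρ : ρ ∈ Icc (0 : ℝ) 1) :
    IsChar t0 c (pt t0 z Y ρ) (fun s => Y (ρ * s)) := by
  refine ⟨by simp, fun σ hσ => ?_⟩
  have h1 : HasDerivWithinAt (fun s : ℝ => ρ * s) ρ (Icc 0 1) σ := by
    simpa using (hasDerivWithinAt_id σ (Icc (0 : ℝ) 1)).const_mul ρ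
  have := (h.deriv _ (mul_mem_unit hρ hσ)).scomp σ h1 (fun s hs => mul_mem_unit hρ hs)
  rw [smul_smul] at this
  rwa [pt_snd_sub, pt_pt]

/-- The slab is unrestricted in space and the speed is bounded, so the Picard–Lindelöf ball can have
radius equal to the total speed. The solution therefore exists on all of `[0,1]`, started from the
right end. -/
theorem exists_char_slab [CompleteSpace E] {K : NNReal} {M : ℝ}
    (hc : LipschitzOnWith K c (slab E t0 α)) (hM : ∀ z ∈ slab E t0 α, ‖c z‖ ≤ M)
    (hz : z ∈ slab E t0 α) : ∃ Y, IsChar t0 c z Y := by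
  have hmem : ∀ s ∈ Icc (0 : ℝ) 1, ∀ y : E, (y, t0 + s * (z.2 - t0)) ∈ slab E t0 α := by
    intro s hs y
    change |t0 + s * (z.2 - t0) - t0| ≤ α
    rw [add_sub_cancel_left, abs_mul, abs_of_nonneg hs.1]
    exact (mul_le_of_le_one_left (abs_nonneg _) hs.2).trans hz
  have hM0 : 0 ≤ M := (norm_nonneg _).trans (hM z hz)
  have hPL : IsPicardLindelof (fun s y => (z.2 - t0) • c (y, t0 + s * (z.2 - t0)))
      (tmin := 0) (tmax := 1) ⟨1, by simp⟩ z.1 (‖z.2 - t0‖₊ * M.toNNReal) 0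
      (‖z.2 - t0‖₊ * M.toNNReal) (‖z.2 - t0‖₊ * K) := by
    refine ⟨?_, ?_, ?_, ?_⟩
    · intro s hs
      refine LipschitzOnWith.of_dist_le_mul fun y _ y' _ => ?_
      have h1 := hc.dist_le_mul _ (hmem s hs y) _ (hmem s hs y')
      rw [Prod.dist_eq, dist_self, max_eq_left dist_nonneg] at h1
      rw [dist_smul₀, NNReal.coe_mul, coe_nnnorm, mul_assoc]
      gcongr
    · intro y _
      refine ContinuousOn.const_smul (hc.continuousOn.comp (by fun_prop) fun s hs => hmem s hs y) _
    · intro s hs y _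
      rw [norm_smul, NNReal.coe_mul, coe_nnnorm, Real.coe_toNNReal _ hM0]
      have := hM _ (hmem s hs y)
      gcongr
    · simp
  obtain ⟨Y, hY1, hY⟩ := hPL.exists_eq_forall_mem_Icc_hasDerivWithinAt₀
  exact ⟨Y, hY1, fun σ hσ => hY σ hσ⟩

theorem charDomain_slab [CompleteSpace E] {K : NNReal} {M : ℝ}
    (hc : LipschitzOnWith K c (slab E t0 α)) (hM : ∀ z ∈ slab E t0 α, ‖c z‖ ≤ M) :
    CharDomain t0 (slab E t0 α) c := by
  refine ⟨fun z hz => exists_char_slab hc hM hz, fun z hz Y _ σ hσ => ?_, K, hc⟩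
  change |(pt t0 z Y σ).2 - t0| ≤ α
  rw [abs_pt_snd_sub hσ]
  exact (mul_le_of_le_one_left (abs_nonneg _) hσ.2).trans hz

theorem norm_sub_le_of_lip {K : NNReal} {F : Type*} [NormedAddCommGroup F] {c : E × ℝ → F}
    (hc : LipschitzOnWith K c S)
    {p q : E × ℝ} (hp : p ∈ S) (hq : q ∈ S) :
    ‖c p - c q‖ ≤ K * (‖p.1 - q.1‖ + |p.2 - q.2|) := by
  have := hc.dist_le_mul _ hp _ hq
  rw [dist_eq_norm, dist_eq_norm] at this
  refine this.trans ?_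
  gcongr
  rw [Prod.norm_def]
  exact max_le (by simp) (by simp)

/-- Lipschitz dependence of characteristics on their end points. -/
theorem IsChar.norm_sub_le {K : NNReal} {M : ℝ} (hc : LipschitzOnWith K c S)
    (hM : ∀ z ∈ S, ‖c z‖ ≤ M) (hz : |z.2 - t0| ≤ α)
    (hY : IsChar t0 c z Y) (hY' : IsChar t0 c z' Y')
    (hmem : ∀ σ ∈ Icc (0 : ℝ) 1, pt t0 z Y σ ∈ S)
    (hmem' : ∀ σ ∈ Icc (0 : ℝ) 1, pt t0 z' Y' σ ∈ S) :
    ∀ σ ∈ Icc (0 : ℝ) 1, ‖Y σ - Y' σ‖ ≤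
      (‖z.1 - z'.1‖ + |z.2 - z'.2| * (α * K + M)) * Real.exp (α * K * (1 - σ)) := by
  have hα : 0 ≤ α := (abs_nonneg _).trans hz
  have hM0 : 0 ≤ M := (norm_nonneg _).trans (hM _ (hmem 0 (by simp)))
  -- At equal parameters the two points sit at different times, which costs `α * K` through the
  -- field, and the rescaling factors `z.2 - t0` differ, which costs `M`.
  set β := |z.2 - z'.2| * (α * K + M) with hβ
  have hβ0 : 0 ≤ β := by positivity
  intro σ hσ
  have := norm_le_of_norm_deriv_le_backward (f := fun s => Y s - Y' s) (a := fun _ => α * K)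
    (f' := fun s => (z.2 - t0) • c (pt t0 z Y s) - (z'.2 - t0) • c (pt t0 z' Y' s))
    (β := fun _ => β) (A := α * K)
    (b := fun s => (‖z.1 - z'.1‖ + (1 - s) * β) * Real.exp (α * K * (1 - s)))
    (b' := fun s => -β * Real.exp (α * K * (1 - s)) +
      (‖z.1 - z'.1‖ + (1 - s) * β) * (Real.exp (α * K * (1 - s)) * (-(α * K))))
    (fun s hs => (hY.deriv s hs).sub (hY'.deriv s hs)) ?_ ?_ (fun _ _ => le_rfl) ?_ ?_ σ hσ
  · refine this.trans ?_
    have : (1 - σ) * β ≤ 1 * β := by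
      have := hσ.1
      gcongr
      linarith
    gcongr
    linarith
  · intro s _
    have h1 := (((hasDerivAt_id s).const_sub 1).mul_const β).const_add ‖z.1 - z'.1‖
    have h2 := (((hasDerivAt_id s).const_sub 1).const_mul (α * K)).exp
    refine ((h1.mul h2).hasDerivWithinAt).congr_deriv ?_
    simp
  · simp [hY.end_eq, hY'.end_eq]
  · intro s hs
    have e : (z.2 - t0) • c (pt t0 z Y s) - (z'.2 - t0) • c (pt t0 z' Y' s) =
        (z.2 - t0) • (c (pt t0 z Y s) - c (pt t0 z' Y' s)) +
          (z.2 - z'.2) • c (pt t0 z' Y' s) := by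
      rw [smul_sub, sub_smul, sub_smul, sub_smul, sub_smul]; abel
    have h1 := norm_sub_le_of_lip hc (hmem s hs) (hmem' s hs)
    have h2 : |(pt t0 z Y s).2 - (pt t0 z' Y' s).2| ≤ |z.2 - z'.2| := by
      have : (pt t0 z Y s).2 - (pt t0 z' Y' s).2 = s * (z.2 - z'.2) := by simp; ring
      rw [this, abs_mul, abs_of_nonneg hs.1]
      exact mul_le_of_le_one_left (abs_nonneg _) hs.2
    rw [pt_fst, pt_fst] at h1
    rw [e]
    calc _ ≤ ‖z.2 - t0‖ * ‖c (pt t0 z Y s) - c (pt t0 z' Y' s)‖ +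
          ‖z.2 - z'.2‖ * ‖c (pt t0 z' Y' s)‖ := by
            refine (norm_add_le _ _).trans_eq ?_
            rw [norm_smul, norm_smul]
      _ ≤ α * (K * (‖Y s - Y' s‖ + |z.2 - z'.2|)) + |z.2 - z'.2| * M := by
          have := hM _ (hmem' s hs)
          have h3 := h1.trans (mul_le_mul_of_nonneg_left (add_le_add_right h2 _) K.2)
          have h4 : ‖z.2 - t0‖ ≤ α := hz
          exact add_le_add (mul_le_mul h4 h3 (norm_nonneg _) hα)
            (mul_le_mul_of_nonneg_left this (abs_nonneg _))
      _ = _ := by rw [hβ]; ring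
  · intro s hs
    have h1 : 1 ≤ Real.exp (α * K * (1 - s)) :=
      Real.one_le_exp (mul_nonneg (by positivity) (by linarith [hs.2]))
    have h2 : β * 1 ≤ β * Real.exp (α * K * (1 - s)) := by gcongr
    linarith

/-- Characteristics with end points in the same plane separate at most exponentially. -/
theorem IsChar.norm_sub_le_of_eq {K : NNReal} {M : ℝ} (hc : LipschitzOnWith K c S)
    (hM : ∀ z ∈ S, ‖c z‖ ≤ M) (hzz : z.2 = z'.2)
    (hY : IsChar t0 c z Y) (hY' : IsChar t0 c z' Y')
    (hmem : ∀ σ ∈ Icc (0 : ℝ) 1, pt t0 z Y σ ∈ S)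
    (hmem' : ∀ σ ∈ Icc (0 : ℝ) 1, pt t0 z' Y' σ ∈ S) :
    ∀ σ ∈ Icc (0 : ℝ) 1, ‖Y σ - Y' σ‖ ≤
      ‖z.1 - z'.1‖ * Real.exp (|z.2 - t0| * K * (1 - σ)) := by
  simpa [hzz] using IsChar.norm_sub_le hc hM le_rfl hY hY' hmem hmem'

end Characteristics

/-! ### Integration of a source along characteristics. -/

section Duhamel

variable {E : Type*} [NormedAddCommGroup E] [NormedSpace ℝ E]
  {t0 : ℝ} {S : Set (E × ℝ)} {c : E × ℝ → E} {z z' : E × ℝ} {Y Y' : ℝ → E}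

/-- Characteristics in `S` are determined by their end points. -/
theorem CharDomain.eqOn (h : CharDomain t0 S c) (hb : ∃ M, ∀ z ∈ S, ‖c z‖ ≤ M) (hz : z ∈ S)
    (hY : IsChar t0 c z Y) (hY' : IsChar t0 c z Y') : EqOn Y Y' (Icc 0 1) := by
  obtain ⟨K, hK⟩ := h.lip
  obtain ⟨M, hM⟩ := hb
  intro σ hσ
  have := IsChar.norm_sub_le_of_eq hK hM rfl hY hY' (h.mem z hz Y hY) (h.mem z hz Y' hY') σ hσ
  rw [sub_self, norm_zero, zero_mul] at this
  exact sub_eq_zero.1 (norm_le_zero_iff.1 this)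

open Classical in
/-- The characteristic of `c` that ends at `z`. -/
def flow (t0 : ℝ) (c : E × ℝ → E) (z : E × ℝ) : ℝ → E :=
  if h : ∃ Y, IsChar t0 c z Y then h.choose else fun _ => z.1

theorem CharDomain.isChar_flow (h : CharDomain t0 S c) (hz : z ∈ S) :
    IsChar t0 c z (flow t0 c z) := by
  rw [flow, dif_pos (h.exists_char z hz)]
  exact (h.exists_char z hz).choose_spec

/-- The function with initial values `J` and derivative `g` along the characteristics of `c`. -/
def duhamel (t0 : ℝ) (c : E × ℝ → E) (J : E → ℝ) (g : E × ℝ → ℝ) (z : E × ℝ) : ℝ :=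
  J (flow t0 c z 0) + (z.2 - t0) * ∫ σ in (0 : ℝ)..1, g (pt t0 z (flow t0 c z) σ)

/-- By uniqueness, the characteristic ending at a point of `Y` is a rescaled part of `Y`. The
integral at parameter `ρ` is thus the integral of one fixed function over `[0, ρ]`, and the
fundamental theorem of calculus applies. -/
theorem CharDomain.transported_duhamel (h : CharDomain t0 S c) (hb : ∃ M, ∀ z ∈ S, ‖c z‖ ≤ M)
    {J : E → ℝ} {g : E × ℝ → ℝ} (hg : ContinuousOn g S) :
    Transported t0 S c g (duhamel t0 c J g) := by
  intro z hz Y hY σ hσ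
  have hgc : ContinuousOn (fun s => g (pt t0 z Y s)) (Icc 0 1) :=
    hg.comp hY.continuousOn_pt (h.mem z hz Y hY)
  -- The constant extension beyond `[0,1]` makes the integrand continuous on the line, so that
  -- differentiation at the end points needs no separate treatment.
  set G : ℝ → ℝ := IccExtend zero_le_one ((Icc (0 : ℝ) 1).domRestrict fun s => g (pt t0 z Y s))
    with hG
  have hGc : Continuous G := Continuous.Icc_extend' (continuousOn_iff_continuous_domRestrict.1 hgc)
  have hGe : ∀ s ∈ Icc (0 : ℝ) 1, G s = g (pt t0 z Y s) := fun s hs => by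
    rw [hG, IccExtend_of_mem _ _ hs]; rfl
  have hval : ∀ ρ ∈ Icc (0 : ℝ) 1, duhamel t0 c J g (pt t0 z Y ρ) =
      J (Y 0) + (z.2 - t0) * ∫ s in (0 : ℝ)..ρ, G s := by
    intro ρ hρ
    have heq := h.eqOn hb (h.mem z hz Y hY ρ hρ) (h.isChar_flow (h.mem z hz Y hY ρ hρ))
      (hY.restrict hρ)
    have h1 : ∫ s in (0 : ℝ)..1, g (pt t0 (pt t0 z Y ρ) (flow t0 c (pt t0 z Y ρ)) s) =
        ∫ s in (0 : ℝ)..1, G (ρ * s) := by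
      refine intervalIntegral.integral_congr fun s hs => ?_
      rw [uIcc_of_le zero_le_one] at hs
      rw [hGe _ (mul_mem_unit hρ hs), ← pt_pt (ρ := ρ)]
      congr 1
      ext1
      · exact heq hs
      · rfl
    rw [duhamel, heq (by simp), h1, pt_snd_sub]
    simp only [mul_zero]
    rw [mul_comm ρ, mul_assoc,
      intervalIntegral.mul_integral_comp_mul_left, mul_zero,
      mul_one]
  have hd : HasDerivAt (fun ρ => J (Y 0) + (z.2 - t0) * ∫ s in (0 : ℝ)..ρ, G s)
      ((z.2 - t0) * G σ) σ :=
    ((hGc.integral_hasStrictDerivAt 0 σ).hasDerivAt.const_mul _).const_add _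
  rw [← hGe σ hσ]
  exact hd.hasDerivWithinAt.congr hval (hval σ hσ)

/-- For `z.2 = t0` the rescaled velocity vanishes, so the characteristic is constant and the
integral carries the factor zero. -/
theorem CharDomain.duhamel_initial (h : CharDomain t0 S c) {J : E → ℝ} {g : E × ℝ → ℝ}
    (hz : z ∈ S) (hz0 : z.2 = t0) : duhamel t0 c J g z = J z.1 := by
  have hY := h.isChar_flow hz
  have : flow t0 c z 0 = flow t0 c z 1 := by
    have := norm_sub_le_of_norm_deriv_le (B := 0) hY.deriv (fun σ _ => by simp [hz0])
      (ρ := 1) (σ := 0) (by simp) (by simp)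
    rw [zero_mul] at this
    exact sub_eq_zero.1 (norm_le_zero_iff.1 this)
  rw [duhamel, this, hY.end_eq, hz0]
  simp

end Duhamel

/-! ### The Bernoulli equation for the Lipschitz constant along planes. -/

section Riccati

/-- The solution of the Bernoulli equation that governs the Lipschitz constants, together with the
factor `v` by which distances of characteristics change. -/
theorem exists_slice_bound {K LD LI c1 α n : ℝ} (hn : 0 < n) (hK : 0 ≤ K) (hLD : 0 ≤ LD)
    (hLI : 0 ≤ LI) (hc1 : c1 = n * LD - K)
    (hq : K * (1 + n * LI) * α * Real.exp (step c1 * c1 * α) < 1) :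
    ∃ v lam : ℝ → ℝ, (∀ τ ∈ Icc 0 α, 0 < v τ) ∧
      (∀ τ ∈ Icc 0 α, HasDerivAt v (-(K * (1 + n * lam τ) * v τ)) τ) ∧
      (∀ τ ∈ Icc 0 α, HasDerivAt lam (K * (1 + n * lam τ) * lam τ + LD * (1 + n * lam τ)) τ) ∧
      lam 0 = LI ∧ ∀ τ ∈ Icc 0 α, 0 ≤ lam τ ∧ lam τ ≤
        ((1 + n * LI) * Real.exp (c1 * α) /
          (1 - K * (1 + n * LI) * α * Real.exp (step c1 * c1 * α)) - 1) / n := by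
  -- With `μ = 1 + n λ` the equation is `μ' = μ(Kμ + c1)`, solved by `μ = μ0 e^{c1 τ} / v` with `v =
  -- 1 - K μ0 φ` and `φ` the integral of `e^{c1 s}`. The same `v` satisfies `v' = -K μ v`.
  set μ0 := 1 + n * LI with hμ0
  have hμ1 : 1 ≤ μ0 := by have : 0 ≤ n * LI := by positivity
                          linarith
  set φ : ℝ → ℝ := fun τ => ∫ s in (0 : ℝ)..τ, Real.exp (c1 * s) with hφ
  have hφd : ∀ τ, HasDerivAt φ (Real.exp (c1 * τ)) τ := fun τ =>
    ((by fun_prop : Continuous fun s => Real.exp (c1 * s)).integral_hasStrictDerivAt 0 τ).hasDerivAt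
  have hφ0 : φ 0 = 0 := by simp [hφ]
  -- The factor `exp(step c1 * c1 * α)` is the maximum of `e^{c1 s}` on `[0, α]`: the value at `α`
  -- if `c1 ≥ 0`, the value `1` at zero otherwise.
  have hφle : ∀ τ ∈ Icc 0 α, φ τ ≤ α * Real.exp (step c1 * c1 * α) := by
    intro τ hτ
    have h1 : φ τ ≤ ∫ _ in (0 : ℝ)..τ, Real.exp (step c1 * c1 * α) := by
      refine intervalIntegral.integral_mono_on hτ.1
        ((by fun_prop : Continuous fun s => Real.exp (c1 * s)).intervalIntegrable _ _)
        (by simp) fun s hs => ?_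
      refine Real.exp_le_exp.2 ?_
      rw [step]
      split_ifs with h
      · rw [one_mul]
        exact mul_le_mul_of_nonneg_left (hs.2.trans hτ.2) h
      · rw [zero_mul, zero_mul]
        exact mul_nonpos_of_nonpos_of_nonneg (not_le.1 h).le hs.1
    rw [intervalIntegral.integral_const, smul_eq_mul, sub_zero] at h1
    exact h1.trans (mul_le_mul_of_nonneg_right hτ.2 (Real.exp_pos _).le)
  set v : ℝ → ℝ := fun τ => 1 - K * μ0 * φ τ with hv
  have hvd : ∀ τ, HasDerivAt v (-(K * μ0 * Real.exp (c1 * τ))) τ := fun τ =>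
    ((hφd τ).const_mul (K * μ0)).const_sub 1
  have hvge : ∀ τ ∈ Icc 0 α, 1 - K * μ0 * α * Real.exp (step c1 * c1 * α) ≤ v τ := by
    intro τ hτ
    have : K * μ0 * φ τ ≤ K * μ0 * (α * Real.exp (step c1 * c1 * α)) :=
      mul_le_mul_of_nonneg_left (hφle τ hτ) (by positivity)
    simp only [hv]
    linarith
  have hvpos : ∀ τ ∈ Icc 0 α, 0 < v τ := fun τ hτ => by linarith [hvge τ hτ]
  set μ : ℝ → ℝ := fun τ => μ0 * Real.exp (c1 * τ) / v τ with hμ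
  have hμd : ∀ τ ∈ Icc 0 α, HasDerivAt μ (μ τ * (K * μ τ + c1)) τ := by
    intro τ hτ
    have hv0 := (hvpos τ hτ).ne'
    have h1 := ((((hasDerivAt_id τ).const_mul c1).exp.const_mul μ0).div (hvd τ) hv0)
    refine h1.congr_deriv ?_
    simp only [hμ, id]
    field_simp
    ring
  have hμge : ∀ τ ∈ Icc 0 α, 1 ≤ μ τ := by
    intro τ hτ
    rw [hμ]
    simp only
    rw [one_le_div (hvpos τ hτ)]
    -- `μ ≥ 1` means `μ0 (e^{c1 τ} + K φ) ≥ 1`. The bracket equals `1` at zero and has derivative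
    -- `(c1 + K) e^{c1 τ} = n LD e^{c1 τ} ≥ 0`.
    have hmono : Monotone fun τ => Real.exp (c1 * τ) + K * φ τ := by
      have hd : ∀ τ, HasDerivAt (fun τ => Real.exp (c1 * τ) + K * φ τ)
          (Real.exp (c1 * τ) * c1 + K * Real.exp (c1 * τ)) τ := fun τ => by
        exact (((hasDerivAt_id τ).const_mul c1).exp.add ((hφd τ).const_mul K)).congr_deriv (by simp)
      refine monotone_of_deriv_nonneg (fun τ => (hd τ).differentiableAt) fun τ => ?_
      rw [(hd τ).deriv]
      have : 0 ≤ c1 + K := by rw [hc1]; have : 0 ≤ n * LD := by positivity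
                              linarith
      nlinarith [Real.exp_pos (c1 * τ)]
    have h1 := hmono hτ.1
    simp only [mul_zero, Real.exp_zero, hφ0, add_zero] at h1
    simp only [hv]
    nlinarith
  have hμle : ∀ τ ∈ Icc 0 α, μ τ ≤ μ0 * Real.exp (c1 * α) /
      (1 - K * μ0 * α * Real.exp (step c1 * c1 * α)) := by
    intro τ hτ
    -- From `μ ≥ 1` one gets `Kμ + c1 ≥ K + c1 = n LD ≥ 0`, so `μ` increases and is largest at `α`.
    have hmono : MonotoneOn μ (Icc 0 α) := by
      refine monotoneOn_of_deriv_nonneg (convex_Icc 0 α)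
        (fun τ hτ => (hμd τ hτ).continuousAt.continuousWithinAt)
        (fun τ hτ => (hμd τ (interior_subset hτ)).differentiableAt.differentiableWithinAt)
        fun τ hτ => ?_
      have hτ' := interior_subset hτ
      rw [(hμd τ hτ').deriv]
      have h1 := hμge τ hτ'
      refine mul_nonneg (by linarith) ?_
      have h2 : K * 1 ≤ K * μ τ := by gcongr
      rw [hc1]
      have : 0 ≤ n * LD := by positivity
      linarith
    have hα : α ∈ Icc 0 α := ⟨hτ.1.trans hτ.2, le_rfl⟩
    refine (hmono hτ hα hτ.2).trans ?_
    have h1 := hvge α hα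
    simp only [hμ]
    gcongr
  have hlam : ∀ τ, 1 + n * ((μ τ - 1) / n) = μ τ := fun τ => by field_simp; ring
  refine ⟨v, fun τ => (μ τ - 1) / n, hvpos, fun τ hτ => ?_, fun τ hτ => ?_, ?_, fun τ hτ => ?_⟩
  · refine (hvd τ).congr_deriv ?_
    rw [hlam]
    simp only [hμ]
    have := (hvpos τ hτ).ne'
    field_simp
  · refine (((hμd τ hτ).sub_const 1).div_const n).congr_deriv ?_
    rw [hlam, hc1]
    field_simp
    ring
  · simp [hμ, hv, hφ0, hμ0, hn.ne']
  · have := hμge τ hτ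
    exact ⟨div_nonneg (by linarith) hn.le, 
      div_le_div_of_nonneg_right (sub_le_sub_right (hμle τ hτ) 1) hn.le⟩

end Riccati

/-! ### The 1-norm, and Lipschitz bounds from planes and characteristics. -/

section Distances

variable {m n : ℕ}

theorem dist1_nonneg (z z' : Dom m) : 0 ≤ dist1 z z' :=
  add_nonneg (Finset.sum_nonneg fun _ _ => abs_nonneg _) (abs_nonneg _)

theorem dist1_comm (z z' : Dom m) : dist1 z z' = dist1 z' z := by
  simp [dist1, abs_sub_comm]

theorem norm_sub_le_dist1 (z z' : Dom m) : ‖z - z'‖ ≤ dist1 z z' := by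
  rw [Prod.norm_def]
  have h1 : 0 ≤ ∑ l, |z.1 l - z'.1 l| := Finset.sum_nonneg fun _ _ => abs_nonneg _
  refine max_le ((pi_norm_le_iff_of_nonneg (dist1_nonneg z z')).2 fun l => ?_) ?_
  · have := Finset.single_le_sum (f := fun l => |z.1 l - z'.1 l|) (fun _ _ => abs_nonneg _)
      (Finset.mem_univ l)
    have h2 := abs_nonneg (z.2 - z'.2)
    rw [dist1]
    exact this.trans (by linarith)
  · rw [dist1]
    simpa using h1

theorem dist1_le_norm_sub (z z' : Dom m) : dist1 z z' ≤ ((m - 1 : ℕ) + 1) * ‖z - z'‖ := by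
  have h1 : ∑ l, |z.1 l - z'.1 l| ≤ ∑ _l : Fin (m - 1), ‖z - z'‖ :=
    Finset.sum_le_sum fun l _ => (norm_le_pi_norm (z.1 - z'.1) l).trans (norm_fst_le (z - z'))
  have h2 : |z.2 - z'.2| ≤ ‖z - z'‖ := norm_snd_le (z - z')
  rw [Finset.sum_const, Finset.card_univ, Fintype.card_fin, nsmul_eq_mul] at h1
  rw [dist1]
  linarith

theorem dist1_of_snd_eq {z z' : Dom m} (h : z.2 = z'.2) :
    dist1 z z' = ∑ l, |z.1 l - z'.1 l| := by
  simp [dist1, h]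

/-- The explicit constants refer to the 1-norm, whereas `Fin d → ℝ` carries the maximum norm.
Passing to `WithLp 1` lets the comparison principles act on the sum of the coordinate differences.
-/
theorem norm_toLp_one {d : ℕ} (x : Fin d → ℝ) : ‖WithLp.toLp 1 x‖ = ∑ l, |x l| := by
  simp [PiLp.norm_eq_of_L1]

theorem hasDerivWithinAt_toLp_one {d : ℕ} {f : ℝ → Fin d → ℝ} {f' : Fin d → ℝ} {s : Set ℝ} {σ : ℝ}
    (h : HasDerivWithinAt f f' s σ) :
    HasDerivWithinAt (fun s => WithLp.toLp 1 (f s)) (WithLp.toLp 1 f') s σ :=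
  ((PiLp.continuousLinearEquiv 1 ℝ
    (fun _ : Fin d => ℝ)).symm.toContinuousLinearMap.hasFDerivAt).comp_hasDerivWithinAt σ h

/-- A function that is Lipschitz along planes and along characteristics is Lipschitz. -/
theorem abs_sub_le_of_slice {S : Set (Dom m)} {t0 : ℝ} {w : Dom m → ℝ} {Λ M N : ℝ} (hΛ : 0 ≤ Λ)
    (hM : 0 ≤ M) (hN : 0 ≤ N)
    (hslice : ∀ z ∈ S, ∀ z' ∈ S, z.2 = z'.2 → |w z - w z'| ≤ Λ * dist1 z z')
    (hchar : ∀ z ∈ S, ∀ ρ ∈ Icc (0 : ℝ) 1, ∃ y, (y, t0 + ρ * (z.2 - t0)) ∈ S ∧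
      |w z - w (y, t0 + ρ * (z.2 - t0))| ≤ M * ((1 - ρ) * |z.2 - t0|) ∧
      ∑ l, |z.1 l - y l| ≤ N * ((1 - ρ) * |z.2 - t0|)) :
    ∀ z ∈ S, ∀ z' ∈ S, |w z - w z'| ≤ max Λ (M + Λ * N) * dist1 z z' := by
  have hmax : 0 ≤ M + Λ * N := by positivity
  -- Both points slide back along characteristics to a common time and are compared in that plane.
  -- Sliding for time `A` changes `w` by `M A` and the position by `N A`, which produces `M + Λ N`,
  -- provided the total sliding time is at most the time difference.
  have main : ∀ z ∈ S, ∀ z' ∈ S, ∀ ρ ∈ Icc (0 : ℝ) 1, ∀ ρ' ∈ Icc (0 : ℝ) 1,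
      ρ * (z.2 - t0) = ρ' * (z'.2 - t0) →
      (1 - ρ) * |z.2 - t0| + (1 - ρ') * |z'.2 - t0| ≤ |z.2 - z'.2| →
      |w z - w z'| ≤ max Λ (M + Λ * N) * dist1 z z' := by
    intro z hz z' hz' ρ hρ ρ' hρ' heq hle
    obtain ⟨y, hy, hw, hd⟩ := hchar z hz ρ hρ
    obtain ⟨y', hy', hw', hd'⟩ := hchar z' hz' ρ' hρ'
    rw [← heq] at hy' hw'
    have h1 := hslice _ hy _ hy' rfl
    simp only [dist1, sub_self, abs_zero, add_zero] at h1
    have h2 : ∑ l, |y l - y' l| ≤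
        ∑ l, |z.1 l - y l| + (∑ l, |z.1 l - z'.1 l| + ∑ l, |z'.1 l - y' l|) := by
      rw [← Finset.sum_add_distrib, ← Finset.sum_add_distrib]
      refine Finset.sum_le_sum fun l _ => ?_
      have e : y l - y' l = -(z.1 l - y l) + ((z.1 l - z'.1 l) + (z'.1 l - y' l)) := by ring
      rw [e]
      refine (abs_add_le _ _).trans ?_
      rw [abs_neg]
      gcongr
      exact abs_add_le _ _
    set A := (1 - ρ) * |z.2 - t0|
    set A' := (1 - ρ') * |z'.2 - t0|
    set X := ∑ l, |z.1 l - z'.1 l|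
    have hX : 0 ≤ X := Finset.sum_nonneg fun _ _ => abs_nonneg _
    have h3 : |w z - w z'| ≤ M * A + Λ * (N * A + (X + N * A')) + M * A' := by
      have e : w z - w z' = (w z - w (y, t0 + ρ * (z.2 - t0))) +
        (w (y, t0 + ρ * (z.2 - t0)) - w (y', t0 + ρ * (z.2 - t0))) -
        (w z' - w (y', t0 + ρ * (z.2 - t0))) := by ring
      rw [e]
      refine (abs_sub _ _).trans ?_
      refine add_le_add ((abs_add_le _ _).trans (add_le_add hw (h1.trans ?_))) hw'
      gcongr
      linarith
    have h4 : M * A + Λ * (N * A + (X + N * A')) + M * A' = Λ * X + (M + Λ * N) * (A + A') := by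
      ring
    rw [h4] at h3
    refine h3.trans ?_
    rw [dist1, mul_add (max Λ (M + Λ * N))]
    exact add_le_add (mul_le_mul_of_nonneg_right (le_max_left _ _) hX)
      (mul_le_mul (le_max_right _ _) hle
        (add_nonneg (mul_nonneg (by linarith [hρ.2]) (abs_nonneg _))
          (mul_nonneg (by linarith [hρ'.2]) (abs_nonneg _))) (hΛ.trans (le_max_left _ _)))
  intro z hz z' hz'
  have hratio : ∀ a b : ℝ, 0 ≤ a → a ≤ b → a / b ∈ Icc (0 : ℝ) 1 := fun a b ha hab =>
    ⟨div_nonneg ha (ha.trans hab), div_le_one_of_le₀ hab (ha.trans hab)⟩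
  -- On one side of the plane only the point farther from it slides, to the time of the other. On
  -- opposite sides both slide to `t0`, where `ρ = ρ' = 0`.
  have same : ∀ z ∈ S, ∀ z' ∈ S, 0 ≤ (z.2 - t0) * (z'.2 - t0) → |z'.2 - t0| ≤ |z.2 - t0| →
      |w z - w z'| ≤ max Λ (M + Λ * N) * dist1 z z' := by
    intro z hz z' hz' hs hle
    refine main z hz z' hz' (|z'.2 - t0| / |z.2 - t0|) (hratio _ _ (abs_nonneg _) hle) 1 (by simp)
      ?_ ?_
    · rcases eq_or_ne (z.2 - t0) 0 with h | h
      · rw [h, abs_zero] at hle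
        have := abs_nonpos_iff.1 hle
        rw [h, this]; simp
      · rw [one_mul, ← abs_div]
        have : 0 ≤ (z'.2 - t0) / (z.2 - t0) := by
          rw [div_eq_mul_inv]
          have e : (z'.2 - t0) * (z.2 - t0)⁻¹ =
              ((z.2 - t0) * (z'.2 - t0)) * ((z.2 - t0)⁻¹ * (z.2 - t0)⁻¹) := by
            field_simp
          rw [e]
          exact mul_nonneg hs (mul_self_nonneg _)
        rw [abs_of_nonneg this, div_mul_cancel₀ _ h]
    · rw [sub_self, zero_mul, add_zero, sub_mul, one_mul]
      rcases eq_or_ne (|z.2 - t0|) 0 with h | h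
      · rw [h]; simp
      · rw [div_mul_cancel₀ _ h]
        refine (abs_sub_abs_le_abs_sub _ _).trans_eq ?_
        congr 1; ring
  rcases le_total 0 ((z.2 - t0) * (z'.2 - t0)) with hs | hs
  · rcases le_total |z'.2 - t0| |z.2 - t0| with hle | hle
    · exact same z hz z' hz' hs hle
    · rw [abs_sub_comm, dist1_comm]
      exact same z' hz' z hz (by rwa [mul_comm]) hle
  · refine main z hz z' hz' 0 (by simp) 0 (by simp) (by simp) ?_
    rw [sub_zero, one_mul, one_mul]
    have e : z.2 - z'.2 = (z.2 - t0) - (z'.2 - t0) := by ring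
    rw [e]
    rcases le_total 0 (z.2 - t0) with h1 | h1 <;> rcases le_total 0 (z'.2 - t0) with h2 | h2
    · have : (z.2 - t0) * (z'.2 - t0) = 0 := le_antisymm hs (mul_nonneg h1 h2)
      rcases mul_eq_zero.1 this with h | h <;> simp [h, abs_sub_comm]
    · rw [abs_of_nonneg h1, abs_of_nonpos h2, abs_of_nonneg (by linarith)]; linarith
    · rw [abs_of_nonpos h1, abs_of_nonneg h2, abs_of_nonpos (by linarith)]; linarith
    · have : (z.2 - t0) * (z'.2 - t0) = 0 := le_antisymm hs (mul_nonneg_of_nonpos_of_nonpos h1 h2)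
      rcases mul_eq_zero.1 this with h | h <;> simp [h, abs_sub_comm]

end Distances

/-! ### The Picard operator and its invariant Lipschitz class. -/

section GlobalExistence

variable {m n : ℕ} {c : Constants m} {C : Fin n → Fin (m - 1) → Dom m × Cod n → ℝ}
  {D : Fin n → Dom m × Cod n → ℝ} {I : (Fin (m - 1) → ℝ) → Cod n}

/-- Coefficients and initial values that are defined everywhere, with global constants. -/
structure GlobalData (c : Constants m) (C : Fin n → Fin (m - 1) → Dom m × Cod n → ℝ)
    (D : Fin n → Dom m × Cod n → ℝ) (I : (Fin (m - 1) → ℝ) → Cod n) : Prop where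
  lipC : ∀ i l z w, |C i l z - C i l w| ≤ c.LC * dist1Prod z w
  lipD : ∀ i z w, |D i z - D i w| ≤ c.LD * dist1Prod z w
  lipI : ∀ i x y, |I x i - I y i| ≤ c.LI * ∑ l, |x l - y l|
  boundC : ∀ i l z, |C i l z| ≤ c.MC
  boundD : ∀ i z, |D i z| ≤ c.MD
  boundI : ∃ M, ∀ x, ‖I x‖ ≤ M
  LC_nonneg : 0 ≤ c.LC
  LD_nonneg : 0 ≤ c.LD
  LI_nonneg : 0 ≤ c.LI
  MC_nonneg : 0 ≤ c.MC
  MD_nonneg : 0 ≤ c.MD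

/-- The velocity field of the characteristics of the `i`-th equation, for given `f`. -/
def vf (C : Fin n → Fin (m - 1) → Dom m × Cod n → ℝ) (f : Dom m → Cod n) (i : Fin n)
    (z : Dom m) : Fin (m - 1) → ℝ := fun l => C i l (z, f z)

/-- `f` has the Lipschitz constants `lam` along planes, and `Λ` in total. -/
structure LipClass (t0 α : ℝ) (lam : ℝ → ℝ) (Λ : ℝ) (f : Dom m → Cod n) : Prop where
  slice : ∀ z ∈ slab _ t0 α, ∀ z' ∈ slab _ t0 α, z.2 = z'.2 → ∀ i,
    |f z i - f z' i| ≤ lam |z.2 - t0| * dist1 z z'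
  total : ∀ z ∈ slab _ t0 α, ∀ z' ∈ slab _ t0 α, ∀ i, |f z i - f z' i| ≤ Λ * dist1 z z'

variable {t0 α : ℝ} {lam v : ℝ → ℝ} {Λ : ℝ} {f g : Dom m → Cod n}

theorem LipClass.continuousOn (hf : LipClass t0 α lam Λ f) : ContinuousOn f (slab _ t0 α) := by
  refine continuousOn_pi.2 fun i => ?_
  refine (LipschitzOnWith.of_dist_le_mul (K := (|Λ| * ((m - 1 : ℕ) + 1)).toNNReal)
    fun z hz z' hz' => ?_).continuousOn
  rw [Real.dist_eq, Real.coe_toNNReal _ (by positivity), dist_eq_norm, mul_assoc]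
  refine (hf.total z hz z' hz' i).trans ?_
  exact mul_le_mul (le_abs_self Λ) (dist1_le_norm_sub z z') (dist1_nonneg _ _) (abs_nonneg _)

theorem LipClass.dist1Prod_le (hf : LipClass t0 α lam Λ f) {z z' : Dom m} (hz : z ∈ slab _ t0 α)
    (hz' : z' ∈ slab _ t0 α) :
    dist1Prod (z, f z) (z', f z') ≤ (1 + n * Λ) * dist1 z z' := by
  rw [dist1Prod]
  have : ∑ s, |f z s - f z' s| ≤ ∑ _s : Fin n, Λ * dist1 z z' :=
    Finset.sum_le_sum fun s _ => hf.total z hz z' hz' s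
  rw [Finset.sum_const, Finset.card_univ, Fintype.card_fin, nsmul_eq_mul] at this
  simp only
  linarith

theorem LipClass.dist1Prod_le_slice (hf : LipClass t0 α lam Λ f) {z z' : Dom m}
    (hz : z ∈ slab _ t0 α) (hz' : z' ∈ slab _ t0 α) (h : z.2 = z'.2) :
    dist1Prod (z, f z) (z', f z') ≤ (1 + n * lam |z.2 - t0|) * ∑ l, |z.1 l - z'.1 l| := by
  rw [dist1Prod]
  have : ∑ s, |f z s - f z' s| ≤ ∑ _s : Fin n, lam |z.2 - t0| * dist1 z z' :=
    Finset.sum_le_sum fun s _ => hf.slice z hz z' hz' h s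
  rw [Finset.sum_const, Finset.card_univ, Fintype.card_fin, nsmul_eq_mul] at this
  simp only
  rw [dist1_of_snd_eq h] at *
  linarith

theorem GlobalData.lipschitz_vf (G : GlobalData c C D I) (hf : LipClass t0 α lam Λ f)
    (i : Fin n) :
    LipschitzOnWith (c.LC * ((1 + n * |Λ|) * ((m - 1 : ℕ) + 1))).toNNReal (vf C f i)
      (slab _ t0 α) := by
  have h0 := G.LC_nonneg
  refine LipschitzOnWith.of_dist_le_mul fun z hz z' hz' => ?_
  rw [Real.coe_toNNReal _ (by positivity), dist_eq_norm]
  refine (pi_norm_le_iff_of_nonneg (by positivity)).2 fun l => ?_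
  refine (G.lipC i l _ _).trans ?_
  rw [mul_assoc]
  refine mul_le_mul_of_nonneg_left ?_ h0
  refine (hf.dist1Prod_le hz hz').trans ?_
  rw [mul_assoc, dist_eq_norm]
  refine mul_le_mul ?_ (dist1_le_norm_sub z z') (dist1_nonneg _ _) (by positivity)
  have := le_abs_self Λ
  gcongr

theorem GlobalData.norm_vf_le (G : GlobalData c C D I) (f : Dom m → Cod n) (i : Fin n)
    (z : Dom m) : ‖vf C f i z‖ ≤ c.MC :=
  (pi_norm_le_iff_of_nonneg G.MC_nonneg).2 fun l => G.boundC i l _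

theorem GlobalData.charDomain (G : GlobalData c C D I) (hf : LipClass t0 α lam Λ f) (i : Fin n) :
    CharDomain t0 (slab _ t0 α) (vf C f i) :=
  charDomain_slab (G.lipschitz_vf hf i) fun z _ => G.norm_vf_le f i z

theorem GlobalData.lipschitz_D (G : GlobalData c C D I) (hf : LipClass t0 α lam Λ f)
    (i : Fin n) : LipschitzOnWith (c.LD * ((1 + n * |Λ|) * ((m - 1 : ℕ) + 1))).toNNReal
      (fun z => D i (z, f z)) (slab _ t0 α) := by
  have h0 := G.LD_nonneg
  refine LipschitzOnWith.of_dist_le_mul fun z hz z' hz' => ?_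
  rw [Real.coe_toNNReal _ (by positivity), Real.dist_eq]
  refine (G.lipD i _ _).trans ?_
  rw [mul_assoc]
  refine mul_le_mul_of_nonneg_left ?_ h0
  refine (hf.dist1Prod_le hz hz').trans ?_
  rw [mul_assoc, dist_eq_norm]
  refine mul_le_mul ?_ (dist1_le_norm_sub z z') (dist1_nonneg _ _) (by positivity)
  have := le_abs_self Λ
  gcongr

/-- The Picard operator: solve the equations with the characteristics and sources of `f`. -/
def picard (t0 α : ℝ) (C : Fin n → Fin (m - 1) → Dom m × Cod n → ℝ)
    (D : Fin n → Dom m × Cod n → ℝ) (I : (Fin (m - 1) → ℝ) → Cod n) (f : Dom m → Cod n)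
    (z : Dom m) : Cod n := by
  classical
  -- The value zero off the slab makes the difference of two images vanish there, so that weighted
  -- estimates hold at every point.
  exact if z ∈ slab _ t0 α then
    fun i => duhamel t0 (vf C f i) (fun x => I x i) (fun z => D i (z, f z)) z else 0

theorem picard_of_mem {z : Dom m} (hz : z ∈ slab _ t0 α) (i : Fin n) :
    picard t0 α C D I f z i =
      duhamel t0 (vf C f i) (fun x => I x i) (fun z => D i (z, f z)) z := by
  rw [picard, if_pos hz]

theorem GlobalData.transported_picard (G : GlobalData c C D I) (hf : LipClass t0 α lam Λ f)
    (i : Fin n) : Transported t0 (slab _ t0 α) (vf C f i) (fun z => D i (z, f z))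
      (fun z => picard t0 α C D I f z i) := by
  intro z hz Y hY σ hσ
  have h := (G.charDomain hf i).transported_duhamel (J := fun x => I x i)
    ⟨c.MC, fun z _ => G.norm_vf_le f i z⟩ (G.lipschitz_D hf i).continuousOn z hz Y hY σ hσ
  have hmem := (G.charDomain hf i).mem z hz Y hY
  exact h.congr (fun s hs => picard_of_mem (hmem s hs) i) (picard_of_mem (hmem σ hσ) i)

theorem GlobalData.picard_initial (G : GlobalData c C D I) (hf : LipClass t0 α lam Λ f)
    (hα : 0 ≤ α) (x : Fin (m - 1) → ℝ) : picard t0 α C D I f (x, t0) = I x := by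
  have hz : (x, t0) ∈ slab (Fin (m - 1) → ℝ) t0 α := by simpa [slab] using hα
  ext i
  rw [picard_of_mem hz]
  exact (G.charDomain hf i).duhamel_initial hz rfl

/-- The Picard operator preserves the bounds for the Lipschitz constants along planes. -/
theorem GlobalData.picard_slice (G : GlobalData c C D I) (hf : LipClass t0 α lam Λ f)
    {K Lmax : ℝ} (hK : K = (m - 1 : ℕ) * c.LC)
    (hv : ∀ τ ∈ Icc 0 α, 0 < v τ)
    (hvd : ∀ τ ∈ Icc 0 α, HasDerivAt v (-(K * (1 + n * lam τ) * v τ)) τ)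
    (hlamd : ∀ τ ∈ Icc 0 α,
      HasDerivAt lam (K * (1 + n * lam τ) * lam τ + c.LD * (1 + n * lam τ)) τ)
    (hlam0 : lam 0 = c.LI) (hlam : ∀ τ ∈ Icc 0 α, 0 ≤ lam τ ∧ lam τ ≤ Lmax)
    {z z' : Dom m} (hz : z ∈ slab _ t0 α) (hz' : z' ∈ slab _ t0 α) (hzz : z.2 = z'.2)
    (i : Fin n) :
    |picard t0 α C D I f z i - picard t0 α C D I f z' i| ≤ lam |z.2 - t0| * dist1 z z' := by
  have hK0 : 0 ≤ K := by rw [hK]; exact mul_nonneg (Nat.cast_nonneg _) G.LC_nonneg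
  have hLD := G.LD_nonneg
  have hα : 0 ≤ α := (abs_nonneg _).trans hz
  have hcd := G.charDomain hf i
  obtain ⟨Y, hY⟩ := hcd.exists_char z hz
  obtain ⟨Y', hY'⟩ := hcd.exists_char z' hz'
  set T := |z.2 - t0| with hT
  have hT0 : 0 ≤ T := abs_nonneg _
  have hTα : T ≤ α := hz
  have hτ : ∀ σ ∈ Icc (0 : ℝ) 1, σ * T ∈ Icc 0 α := fun σ hσ =>
    ⟨mul_nonneg hσ.1 hT0, (mul_le_of_le_one_left hT0 hσ.2).trans hTα⟩
  have hTm : T ∈ Icc 0 α := ⟨hT0, hTα⟩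
  have hdτ : ∀ σ : ℝ, HasDerivAt (fun s : ℝ => s * T) T σ := fun σ => by
    simpa using (hasDerivAt_id σ).mul_const T
  have hvT := hv T hTm
  set N := dist1 z z' with hN
  have hN0 : 0 ≤ N := dist1_nonneg _ _
  have hdp : ∀ σ ∈ Icc (0 : ℝ) 1,
      dist1Prod (pt t0 z Y σ, f (pt t0 z Y σ)) (pt t0 z' Y' σ, f (pt t0 z' Y' σ)) ≤
        (1 + n * lam (σ * T)) * ‖WithLp.toLp 1 (Y σ - Y' σ)‖ := by
    intro σ hσ
    have := hf.dist1Prod_le_slice (hcd.mem z hz Y hY σ hσ) (hcd.mem z' hz' Y' hY' σ hσ)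
      (by simp [hzz])
    rw [abs_pt_snd_sub hσ] at this
    rw [norm_toLp_one]
    exact this
  -- Going backward from distance `N` at `σ = 1`, the separation grows at rate at most `T K (1 + n
  -- λ)`. The function `v` solves precisely this equation, so the bound is `N v(σT) / v(T)`.
  have hξ : ∀ σ ∈ Icc (0 : ℝ) 1, ‖WithLp.toLp 1 (Y σ - Y' σ)‖ ≤ N / v T * v (σ * T) := by
    refine norm_le_of_norm_deriv_le_backward
      (f' := fun σ => WithLp.toLp 1 ((z.2 - t0) • vf C f i (pt t0 z Y σ) -
        (z'.2 - t0) • vf C f i (pt t0 z' Y' σ)))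
      (a := fun σ => T * (K * (1 + n * lam (σ * T)))) (β := fun _ => 0)
      (A := T * (K * (1 + n * Lmax)))
      (b' := fun σ => N / v T * (-(K * (1 + n * lam (σ * T)) * v (σ * T)) * T))
      (fun σ hσ => hasDerivWithinAt_toLp_one ((hY.deriv σ hσ).sub (hY'.deriv σ hσ)))
      (fun σ hσ => (((hvd _ (hτ σ hσ)).comp σ (hdτ σ)).const_mul (N / v T)).hasDerivWithinAt)
      ?_ (fun σ hσ => ?_) (fun σ hσ => ?_) (fun σ hσ => ?_)
    · rw [norm_toLp_one, hY.end_eq, hY'.end_eq, one_mul, div_mul_cancel₀ _ hvT.ne', hN,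
        dist1_of_snd_eq hzz]
      rfl
    · have := (hlam _ (hτ σ hσ)).2
      gcongr
    · rw [← hzz, ← smul_sub, WithLp.toLp_smul, norm_smul, Real.norm_eq_abs, add_zero,
        ← hT, norm_toLp_one, mul_assoc]
      refine mul_le_mul_of_nonneg_left ?_ hT0
      have : ∀ l, |(vf C f i (pt t0 z Y σ) - vf C f i (pt t0 z' Y' σ)) l| ≤
          c.LC * ((1 + n * lam (σ * T)) * ‖WithLp.toLp 1 (Y σ - Y' σ)‖) := fun l =>
        (G.lipC i l _ _).trans (mul_le_mul_of_nonneg_left (hdp σ hσ) G.LC_nonneg)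
      refine (Finset.sum_le_sum fun l _ => this l).trans_eq ?_
      rw [Finset.sum_const, Finset.card_univ, Fintype.card_fin, nsmul_eq_mul, hK]
      ring
    · refine le_of_eq ?_
      ring
  -- In the derivative of `λ v` the terms with `K` cancel and `LD (1 + n λ) v` remains, which is the
  -- bound for the difference of the sources. At `σ = 1` the factor `v(T)` drops out and `λ(T) N` is
  -- left.
  have hw : ∀ σ ∈ Icc (0 : ℝ) 1,
      ‖picard t0 α C D I f (pt t0 z Y σ) i - picard t0 α C D I f (pt t0 z' Y' σ) i‖ ≤
        N / v T * (lam (σ * T) * v (σ * T)) := by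
    refine norm_le_of_norm_deriv_le
      (f' := fun σ => (z.2 - t0) * D i (pt t0 z Y σ, f (pt t0 z Y σ)) -
        (z'.2 - t0) * D i (pt t0 z' Y' σ, f (pt t0 z' Y' σ)))
      (a := fun _ => 0) (A := 0)
      (β := fun σ => T * (c.LD * ((1 + n * lam (σ * T)) * (N / v T * v (σ * T)))))
      (b' := fun σ => N / v T * (((K * (1 + n * lam (σ * T)) * lam (σ * T) +
        c.LD * (1 + n * lam (σ * T))) * T) * v (σ * T) +
        lam (σ * T) * (-(K * (1 + n * lam (σ * T)) * v (σ * T)) * T)))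
      (fun σ hσ => (G.transported_picard hf i z hz Y hY σ hσ).sub
        (G.transported_picard hf i z' hz' Y' hY' σ hσ))
      (fun σ hσ => ((((hlamd _ (hτ σ hσ)).comp σ (hdτ σ)).mul
        ((hvd _ (hτ σ hσ)).comp σ (hdτ σ))).const_mul (N / v T)).hasDerivWithinAt)
      ?_ (fun _ _ => le_rfl) (fun σ hσ => ?_) (fun σ hσ => ?_)
    · rw [pt_zero, pt_zero, G.picard_initial hf hα, G.picard_initial hf hα, zero_mul, hlam0,
        Real.norm_eq_abs]
      refine (G.lipI i _ _).trans ?_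
      have := hξ 0 (by simp)
      rw [norm_toLp_one, zero_mul] at this
      refine (mul_le_mul_of_nonneg_left this G.LI_nonneg).trans_eq ?_
      ring
    · rw [← hzz, ← mul_sub, zero_mul, zero_add, Real.norm_eq_abs, abs_mul, ← hT]
      refine mul_le_mul_of_nonneg_left ?_ hT0
      refine (G.lipD i _ _).trans (mul_le_mul_of_nonneg_left ?_ hLD)
      refine (hdp σ hσ).trans (mul_le_mul_of_nonneg_left (hξ σ hσ) ?_)
      have := (hlam _ (hτ σ hσ)).1
      positivity
    · refine le_of_eq ?_
      ring
  have := hw 1 (by simp)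
  rw [hY.pt_one, hY'.pt_one, one_mul, Real.norm_eq_abs] at this
  refine this.trans_eq ?_
  field_simp

/-- The Picard operator preserves the class of functions with the given Lipschitz constants. -/
theorem GlobalData.lipClass_picard (G : GlobalData c C D I) (hf : LipClass t0 α lam Λ f)
    {Lmax : ℝ} (hL0 : 0 ≤ Lmax)
    (hlam : ∀ τ ∈ Icc 0 α, lam τ ≤ Lmax)
    (hΛ : Λ = max Lmax (c.MD + Lmax * ((m - 1 : ℕ) * c.MC)))
    (hslice : ∀ z ∈ slab _ t0 α, ∀ z' ∈ slab _ t0 α, z.2 = z'.2 → ∀ i,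
      |picard t0 α C D I f z i - picard t0 α C D I f z' i| ≤ lam |z.2 - t0| * dist1 z z') :
    LipClass t0 α lam Λ (picard t0 α C D I f) := by
  refine ⟨hslice, ?_⟩
  intro z hz z' hz' i
  rw [hΛ]
  refine abs_sub_le_of_slice (S := slab _ t0 α) (t0 := t0)
    (w := fun z => picard t0 α C D I f z i) hL0 G.MD_nonneg
    (mul_nonneg (Nat.cast_nonneg _) G.MC_nonneg) (fun z hz z' hz' h => ?_) (fun z hz ρ hρ => ?_)
    z hz z' hz'
  · refine (hslice z hz z' hz' h i).trans ?_
    exact mul_le_mul_of_nonneg_right (hlam _ ⟨abs_nonneg _, hz⟩) (dist1_nonneg _ _)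
  · have hcd := G.charDomain hf i
    obtain ⟨Y, hY⟩ := hcd.exists_char z hz
    refine ⟨Y ρ, hcd.mem z hz Y hY ρ hρ, ?_, ?_⟩
    · have := norm_sub_le_of_norm_deriv_le (B := |z.2 - t0| * c.MD)
        (G.transported_picard hf i z hz Y hY) (fun σ _ => ?_) hρ (σ := 1) (by simp)
      · rw [hY.pt_one, Real.norm_eq_abs, abs_of_nonneg (sub_nonneg.2 hρ.2)] at this
        refine this.trans_eq ?_
        ring
      · rw [Real.norm_eq_abs, abs_mul]
        exact mul_le_mul_of_nonneg_left (G.boundD i _) (abs_nonneg _)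
    · have := norm_sub_le_of_norm_deriv_le (B := |z.2 - t0| * c.MC) hY.deriv (fun σ _ => ?_) hρ
        (σ := 1) (by simp)
      · rw [hY.end_eq, abs_of_nonneg (sub_nonneg.2 hρ.2)] at this
        refine (Finset.sum_le_sum fun l _ =>
          (norm_le_pi_norm (z.1 - Y ρ) l).trans this).trans_eq ?_
        rw [Finset.sum_const, Finset.card_univ, Fintype.card_fin, nsmul_eq_mul]
        ring
      · rw [norm_smul, Real.norm_eq_abs]
        exact mul_le_mul_of_nonneg_left (G.norm_vf_le f i _) (abs_nonneg _)

end GlobalExistence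

/-! ### Contraction of the Picard operator and the global solution. -/

section GlobalExistence

variable {m n : ℕ} {c : Constants m} {C : Fin n → Fin (m - 1) → Dom m × Cod n → ℝ}
  {D : Fin n → Dom m × Cod n → ℝ} {I : (Fin (m - 1) → ℝ) → Cod n}
  {t0 α : ℝ} {lam : ℝ → ℝ} {Λ : ℝ} {f g : Dom m → Cod n}

theorem dist1Prod_self_left_le (z : Dom m) (y y' : Cod n) :
    dist1Prod (z, y) (z, y') ≤ n * ‖y - y'‖ := by
  have : ∑ s, |y s - y' s| ≤ ∑ _s : Fin n, ‖y - y'‖ :=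
    Finset.sum_le_sum fun s _ => norm_le_pi_norm (y - y') s
  rw [Finset.sum_const, Finset.card_univ, Fintype.card_fin, nsmul_eq_mul] at this
  simpa [dist1Prod, dist1] using this

/-- The Picard operator is a contraction for suitable weights. -/
theorem GlobalData.picard_contracting (G : GlobalData c C D I) (hα : 0 ≤ α) (Λ : ℝ) :
    ∃ κ, ∀ (lam : ℝ → ℝ) (f g : Dom m → Cod n) (B : ℝ), LipClass t0 α lam Λ f →
      LipClass t0 α lam Λ g → (∀ z, ‖f z - g z‖ ≤ B * Real.exp (κ * |z.2 - t0|)) →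
      ∀ z, ‖picard t0 α C D I f z - picard t0 α C D I g z‖ ≤
        B / 2 * Real.exp (κ * |z.2 - t0|) := by
  set K : ℝ := ((c.LC * ((1 + n * |Λ|) * ((m - 1 : ℕ) + 1))).toNNReal : ℝ) with hK
  set Kd : ℝ := ((c.LD * ((1 + n * |Λ|) * ((m - 1 : ℕ) + 1))).toNNReal : ℝ) with hKd
  have hK0 : 0 ≤ K := NNReal.coe_nonneg _
  have hKd0 : 0 ≤ Kd := NNReal.coe_nonneg _
  have hLC := G.LC_nonneg
  have hLD := G.LD_nonneg
  have hLI := G.LI_nonneg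
  set K1 : ℝ := c.LC * n with hK1
  have hK10 : 0 ≤ K1 := by positivity
  -- The three terms come from different feet of the characteristics, from the source at displaced
  -- points, and from the source at different values. Each enters with a factor `1/κ` from
  -- integrating the weight, so `κ = 2Q + 1` gives a factor at most `1/2`. Since `κ` depends on `f`
  -- and `g` only through `Λ`, one weight serves the whole class.
  set Q : ℝ := c.LI * (m - 1 : ℕ) * K1 * Real.exp (K * α) +
    α * (Kd * K1 * Real.exp (K * α)) + c.LD * n with hQ
  have hQ0 : 0 ≤ Q := by positivity
  set κ : ℝ := 2 * Q + 1 with hκ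
  have hκ0 : 0 < κ := by positivity
  refine ⟨κ, fun lam f g B hf hg hB z => ?_⟩
  have hB0 : 0 ≤ B := by
    have := (norm_nonneg _).trans (hB z)
    exact nonneg_of_mul_nonneg_left this (Real.exp_pos _)
  by_cases hz : z ∈ slab (Fin (m - 1) → ℝ) t0 α
  swap
  · rw [picard, picard, if_neg hz, if_neg hz, sub_self, norm_zero]
    positivity
  refine (pi_norm_le_iff_of_nonneg (by positivity)).2 fun i => ?_
  have hcf := G.charDomain hf i
  have hcg := G.charDomain hg i
  obtain ⟨Y, hY⟩ := hcf.exists_char z hz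
  obtain ⟨Y', hY'⟩ := hcg.exists_char z hz
  have hmY := hcf.mem z hz Y hY
  have hmY' := hcg.mem z hz Y' hY'
  set T := |z.2 - t0| with hT
  have hT0 : 0 ≤ T := abs_nonneg _
  have hTα : T ≤ α := hz
  have hmid : ∀ σ ∈ Icc (0 : ℝ) 1,
      ‖f (pt t0 z Y' σ) - g (pt t0 z Y' σ)‖ ≤ B * Real.exp (κ * (σ * T)) := fun σ hσ => by
    have := hB (pt t0 z Y' σ)
    rwa [abs_pt_snd_sub hσ] at this
  set A : ℝ := K1 * B / κ * Real.exp (κ * T) * Real.exp (K * α) with hA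
  have hA0 : 0 ≤ A := by positivity
  have hξ : ∀ σ ∈ Icc (0 : ℝ) 1, ‖Y σ - Y' σ‖ ≤ A := by
    intro σ hσ
    -- Both characteristics end at `z`, so the supersolution must vanish at `s = 1`. The factor `exp
    -- (κ T) - exp (κ s T)` does, and its derivative reproduces the forcing `K1 B exp (κ s T)`.
    have := norm_le_of_norm_deriv_le_backward (f := fun s => Y s - Y' s)
      (f' := fun s => (z.2 - t0) • vf C f i (pt t0 z Y s) - (z.2 - t0) • vf C g i (pt t0 z Y' s))
      (a := fun _ => T * K) (A := T * K)
      (β := fun s => T * (K1 * (B * Real.exp (κ * (s * T)))))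
      (b := fun s => K1 * B / κ * (Real.exp (κ * T) - Real.exp (κ * (s * T))) *
        Real.exp (T * K * (1 - s)))
      (b' := fun s => K1 * B / κ * (-(Real.exp (κ * (s * T)) * (κ * T))) *
        Real.exp (T * K * (1 - s)) + K1 * B / κ * (Real.exp (κ * T) - Real.exp (κ * (s * T))) *
        (Real.exp (T * K * (1 - s)) * (T * K * (-1))))
      (fun s hs => (hY.deriv s hs).sub (hY'.deriv s hs)) (fun s _ => ?_) ?_
      (fun _ _ => le_rfl) (fun s hs => ?_) (fun s hs => ?_) σ hσ
    · refine this.trans ?_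
      rw [hA, mul_assoc _ (Real.exp (κ * T))]
      rw [mul_assoc]
      have h1 : Real.exp (κ * T) - Real.exp (κ * (σ * T)) ≤ Real.exp (κ * T) := by
        linarith [Real.exp_pos (κ * (σ * T))]
      have h2 : Real.exp (T * K * (1 - σ)) ≤ Real.exp (K * α) := by
        refine Real.exp_le_exp.2 ?_
        have : T * K * (1 - σ) ≤ T * K * 1 := by
          have := hσ.1
          gcongr
          linarith
        nlinarith
      gcongr
    · have h1 := (((hasDerivAt_id s).mul_const T).const_mul κ).exp
      have h2 := ((((h1.const_sub (Real.exp (κ * T))).const_mul (K1 * B / κ))).mul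
        (((hasDerivAt_id s).const_sub 1).const_mul (T * K)).exp)
      exact h2.hasDerivWithinAt.congr_deriv (by simp)
    · simp [hY.end_eq, hY'.end_eq]
    · rw [← smul_sub, norm_smul, Real.norm_eq_abs, ← hT, mul_assoc, ← mul_add]
      refine mul_le_mul_of_nonneg_left ?_ hT0
      have e : vf C f i (pt t0 z Y s) - vf C g i (pt t0 z Y' s) =
        (vf C f i (pt t0 z Y s) - vf C f i (pt t0 z Y' s)) +
        (vf C f i (pt t0 z Y' s) - vf C g i (pt t0 z Y' s)) := by abel
      rw [e]
      refine (norm_add_le _ _).trans (add_le_add ?_ ?_)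
      · have := norm_sub_le_of_lip (G.lipschitz_vf hf i) (hmY s hs) (hmY' s hs)
        simpa only [pt_fst, pt_snd, sub_self, abs_zero, add_zero] using this
      · refine (pi_norm_le_iff_of_nonneg (by positivity)).2 fun l => ?_
        refine (G.lipC i l _ _).trans ?_
        rw [hK1, mul_assoc]
        refine mul_le_mul_of_nonneg_left ((dist1Prod_self_left_le _ _ _).trans ?_) hLC
        exact mul_le_mul_of_nonneg_left (hmid s hs) (Nat.cast_nonneg _)
    · have h1 : 1 ≤ Real.exp (T * K * (1 - s)) :=
        Real.one_le_exp (mul_nonneg (by positivity) (by linarith [hs.2]))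
      have h2 : T * (K1 * (B * Real.exp (κ * (s * T)))) * 1 ≤
          T * (K1 * (B * Real.exp (κ * (s * T)))) * Real.exp (T * K * (1 - s)) := by gcongr
      have h3 : K1 * B / κ * (-(Real.exp (κ * (s * T)) * (κ * T))) * Real.exp (T * K * (1 - s)) =
          -(T * (K1 * (B * Real.exp (κ * (s * T)))) * Real.exp (T * K * (1 - s))) := by
        field_simp
      rw [h3]
      linarith
  have hw := norm_le_of_norm_deriv_le_exp (τ := T) (a := Kd * A) (b := c.LD * n * B) (κ := κ)
    (f := fun s => picard t0 α C D I f (pt t0 z Y s) i - picard t0 α C D I g (pt t0 z Y' s) i)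
    hT0 (by positivity) (by positivity) hκ0
    (fun s hs => (G.transported_picard hf i z hz Y hY s hs).sub
        (G.transported_picard hg i z hz Y' hY' s hs)) (fun s hs => ?_) 1 (by simp)
  · rw [hY.pt_one, hY'.pt_one, one_mul, pt_zero, pt_zero, G.picard_initial hf hα,
      G.picard_initial hg hα] at hw
    refine hw.trans ?_
    have h1 : ‖I (Y 0) i - I (Y' 0) i‖ ≤ c.LI * ((m - 1 : ℕ) * A) := by
      refine (G.lipI i _ _).trans (mul_le_mul_of_nonneg_left ?_ hLI)
      refine (Finset.sum_le_sum fun l _ =>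
        (norm_le_pi_norm (Y 0 - Y' 0) l).trans (hξ 0 (by simp))).trans_eq ?_
      rw [Finset.sum_const, Finset.card_univ, Fintype.card_fin, nsmul_eq_mul]
    have h2 : T * (Kd * A) ≤ α * (Kd * A) := by gcongr
    have h3 : c.LI * ((m - 1 : ℕ) * A) + α * (Kd * A) +
        c.LD * n * B / κ * Real.exp (κ * T) = Q / κ * B * Real.exp (κ * T) := by
      rw [hA, hQ]
      field_simp
    have h4 : Q / κ ≤ 1 / 2 := by
      rw [div_le_iff₀ hκ0, hκ]
      linarith
    calc _ ≤ Q / κ * B * Real.exp (κ * T) := by linarith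
      _ ≤ 1 / 2 * B * Real.exp (κ * T) := by gcongr
      _ = _ := by ring
  · rw [← mul_sub, norm_mul, Real.norm_eq_abs, ← hT]
    refine mul_le_mul_of_nonneg_left ?_ hT0
    have e : D i (pt t0 z Y s, f (pt t0 z Y s)) - D i (pt t0 z Y' s, g (pt t0 z Y' s)) =
        (D i (pt t0 z Y s, f (pt t0 z Y s)) - D i (pt t0 z Y' s, f (pt t0 z Y' s))) +
        (D i (pt t0 z Y' s, f (pt t0 z Y' s)) - D i (pt t0 z Y' s, g (pt t0 z Y' s))) := by ring
    rw [e]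
    refine (norm_add_le _ _).trans (add_le_add ?_ ?_)
    · have := norm_sub_le_of_lip (G.lipschitz_D hf i) (hmY s hs) (hmY' s hs)
      refine this.trans (mul_le_mul_of_nonneg_left ?_ hKd0)
      simpa using hξ s hs
    · refine (G.lipD i _ _).trans ?_
      rw [mul_assoc, mul_assoc]
      refine mul_le_mul_of_nonneg_left ((dist1Prod_self_left_le _ _ _).trans ?_) hLD
      exact mul_le_mul_of_nonneg_left (hmid s hs) (Nat.cast_nonneg _)

theorem LipClass.of_limit {u : ℕ → Dom m → Cod n} (hu : ∀ k, LipClass t0 α lam Λ (u k))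
    (hlim : ∀ z, Tendsto (fun k => u k z) atTop (𝓝 (f z))) : LipClass t0 α lam Λ f := by
  have h : ∀ z z' i, Tendsto (fun k => |u k z i - u k z' i|) atTop (𝓝 |f z i - f z' i|) :=
    fun z z' i => ((tendsto_pi_nhds.1 (hlim z) i).sub (tendsto_pi_nhds.1 (hlim z') i)).abs
  exact ⟨fun z hz z' hz' hzz i => le_of_tendsto' (h z z' i)
      fun k => (hu k).slice z hz z' hz' hzz i,
    fun z hz z' hz' i => le_of_tendsto' (h z z' i) fun k => (hu k).total z hz z' hz' i⟩

/-- Existence for global data, with explicit Lipschitz constants. -/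
theorem GlobalData.exists_solution (G : GlobalData c C D I) (t0 : ℝ) (hm : 2 ≤ m) (hn : 1 ≤ n)
    (hα : 0 ≤ α) (hq : c.q n α < 1) :
    ∃ f, LipClass t0 α (fun _ => c.Lf n α) (c.LUfs n α) f ∧ picard t0 α C D I f = f := by
  have hn0 : (0 : ℝ) < n := by exact_mod_cast hn
  have hcast : ((m - 1 : ℕ) : ℝ) = (m : ℝ) - 1 := by
    rw [Nat.cast_sub (by omega), Nat.cast_one]
  have hLC := G.LC_nonneg
  have hLI := G.LI_nonneg
  set K : ℝ := (m - 1 : ℕ) * c.LC with hK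
  have hqe : c.q n α = K * (1 + n * c.LI) * α * Real.exp (step (c.c1 n) * c.c1 n * α) := by
    rw [Constants.q, hK, hcast]
    field_simp
    ring
  obtain ⟨v, lam, hv, hvd, hlamd, hlam0, hlam⟩ := exists_slice_bound (K := K) (LD := c.LD)
    (LI := c.LI) (c1 := c.c1 n) (α := α) hn0 (by positivity) G.LD_nonneg hLI
    (by rw [Constants.c1, hK, hcast]) (by rwa [← hqe])
  have hLf : c.Lf n α = ((1 + n * c.LI) * Real.exp (c.c1 n * α) /
      (1 - K * (1 + n * c.LI) * α * Real.exp (step (c.c1 n) * c.c1 n * α)) - 1) / n := by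
    rw [Constants.Lf, ← hqe]
    have : 1 - c.q n α ≠ 0 := by linarith
    field_simp
    ring
  rw [← hLf] at hlam
  have hLf0 : 0 ≤ c.Lf n α := (hlam 0 ⟨le_rfl, hα⟩).1.trans (hlam 0 ⟨le_rfl, hα⟩).2
  have hΛ : c.LUfs n α = max (c.Lf n α) (c.MD + c.Lf n α * ((m - 1 : ℕ) * c.MC)) := by
    rw [Constants.LUfs, hcast, mul_assoc]
  have hP : ∀ f, LipClass t0 α lam (c.LUfs n α) f →
      LipClass t0 α lam (c.LUfs n α) (picard t0 α C D I f) := fun f hf =>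
    G.lipClass_picard hf hLf0 (fun τ hτ => (hlam τ hτ).2) hΛ fun z hz z' hz' hzz i =>
      G.picard_slice hf hK hv hvd hlamd hlam0 hlam hz hz' hzz i
  obtain ⟨κ, hκ⟩ := G.picard_contracting (t0 := t0) hα (c.LUfs n α)
  obtain ⟨MI, hMI⟩ := G.boundI
  have hMI0 : 0 ≤ MI := (norm_nonneg _).trans (hMI 0)
  have hMD := G.MD_nonneg
  have h0 : LipClass t0 α lam (c.LUfs n α) (fun _ : Dom m => (0 : Cod n)) := by
    refine ⟨fun z hz z' hz' _ i => ?_, fun z hz z' hz' i => ?_⟩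
    · simpa using mul_nonneg (hlam _ ⟨abs_nonneg _, hz⟩).1 (dist1_nonneg z z')
    · have : 0 ≤ c.LUfs n α := hLf0.trans (le_max_left _ _)
      simpa using mul_nonneg this (dist1_nonneg z z')
  -- The invariant class uses the time dependent bound `lam`; only for the fixed point is it relaxed
  -- to its upper bound `Lf`.
  suffices h : ∃ f, LipClass t0 α lam (c.LUfs n α) f ∧ picard t0 α C D I f = f by
    obtain ⟨f, hf, hfix⟩ := h
    exact ⟨f, ⟨fun z hz z' hz' hzz i => (hf.slice z hz z' hz' hzz i).trans
      (mul_le_mul_of_nonneg_right (hlam _ ⟨abs_nonneg _, hz⟩).2 (dist1_nonneg _ _)), hf.total⟩,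
      hfix⟩
  refine exists_fixedPoint_of_weighted
    (fun z : Dom m => Real.exp (κ * |z.2 - t0|)) (picard t0 α C D I)
    (LipClass t0 α lam (c.LUfs n α)) hP ?_ (fun _ => 0) h0
    ((MI + α * c.MD) * Real.exp (|κ| * α)) ?_ (fun f g B hf hg hB => hκ lam f g B hf hg hB)
  · intro u f B hu hB
    refine LipClass.of_limit hu fun z => ?_
    rw [tendsto_iff_norm_sub_tendsto_zero]
    refine squeeze_zero (fun _ => norm_nonneg _) (fun k => (norm_sub_rev _ _).trans_le (hB k z)) ?_
    have := (tendsto_pow_atTop_nhds_zero_of_lt_one (by norm_num : (0 : ℝ) ≤ 1 / 2)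
      (by norm_num)).const_mul B
    simpa using this.mul_const (Real.exp (κ * |z.2 - t0|))
  · intro z
    by_cases hz : z ∈ slab (Fin (m - 1) → ℝ) t0 α
    swap
    · rw [picard, if_neg hz, sub_zero, norm_zero]
      positivity
    have h1 : ‖picard t0 α C D I (fun _ => 0) z - 0‖ ≤ MI + α * c.MD := by
      rw [sub_zero]
      refine (pi_norm_le_iff_of_nonneg (by positivity)).2 fun i => ?_
      obtain ⟨Y, hY⟩ := (G.charDomain h0 i).exists_char z hz
      have := norm_sub_le_of_norm_deriv_le (B := α * c.MD) (G.transported_picard h0 i z hz Y hY)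
        (fun σ _ => ?_) (ρ := 0) (σ := 1) (by simp) (by simp)
      · rw [hY.pt_one, pt_zero, sub_zero, abs_one, mul_one] at this
        simp only [G.picard_initial h0 hα] at this
        have h2 := (norm_le_pi_norm (I (Y 0)) i).trans (hMI _)
        have h3 := norm_le_norm_add_norm_sub' (picard t0 α C D I (fun _ => 0) z i) (I (Y 0) i)
        linarith
      · rw [norm_mul]
        exact mul_le_mul hz (G.boundD i _) (norm_nonneg _) hα
    -- The sign of `κ` is not part of what `picard_contracting` provides; the factor with `|κ|`
    -- compensates for a weight that might be below `1`.
    have h2 : 1 ≤ Real.exp (|κ| * α) * Real.exp (κ * |z.2 - t0|) := by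
      rw [← Real.exp_add]
      refine Real.one_le_exp ?_
      have h3 : |κ| * |z.2 - t0| ≤ |κ| * α := mul_le_mul_of_nonneg_left hz (abs_nonneg _)
      have h4 : -(|κ| * |z.2 - t0|) ≤ κ * |z.2 - t0| := by
        rw [← neg_mul]
        exact mul_le_mul_of_nonneg_right (neg_abs_le κ) (abs_nonneg _)
      linarith
    calc _ ≤ (MI + α * c.MD) * 1 := by rw [mul_one]; exact h1
      _ ≤ (MI + α * c.MD) * (Real.exp (|κ| * α) * Real.exp (κ * |z.2 - t0|)) := by gcongr
      _ = _ := by ring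

end GlobalExistence

/-! ### From transport along characteristics to the differential equation. -/

section DirectionalDerivative

variable {E : Type*} [NormedAddCommGroup E] [NormedSpace ℝ E]
  {t0 : ℝ} {S : Set (E × ℝ)} {c : E × ℝ → E} {D w : E × ℝ → ℝ} {M : ℝ}

/-- A function that is transported along the characteristics satisfies the differential equation
at every point of differentiability, the boundary included. -/
theorem Transported.apply_fderivWithin (hS : Convex ℝ S) (hcd : CharDomain t0 S c)
    (hM : ∀ z ∈ S, ‖c z‖ ≤ M) (hw : Transported t0 S c D w) (hD : ContinuousOn D S)
    (hpos : ∃ o ∈ S, t0 < o.2) (hneg : ∃ o ∈ S, o.2 < t0) {z : E × ℝ} (hz : z ∈ S)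
    {A : E × ℝ →L[ℝ] ℝ} (hA : HasFDerivWithinAt w A S z) : A (c z, 1) = D z := by
  -- A point `z` in the initial plane has a degenerate rescaled characteristic that carries no
  -- information. Hence `z` is approximated by points `zε` on the segment towards some `o` off the
  -- plane, on the same side as `z`.
  obtain ⟨o, ho, hne, hsgn⟩ : ∃ o ∈ S, o.2 - t0 ≠ 0 ∧ 0 ≤ (o.2 - t0) * (z.2 - t0) := by
    rcases le_total t0 z.2 with h | h
    · obtain ⟨o, ho, h1⟩ := hpos
      exact ⟨o, ho, sub_ne_zero.2 h1.ne',
        mul_nonneg (by linarith) (by linarith)⟩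
    · obtain ⟨o, ho, h1⟩ := hneg
      exact ⟨o, ho, (by linarith : o.2 - t0 < 0).ne,
        mul_nonneg_of_nonpos_of_nonpos (by linarith) (by linarith)⟩
  set τ := o.2 - t0 with hτ
  have hτ0 : 0 < |τ| := abs_pos.2 hne
  have hM0 : 0 ≤ M := (norm_nonneg _).trans (hM z hz)
  set R : ℝ := (M + 1) * |τ| + ‖o - z‖ with hR
  have hR0 : 0 < R := by positivity
  obtain ⟨K, hK⟩ := hcd.lip
  have key : ∀ η : ℝ, 0 < η → |τ| * |A (c z, 1) - D z| ≤ η * (|τ| + ‖A‖ * |τ| + 2 * R) := by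
    intro η hη
    have e1 : ∀ᶠ p in 𝓝[S] z, ‖c p - c z‖ ≤ η := by
      have := Metric.tendsto_nhds.1 (hK.continuousOn z hz) η hη
      filter_upwards [this] with p hp
      rw [← dist_eq_norm]; exact hp.le
    have e2 : ∀ᶠ p in 𝓝[S] z, |D p - D z| ≤ η := by
      have := Metric.tendsto_nhds.1 (hD z hz) η hη
      filter_upwards [this] with p hp
      exact hp.le
    have e3 : ∀ᶠ p in 𝓝[S] z, ‖w p - w z - A (p - z)‖ ≤ η * ‖p - z‖ :=
      (hasFDerivWithinAt_iff_isLittleO.1 hA).bound hη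
    obtain ⟨δ, hδ, hall⟩ := Metric.mem_nhdsWithin_iff.1 (e1.and (e2.and e3))
    set ε : ℝ := min 1 (δ / (2 * R)) with hε
    have hε0 : 0 < ε := by positivity
    have hε1 : ε ≤ 1 := min_le_left _ _
    have hεR : ε * R < δ := by
      have : ε ≤ δ / (2 * R) := min_le_right _ _
      have : ε * R ≤ δ / (2 * R) * R := by gcongr
      have h2 : δ / (2 * R) * R = δ / 2 := by field_simp
      linarith
    set zε : E × ℝ := z + ε • (o - z) with hzε
    have hzεS : zε ∈ S := hS.add_smul_sub_mem hz ho ⟨hε0.le, hε1⟩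
    have ht : zε.2 - t0 = (1 - ε) * (z.2 - t0) + ε * τ := by
      simp [hzε, hτ]; ring
    have habs : |zε.2 - t0| = (1 - ε) * |z.2 - t0| + ε * |τ| := by
      rw [ht]
      have : |(1 - ε) * (z.2 - t0) + ε * τ| = |(1 - ε) * (z.2 - t0)| + |ε * τ| := by
        rw [abs_add_eq_add_abs_iff]
        have h1 : 0 ≤ 1 - ε := by linarith
        rcases lt_or_gt_of_ne hne with h | h
        · right
          have : z.2 - t0 ≤ 0 := by
            by_contra hcon
            push Not at hcon
            have := mul_neg_of_neg_of_pos h hcon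
            linarith
          exact ⟨mul_nonpos_of_nonneg_of_nonpos h1 this, mul_nonpos_of_nonneg_of_nonpos hε0.le h.le⟩
        · left
          have : 0 ≤ z.2 - t0 := by
            by_contra hcon
            push Not at hcon
            have := mul_neg_of_pos_of_neg h hcon
            linarith
          exact ⟨mul_nonneg h1 this, mul_nonneg hε0.le h.le⟩
      rw [this, abs_mul, abs_mul, abs_of_nonneg hε0.le, abs_of_nonneg (by linarith : 0 ≤ 1 - ε)]
    set T := |zε.2 - t0| with hT
    have hTpos : 0 < T := by
      rw [habs]
      have : 0 ≤ (1 - ε) * |z.2 - t0| := mul_nonneg (by linarith) (abs_nonneg _)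
      have : 0 < ε * |τ| := by positivity
      linarith
    have htne : zε.2 - t0 ≠ 0 := abs_pos.1 hTpos
    -- The part of the characteristic of `zε` over `[ρ, 1]` lasts exactly `ε|τ|`. It lies within `ε
    -- R` of `z`, so all errors are `η` times a multiple of `ε`.
    set ρ : ℝ := 1 - ε * |τ| / T with hρ
    have hρmem : ρ ∈ Icc (0 : ℝ) 1 := by
      have h1 : ε * |τ| / T ≤ 1 := by
        rw [div_le_one hTpos, habs]
        have : 0 ≤ (1 - ε) * |z.2 - t0| := mul_nonneg (by linarith) (abs_nonneg _)
        linarith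
      have h2 : 0 ≤ ε * |τ| / T := by positivity
      exact ⟨by linarith, by linarith⟩
    have hρT : (1 - ρ) * T = ε * |τ| := by
      rw [hρ]; field_simp; ring
    have hρt : (1 - ρ) * (zε.2 - t0) = ε * τ := by
      have h1 : (1 - ρ) = ε * |τ| / T := by rw [hρ]; ring
      have h2 : |τ| * ((1 - ε) * (z.2 - t0) + ε * τ) = τ * T := by
        rw [habs]
        rcases lt_or_gt_of_ne hne with h | h
        · have : z.2 - t0 ≤ 0 := by
            by_contra hcon
            push Not at hcon
            have := mul_neg_of_neg_of_pos h hcon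
            linarith
          rw [abs_of_neg h, abs_of_nonpos this]; ring
        · have : 0 ≤ z.2 - t0 := by
            by_contra hcon
            push Not at hcon
            have := mul_neg_of_pos_of_neg h hcon
            linarith
          rw [abs_of_pos h, abs_of_nonneg this]
      rw [h1, ht, div_mul_eq_mul_div, mul_assoc, h2]
      field_simp
    obtain ⟨Y, hY⟩ := hcd.exists_char zε hzεS
    have hmem := hcd.mem zε hzεS Y hY
    have hIcc : ∀ σ ∈ Icc ρ 1, σ ∈ Icc (0 : ℝ) 1 := fun σ hσ => ⟨hρmem.1.trans hσ.1, hσ.2⟩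
    have hdz : ‖zε - z‖ = ε * ‖o - z‖ := by
      rw [hzε, add_sub_cancel_left, norm_smul, Real.norm_of_nonneg hε0.le]
    have hnear : ∀ σ ∈ Icc ρ 1, ‖pt t0 zε Y σ - z‖ ≤ ε * R := by
      intro σ hσ
      have hσ' := hIcc σ hσ
      have h1 : ‖pt t0 zε Y σ - zε‖ ≤ (M + 1) * (ε * |τ|) := by
        have hle : T * |σ - 1| ≤ ε * |τ| := by
          rw [abs_of_nonpos (by linarith [hσ.2]), ← hρT, mul_comm]
          have := hσ.1
          gcongr
          linarith
        rw [Prod.norm_def]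
        refine max_le ?_ ?_
        · have := norm_sub_le_of_norm_deriv_le (B := T * M) hY.deriv (fun s hs => by
            rw [norm_smul, Real.norm_eq_abs]
            exact mul_le_mul_of_nonneg_left (hM _ (hmem s hs)) (abs_nonneg _)) (ρ := 1) (σ := σ)
            (by simp) hσ'
          rw [hY.end_eq] at this
          refine this.trans ?_
          calc T * M * |σ - 1| = M * (T * |σ - 1|) := by ring
            _ ≤ M * (ε * |τ|) := by gcongr
            _ ≤ _ := by
              have : 0 ≤ ε * |τ| := by positivity
              linarith
        · have e : (pt t0 zε Y σ - zε).2 = (σ - 1) * (zε.2 - t0) := by simp; ring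
          rw [e, norm_mul, Real.norm_eq_abs, Real.norm_eq_abs, mul_comm]
          refine hle.trans ?_
          have : 0 ≤ M * (ε * |τ|) := by positivity
          linarith
      have h2 := norm_sub_le_norm_sub_add_norm_sub (pt t0 zε Y σ) zε z
      rw [hdz] at h2
      calc _ ≤ _ := h2
        _ ≤ (M + 1) * (ε * |τ|) + ε * ‖o - z‖ := by linarith
        _ = _ := by rw [hR]; ring
    have hgood : ∀ σ ∈ Icc ρ 1, ‖c (pt t0 zε Y σ) - c z‖ ≤ η ∧ |D (pt t0 zε Y σ) - D z| ≤ η ∧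
        ‖w (pt t0 zε Y σ) - w z - A (pt t0 zε Y σ - z)‖ ≤ η * ‖pt t0 zε Y σ - z‖ := by
      intro σ hσ
      refine hall ⟨?_, hmem σ (hIcc σ hσ)⟩
      rw [Metric.mem_ball, dist_eq_norm]
      exact (hnear σ hσ).trans_lt hεR
    have h1mem : (1 : ℝ) ∈ Icc ρ 1 := ⟨hρmem.2, le_rfl⟩
    have hρm : ρ ∈ Icc ρ 1 := ⟨le_rfl, hρmem.2⟩
    -- Over this short part the curve moves almost by `ετ c(z)` and `w` changes almost by `ετ D(z)`.
    -- Expanding `w` at `z` at both ends compares the two increments through `A`.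
    have hYinc : ‖Y 1 - Y ρ - (ε * τ) • c z‖ ≤ η * (ε * |τ|) := by
      have hd : ∀ σ ∈ Icc ρ 1, HasDerivWithinAt (fun s => Y s - (s * (zε.2 - t0)) • c z)
          ((zε.2 - t0) • c (pt t0 zε Y σ) - (zε.2 - t0) • c z) (Icc ρ 1) σ := by
        intro σ hσ
        refine ((hY.deriv σ (hIcc σ hσ)).mono hIcc).sub ?_
        have h1 : HasDerivAt (fun s : ℝ => s * (zε.2 - t0)) (zε.2 - t0) σ := by
          simpa using (hasDerivAt_id σ).mul_const (zε.2 - t0)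
        exact (h1.smul_const (c z)).hasDerivWithinAt
      have := (convex_Icc ρ 1).norm_image_sub_le_of_norm_hasDerivWithin_le (C := T * η) hd
        (fun σ hσ => by
          rw [← smul_sub, norm_smul, Real.norm_eq_abs]
          exact mul_le_mul_of_nonneg_left (hgood σ hσ).1 (abs_nonneg _)) hρm h1mem
      have e : Y 1 - (1 * (zε.2 - t0)) • c z - (Y ρ - (ρ * (zε.2 - t0)) • c z) =
          Y 1 - Y ρ - (ε * τ) • c z := by
        have h2 : (ε * τ) • c z = (1 * (zε.2 - t0)) • c z - (ρ * (zε.2 - t0)) • c z := by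
          rw [← sub_smul, ← sub_mul, hρt]
        rw [h2]; abel
      rw [e, Real.norm_of_nonneg (by linarith [hρmem.2] : 0 ≤ 1 - ρ)] at this
      calc _ ≤ _ := this
        _ = η * ((1 - ρ) * T) := by ring
        _ = _ := by rw [hρT]
    have hwinc : |w zε - w (pt t0 zε Y ρ) - ε * τ * D z| ≤ η * (ε * |τ|) := by
      have hd : ∀ σ ∈ Icc ρ 1,
          HasDerivWithinAt (fun s => w (pt t0 zε Y s) - (s * (zε.2 - t0)) * D z)
          ((zε.2 - t0) * D (pt t0 zε Y σ) - (zε.2 - t0) * D z) (Icc ρ 1) σ := by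
        intro σ hσ
        refine ((hw zε hzεS Y hY σ (hIcc σ hσ)).mono hIcc).sub ?_
        have h1 : HasDerivAt (fun s : ℝ => s * (zε.2 - t0)) (zε.2 - t0) σ := by
          simpa using (hasDerivAt_id σ).mul_const (zε.2 - t0)
        exact (h1.mul_const (D z)).hasDerivWithinAt
      have := (convex_Icc ρ 1).norm_image_sub_le_of_norm_hasDerivWithin_le (C := T * η) hd
        (fun σ hσ => by
          rw [← mul_sub, norm_mul, Real.norm_eq_abs]
          exact mul_le_mul_of_nonneg_left (hgood σ hσ).2.1 (abs_nonneg _)) hρm h1mem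
      have e : w (pt t0 zε Y 1) - (1 * (zε.2 - t0)) * D z -
          (w (pt t0 zε Y ρ) - (ρ * (zε.2 - t0)) * D z) =
          w zε - w (pt t0 zε Y ρ) - ε * τ * D z := by
        rw [← hρt, hY.pt_one]; ring
      rw [e, Real.norm_of_nonneg (by linarith [hρmem.2] : 0 ≤ 1 - ρ)] at this
      calc _ ≤ _ := this
        _ = η * ((1 - ρ) * T) := by ring
        _ = _ := by rw [hρT]
    have hAinc : |A (zε - pt t0 zε Y ρ) - ε * τ * A (c z, 1)| ≤ ‖A‖ * (η * (ε * |τ|)) := by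
      have e : A (zε - pt t0 zε Y ρ) - ε * τ * A (c z, 1) = A (Y 1 - Y ρ - (ε * τ) • c z, 0) := by
        rw [← smul_eq_mul (ε * τ), ← A.map_smul, ← A.map_sub]
        congr 1
        ext1
        · simp [hY.end_eq]
        · simp only [Prod.snd_sub, pt_snd, Prod.smul_snd, smul_eq_mul, mul_one]
          rw [← hρt]; ring
      rw [e]
      refine (A.le_opNorm _).trans ?_
      gcongr
      rw [Prod.norm_def]
      simpa using hYinc
    have hr1 := (hgood 1 h1mem).2.2
    have hr2 := (hgood ρ hρm).2.2
    have hn1 := hnear 1 h1mem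
    have hn2 := hnear ρ hρm
    rw [hY.pt_one] at hr1 hn1
    have hr1' : |w zε - w z - A (zε - z)| ≤ η * (ε * R) := hr1.trans (by gcongr)
    have hr2' : |w (pt t0 zε Y ρ) - w z - A (pt t0 zε Y ρ - z)| ≤ η * (ε * R) :=
      hr2.trans (by gcongr)
    have hfin : ε * (|τ| * |A (c z, 1) - D z|) ≤ ε * (η * (|τ| + ‖A‖ * |τ| + 2 * R)) := by
      have e : ε * τ * (A (c z, 1) - D z) =
          (w zε - w (pt t0 zε Y ρ) - ε * τ * D z) - (A (zε - pt t0 zε Y ρ) - ε * τ * A (c z, 1)) -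
          ((w zε - w z - A (zε - z)) - (w (pt t0 zε Y ρ) - w z - A (pt t0 zε Y ρ - z))) := by
        rw [map_sub, map_sub, map_sub]; ring
      have e2 : ε * (|τ| * |A (c z, 1) - D z|) = |ε * τ * (A (c z, 1) - D z)| := by
        rw [abs_mul, abs_mul, abs_of_pos hε0, mul_assoc]
      rw [e2, e]
      refine (abs_sub _ _).trans ((add_le_add (abs_sub _ _) (abs_sub _ _)).trans ?_)
      linarith
    exact le_of_mul_le_mul_left hfin hε0
  have h0 : |τ| * |A (c z, 1) - D z| ≤ 0 := by
    set Q := |τ| + ‖A‖ * |τ| + 2 * R with hQ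
    have hQ0 : 0 < Q := by positivity
    refine le_of_forall_pos_le_add fun η hη => ?_
    have := key (η / Q) (by positivity)
    rw [div_mul_cancel₀ _ hQ0.ne'] at this
    linarith
  have h1 : |A (c z, 1) - D z| ≤ 0 := by
    by_contra hcon
    push Not at hcon
    exact absurd h0 (not_le.2 (mul_pos hτ0 hcon))
  exact sub_eq_zero.1 (abs_nonpos_iff.1 h1)

end DirectionalDerivative

/-! ### Lipschitz functions along curves that may run in a null set. -/

section Curves

variable {X : Type*} [NormedAddCommGroup X] [NormedSpace ℝ X] [FiniteDimensional ℝ X]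
  [MeasurableSpace X] [BorelSpace X] {μ : Measure X} [μ.IsAddHaarMeasure]

/-- Almost every translate of a curve avoids a null set at almost all times. -/
theorem ae_translate_notMem {N : Set X} (hN : μ N = 0) {γ : ℝ → X} (hγ : Continuous γ) :
    ∀ᵐ h ∂μ, ∀ᵐ σ ∂(volume : Measure ℝ), γ σ + h ∉ N := by
  set N' := toMeasurable μ N with hN'
  have hN0 : μ N' = 0 := by rw [hN', measure_toMeasurable, hN]
  have hm : MeasurableSet {p : X × ℝ | γ p.2 + p.1 ∈ N'} :=
    (measurableSet_toMeasurable μ N).preimage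
      (by fun_prop : Continuous fun p : X × ℝ => γ p.2 + p.1).measurable
  -- Fubini in the other order: at each fixed time the bad translations form a translate of the null
  -- set.
  have h0 : (μ.prod (volume : Measure ℝ)) {p : X × ℝ | γ p.2 + p.1 ∈ N'} = 0 := by
    rw [Measure.prod_apply_symm hm]
    have : ∀ σ : ℝ, μ ((fun x => (x, σ)) ⁻¹' {p : X × ℝ | γ p.2 + p.1 ∈ N'}) = 0 := by
      intro σ
      have e : (fun x => (x, σ)) ⁻¹' {p : X × ℝ | γ p.2 + p.1 ∈ N'} =
          (fun x => γ σ + x) ⁻¹' N' := rfl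
      rw [e, measure_preimage_add, hN0]
    exact (lintegral_congr this).trans lintegral_zero
  have h1 := (Measure.measure_prod_null hm).1 h0
  filter_upwards [h1] with h hh
  have h2 : ∀ᵐ σ ∂(volume : Measure ℝ), γ σ + h ∉ N' := by
    rw [ae_iff]
    simpa using hh
  filter_upwards [h2] with σ hσ hmem
  exact hσ (subset_toMeasurable μ N hmem)

/-- The increment of a Lipschitz function along a curve that may run in the exceptional null
set, for curves in the interior of the domain, up to a small translation. -/
theorem exists_translate_increment {T : Set X} {u : X → ℝ} {K : NNReal}
    (hu : LipschitzOnWith K u T) {b e : X × X → ℝ}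
    (hb : ContinuousOn b (T ×ˢ univ)) (he : ContinuousOn e (T ×ˢ univ))
    (hae : ∀ᵐ z ∂μ, z ∈ interior T → ∀ A : X →L[ℝ] ℝ, HasFDerivAt u A z →
      ∀ v, |A v - b (z, v)| ≤ e (z, v))
    {γ γ' : ℝ → X} (hγ : ∀ σ ∈ Icc (0 : ℝ) 1, HasDerivWithinAt γ (γ' σ) (Icc 0 1) σ)
    (hγ' : ContinuousOn γ' (Icc 0 1)) {r : ℝ} (hr : 0 < r)
    (hmem : ∀ σ ∈ Icc (0 : ℝ) 1, Metric.ball (γ σ) r ⊆ T) :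
    ∃ h : X, ‖h‖ < r ∧ |u (γ 1 + h) - u (γ 0 + h) - ∫ σ in (0 : ℝ)..1, b (γ σ + h, γ' σ)| ≤
      ∫ σ in (0 : ℝ)..1, e (γ σ + h, γ' σ) := by
  have hrad : ∀ᵐ z ∂μ, z ∈ interior T → DifferentiableAt ℝ u z := by
    filter_upwards [hu.ae_differentiableWithinAt_of_mem (μ := μ)] with z hz hzi
    exact (hz (interior_subset hzi)).differentiableAt (mem_interior_iff_mem_nhds.1 hzi)
  have hboth : ∀ᵐ z ∂μ, z ∈ interior T → (DifferentiableAt ℝ u z ∧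
      ∀ v, |fderiv ℝ u z v - b (z, v)| ≤ e (z, v)) := by
    filter_upwards [hrad, hae] with z h1 h2 hz
    exact ⟨h1 hz, h2 hz _ (h1 hz).hasFDerivAt⟩
  have hγc : ContinuousOn γ (Icc 0 1) := fun σ hσ => (hγ σ hσ).continuousWithinAt
  set γe : ℝ → X := IccExtend zero_le_one ((Icc (0 : ℝ) 1).domRestrict γ) with hγe
  have hγec : Continuous γe := Continuous.Icc_extend' (continuousOn_iff_continuous_domRestrict.1 hγc)
  have hγee : ∀ s ∈ Icc (0 : ℝ) 1, γe s = γ s := fun s hs => by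
    rw [hγe, IccExtend_of_mem _ _ hs]; rfl
  have hnull := ae_translate_notMem (μ := μ) (ae_iff.1 hboth) hγec
  -- A ball has positive measure, so it cannot consist of exceptional translations only.
  have hball : ∃ h ∈ Metric.ball (0 : X) r, ∀ᵐ σ ∂(volume : Measure ℝ), γe σ + h ∉
      {z | ¬(z ∈ interior T → (DifferentiableAt ℝ u z ∧
      ∀ v, |fderiv ℝ u z v - b (z, v)| ≤ e (z, v)))} := by
    by_contra hcon
    have : μ (Metric.ball (0 : X) r) = 0 := by
      refine measure_mono_null (fun h hh => ?_) (ae_iff.1 hnull)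
      exact fun h3 => hcon ⟨h, hh, h3⟩
    exact (Metric.measure_ball_pos μ (0 : X) hr).ne' this
  obtain ⟨h, hhr, hgood⟩ := hball
  rw [mem_ball_zero_iff] at hhr
  refine ⟨h, hhr, ?_⟩
  have hint : ∀ σ ∈ Icc (0 : ℝ) 1, γ σ + h ∈ interior T := by
    intro σ hσ
    refine interior_maximal (hmem σ hσ) Metric.isOpen_ball ?_
    simpa [Metric.mem_ball] using hhr
  have hinT : ∀ σ ∈ Icc (0 : ℝ) 1, γ σ + h ∈ T := fun σ hσ => interior_subset (hint σ hσ)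
  obtain ⟨G, hG⟩ := isCompact_Icc.exists_bound_of_continuousOn hγ'
  have hγlip : LipschitzOnWith G.toNNReal γ (Icc 0 1) :=
    (convex_Icc (0 : ℝ) 1).lipschitzOnWith_of_nnnorm_hasDerivWithin_le hγ fun σ hσ => by
      rw [← NNReal.coe_le_coe, coe_nnnorm]
      exact (hG σ hσ).trans (Real.le_coe_toNNReal G)
  have hulip : LipschitzOnWith (K * (G.toNNReal * 1)) (fun σ => u (γ σ + h)) (Icc 0 1) := by
    have h1 : LipschitzOnWith (G.toNNReal * 1) (fun σ => γ σ + h) (Icc 0 1) := by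
      rw [mul_one]
      refine LipschitzOnWith.of_dist_le_mul fun x hx y hy => ?_
      rw [dist_add_right]
      exact hγlip.dist_le_mul x hx y hy
    exact hu.comp h1 hinT
  have hac : AbsolutelyContinuousOnInterval (fun σ => u (γ σ + h)) 0 1 := by
    refine LipschitzOnWith.absolutelyContinuousOnInterval (K := K * (G.toNNReal * 1)) ?_
    rwa [uIcc_of_le zero_le_one]
  have hftc := hac.integral_deriv_eq_sub
  have hcont : ContinuousOn (fun σ => (γ σ + h, γ' σ)) (Icc 0 1) :=
    (hγc.add continuousOn_const).prodMk hγ'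
  have hmaps : MapsTo (fun σ => (γ σ + h, γ' σ)) (Icc 0 1) (T ×ˢ univ) :=
    fun σ hσ => ⟨hinT σ hσ, mem_univ _⟩
  have hbi : IntervalIntegrable (fun σ => b (γ σ + h, γ' σ)) volume 0 1 :=
    (hb.comp hcont hmaps).intervalIntegrable_of_Icc zero_le_one
  have hei : IntervalIntegrable (fun σ => e (γ σ + h, γ' σ)) volume 0 1 :=
    (he.comp hcont hmaps).intervalIntegrable_of_Icc zero_le_one
  rw [← hftc, ← intervalIntegral.integral_sub hac.intervalIntegrable_deriv hbi,
    ← Real.norm_eq_abs]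
  refine intervalIntegral.norm_integral_le_of_norm_le zero_le_one ?_ hei
  have hne1 : ∀ᵐ σ ∂(volume : Measure ℝ), σ ≠ 1 := by
    simp [ae_iff]
  filter_upwards [hgood, hne1] with σ hσ hσ1 hσm
  have hσo : σ ∈ Ioo (0 : ℝ) 1 := ⟨hσm.1, lt_of_le_of_ne hσm.2 hσ1⟩
  have hσI : σ ∈ Icc (0 : ℝ) 1 := Ioo_subset_Icc_self hσo
  rw [hγee σ hσI] at hσ
  obtain ⟨hd, hv⟩ := not_not.1 hσ (hint σ hσI)
  have h1 : HasDerivAt (fun s => γ s + h) (γ' σ) σ :=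
    ((hγ σ hσI).hasDerivAt (Icc_mem_nhds hσo.1 hσo.2)).add_const h
  have h2 : HasDerivAt (fun s => u (γ s + h)) (fderiv ℝ u (γ σ + h) (γ' σ)) σ :=
    hd.hasFDerivAt.comp_hasDerivAt σ h1
  rw [h2.deriv]
  exact hv _

/-- The increment of a Lipschitz function along a curve, from information that is available
almost everywhere. -/
theorem abs_increment_sub_integral_le {T : Set X} (hT : Convex ℝ T) (hTc : IsCompact T)
    (hTi : (interior T).Nonempty) {u : X → ℝ} {K : NNReal}
    (hu : LipschitzOnWith K u T) {b e : X × X → ℝ}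
    (hb : ContinuousOn b (T ×ˢ univ)) (he : ContinuousOn e (T ×ˢ univ))
    (hae : ∀ᵐ z ∂μ, z ∈ interior T → ∀ A : X →L[ℝ] ℝ, HasFDerivAt u A z →
      ∀ v, |A v - b (z, v)| ≤ e (z, v))
    {γ γ' : ℝ → X} (hγ : ∀ σ ∈ Icc (0 : ℝ) 1, HasDerivWithinAt γ (γ' σ) (Icc 0 1) σ)
    (hγ' : ContinuousOn γ' (Icc 0 1)) (hmem : ∀ σ ∈ Icc (0 : ℝ) 1, γ σ ∈ T) :
    |u (γ 1) - u (γ 0) - ∫ σ in (0 : ℝ)..1, b (γ σ, γ' σ)| ≤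
      ∫ σ in (0 : ℝ)..1, e (γ σ, γ' σ) := by
  obtain ⟨o, ho⟩ := hTi
  obtain ⟨r, hr, hball⟩ := Metric.isOpen_iff.1 isOpen_interior o ho
  have hγc : ContinuousOn γ (Icc 0 1) := fun σ hσ => (hγ σ hσ).continuousWithinAt
  set δ : ℕ → ℝ := fun k => 1 / ((k : ℝ) + 1) with hδ
  have hδ0 : ∀ k, 0 < δ k := fun k => by positivity
  have hδ1 : ∀ k, δ k ≤ 1 := fun k => by
    rw [hδ]
    simp only
    rw [div_le_one (by positivity)]
    linarith [(Nat.cast_nonneg k : (0 : ℝ) ≤ k)]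
  have hδl : Tendsto δ atTop (𝓝 0) := tendsto_one_div_add_atTop_nhds_zero_nat
  -- Contracting the curve towards an interior point `o` leaves a tube of radius `δ k * r` inside
  -- `T`, which is room for the translation. Then `δ k → 0`, with dominated convergence on both
  -- integrals.
  set g : ℕ → ℝ → X := fun k σ => (1 - δ k) • γ σ + δ k • o with hg
  have hgball : ∀ k, ∀ σ ∈ Icc (0 : ℝ) 1, Metric.ball (g k σ) (δ k * r) ⊆ T := by
    intro k σ hσ p hp
    have h1 : o + (δ k)⁻¹ • (p - g k σ) ∈ T := by
      refine interior_subset (hball ?_)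
      rw [mem_ball_iff_norm, add_sub_cancel_left, norm_smul, norm_inv,
        Real.norm_of_nonneg (hδ0 k).le, inv_mul_lt_iff₀ (hδ0 k)]
      exact mem_ball_iff_norm.1 hp
    have h2 := hT (hmem σ hσ) h1 (sub_nonneg.2 (hδ1 k)) (hδ0 k).le (by ring)
    have h3 : (1 - δ k) • γ σ + δ k • (o + (δ k)⁻¹ • (p - g k σ)) = p := by
      rw [smul_add, smul_smul, mul_inv_cancel₀ (hδ0 k).ne', one_smul, hg]
      simp only
      abel
    rwa [h3] at h2
  have hgd : ∀ k, ∀ σ ∈ Icc (0 : ℝ) 1,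
      HasDerivWithinAt (g k) ((1 - δ k) • γ' σ) (Icc 0 1) σ := fun k σ hσ =>
    ((hγ σ hσ).const_smul (1 - δ k)).add_const _
  have hex : ∀ k, ∃ h : X, ‖h‖ < δ k * r ∧
      |u (g k 1 + h) - u (g k 0 + h) -
        ∫ σ in (0 : ℝ)..1, b (g k σ + h, (1 - δ k) • γ' σ)| ≤
      ∫ σ in (0 : ℝ)..1, e (g k σ + h, (1 - δ k) • γ' σ) := fun k =>
    exists_translate_increment hu hb he hae (hgd k) (hγ'.const_smul _)
      (mul_pos (hδ0 k) hr) (hgball k)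
  choose h hh hinc using hex
  have hinT : ∀ k, ∀ σ ∈ Icc (0 : ℝ) 1, g k σ + h k ∈ T := fun k σ hσ =>
    hgball k σ hσ (by simpa [Metric.mem_ball] using hh k)
  have hhl : Tendsto h atTop (𝓝 0) := by
    refine squeeze_zero_norm (fun k => (hh k).le) ?_
    simpa using hδl.mul_const r
  have hgl : ∀ σ, Tendsto (fun k => g k σ + h k) atTop (𝓝 (γ σ)) := by
    intro σ
    have h1 : Tendsto (fun k => (1 - δ k) • γ σ + δ k • o + h k) atTop
        (𝓝 ((1 - 0 : ℝ) • γ σ + (0 : ℝ) • o + 0)) :=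
      (((hδl.const_sub 1).smul_const _).add (hδl.smul_const _)).add hhl
    simpa using h1
  have hul : ∀ σ ∈ Icc (0 : ℝ) 1, Tendsto (fun k => u (g k σ + h k)) atTop (𝓝 (u (γ σ))) := by
    intro σ hσ
    refine (hu.continuousOn (γ σ) (hmem σ hσ)).tendsto.comp ?_
    exact tendsto_nhdsWithin_iff.2 ⟨hgl σ, Eventually.of_forall fun k => hinT k σ hσ⟩
  obtain ⟨G, hG⟩ := isCompact_Icc.exists_bound_of_continuousOn hγ'
  have hlim : ∀ f : X × X → ℝ, ContinuousOn f (T ×ˢ univ) →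
      Tendsto (fun k => ∫ σ in (0 : ℝ)..1, f (g k σ + h k, (1 - δ k) • γ' σ)) atTop
        (𝓝 (∫ σ in (0 : ℝ)..1, f (γ σ, γ' σ))) := by
    intro f hf
    have hcomp : IsCompact (T ×ˢ Metric.closedBall (0 : X) G) :=
      hTc.prod (isCompact_closedBall 0 G)
    obtain ⟨B, hB⟩ := hcomp.exists_bound_of_continuousOn
      (hf.mono (prod_mono le_rfl (subset_univ _)))
    have hIoc : ∀ σ ∈ uIoc (0 : ℝ) 1, σ ∈ Icc (0 : ℝ) 1 := fun σ hσ => by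
      rw [uIoc_of_le zero_le_one] at hσ
      exact Ioc_subset_Icc_self hσ
    refine intervalIntegral.tendsto_integral_filter_of_dominated_convergence (fun _ => B) ?_ ?_
      (by simp) ?_
    · refine Eventually.of_forall fun k => ?_
      have h1 : ContinuousOn (fun σ => (g k σ + h k, (1 - δ k) • γ' σ)) (Icc 0 1) :=
        (((hγc.const_smul _).add continuousOn_const).add continuousOn_const).prodMk
          (hγ'.const_smul _)
      have h2 : ContinuousOn (fun σ => f (g k σ + h k, (1 - δ k) • γ' σ)) (Icc 0 1) :=
        hf.comp h1 fun σ hσ => ⟨hinT k σ hσ, mem_univ _⟩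
      rw [uIoc_of_le zero_le_one]
      exact (h2.mono Ioc_subset_Icc_self).aestronglyMeasurable measurableSet_Ioc
    · refine Eventually.of_forall fun k => Eventually.of_forall fun σ hσ => ?_
      refine hB _ ⟨hinT k σ (hIoc σ hσ), ?_⟩
      simp only [mem_closedBall_zero_iff, norm_smul]
      have h1 : ‖1 - δ k‖ ≤ 1 := by
        rw [Real.norm_of_nonneg (sub_nonneg.2 (hδ1 k))]
        linarith [hδ0 k]
      have h2 := hG σ (hIoc σ hσ)
      exact (mul_le_of_le_one_left (norm_nonneg _) h1).trans h2
    · refine Eventually.of_forall fun σ hσ => ?_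
      have hσ' := hIoc σ hσ
      refine (hf (γ σ, γ' σ) ⟨hmem σ hσ', mem_univ _⟩).tendsto.comp ?_
      refine tendsto_nhdsWithin_iff.2 ⟨?_, Eventually.of_forall fun k =>
        ⟨hinT k σ hσ', mem_univ _⟩⟩
      refine (hgl σ).prodMk_nhds ?_
      have : Tendsto (fun k => (1 - δ k) • γ' σ) atTop (𝓝 ((1 - 0 : ℝ) • γ' σ)) :=
        (hδl.const_sub 1).smul_const _
      simpa using this
  exact le_of_tendsto_of_tendsto
    ((((hul 1 (by simp)).sub (hul 0 (by simp))).sub (hlim b hb)).abs) (hlim e he)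
    (Eventually.of_forall hinc)

/-- A Lipschitz function whose derivative coincides almost everywhere with a continuous function
is continuously differentiable, up to the boundary. -/
theorem hasFDerivWithinAt_of_ae {T : Set X} (hT : Convex ℝ T) (hTc : IsCompact T)
    (hTi : (interior T).Nonempty) {u : X → ℝ} {K : NNReal} (hu : LipschitzOnWith K u T)
    {A : X → X →L[ℝ] ℝ} (hA : ContinuousOn A T)
    (hae : ∀ᵐ z ∂μ, z ∈ interior T → ∀ A' : X →L[ℝ] ℝ, HasFDerivAt u A' z → A' = A z)
    {z : X} (hz : z ∈ T) : HasFDerivWithinAt u (A z) T z := by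
  have hb : ContinuousOn (fun p : X × X => A p.1 p.2) (T ×ˢ univ) := by
    refine ContinuousOn.clm_apply (hA.comp continuousOn_fst fun p hp => hp.1) continuousOn_snd
  rw [hasFDerivWithinAt_iff_isLittleO, Asymptotics.isLittleO_iff]
  intro η hη
  have hnear := Metric.tendsto_nhds.1 (hA z hz) η hη
  obtain ⟨δ, hδ, hall⟩ := Metric.mem_nhdsWithin_iff.1 hnear
  refine Metric.mem_nhdsWithin_iff.2 ⟨δ, hδ, fun z' hz' => ?_⟩
  have hseg : ∀ σ ∈ Icc (0 : ℝ) 1, z + σ • (z' - z) ∈ T := fun σ hσ =>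
    hT.add_smul_sub_mem hz hz'.2 hσ
  have hd : ∀ σ ∈ Icc (0 : ℝ) 1,
      HasDerivWithinAt (fun s : ℝ => z + s • (z' - z)) (z' - z) (Icc 0 1) σ := fun σ _ => by
    have := ((hasDerivAt_id σ).smul_const (z' - z)).const_add z
    simpa using this.hasDerivWithinAt
  -- With error term zero, the increment along a segment is exactly the integral of `A`; continuity
  -- of `A` at `z` then yields the derivative.
  have hinc := abs_increment_sub_integral_le (μ := μ) hT hTc hTi hu (b := fun p => A p.1 p.2)
    (e := fun _ => 0) hb continuousOn_const (by
      filter_upwards [hae] with y hy hyi A' hA' v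
      rw [hy hyi A' hA']
      simp) hd continuousOn_const hseg
  simp only [one_smul, zero_smul, add_zero, add_sub_cancel, intervalIntegral.integral_zero,
    abs_nonpos_iff] at hinc
  have hci : IntervalIntegrable (fun σ : ℝ => A (z + σ • (z' - z)) (z' - z)) volume 0 1 := by
    refine ContinuousOn.intervalIntegrable_of_Icc zero_le_one ?_
    exact (hA.comp (by fun_prop) hseg).clm_apply continuousOn_const
  have e : u z' - u z - A z (z' - z) =
      ∫ σ in (0 : ℝ)..1, (A (z + σ • (z' - z)) (z' - z) - A z (z' - z)) := by
    rw [intervalIntegral.integral_sub hci (by simp), intervalIntegral.integral_const]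
    simp only [sub_zero, one_smul]
    linarith
  simp only [mem_ofPred_eq]
  rw [e]
  have := intervalIntegral.norm_integral_le_of_norm_le_const (a := 0) (b := 1)
    (C := η * ‖z' - z‖) (f := fun σ : ℝ => A (z + σ • (z' - z)) (z' - z) - A z (z' - z))
    (fun σ hσ => by
      rw [uIoc_of_le zero_le_one] at hσ
      have hσ' : σ ∈ Icc (0 : ℝ) 1 := Ioc_subset_Icc_self hσ
      rw [← sub_apply]
      refine (ContinuousLinearMap.le_opNorm _ _).trans ?_
      gcongr
      rw [← dist_eq_norm]
      refine (hall ⟨?_, hseg σ hσ'⟩).le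
      rw [mem_ball_iff_norm, add_sub_cancel_left, norm_smul, Real.norm_of_nonneg hσ'.1]
      refine (mul_le_of_le_one_left (norm_nonneg _) hσ'.2).trans_lt ?_
      exact mem_ball_iff_norm.1 hz'.1)
  simpa using this

end Curves

/-! ### Uniqueness among Lipschitz solutions. -/

section Uniqueness

/-- Integrating the weight along a characteristic gains `1/κ`, uniformly in `T`; this is what makes
a large `κ` absorb the Gronwall constants. -/
theorem integral_mul_exp_le {T κ : ℝ} (hκ : 0 < κ) :
    ∫ σ in (0 : ℝ)..1, T * Real.exp (κ * (σ * T)) ≤ Real.exp (κ * T) / κ := by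
  have hd : ∀ σ : ℝ, HasDerivAt (fun s => Real.exp (κ * (s * T)) / κ)
      (T * Real.exp (κ * (σ * T))) σ := fun σ => by
    refine ((((hasDerivAt_id σ).mul_const T).const_mul κ).exp.div_const κ).congr_deriv ?_
    simp only [id, one_mul]
    field_simp
  rw [intervalIntegral.integral_eq_sub_of_hasDerivAt (fun σ _ => hd σ)
    ((by fun_prop : Continuous fun σ => T * Real.exp (κ * (σ * T))).intervalIntegrable _ _)]
  have : 0 < Real.exp (κ * (0 * T)) / κ := by positivity
  rw [one_mul]
  linarith

/-- The derivative in direction `(v, 1)` in terms of the partial derivatives. -/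
theorem clm_apply_prod {d : ℕ} (A : (Fin d → ℝ) × ℝ →L[ℝ] ℝ) (v : Fin d → ℝ) (s : ℝ) :
    A (v, s) = ∑ l, v l * A (Pi.single l 1, 0) + s * A (0, 1) := by
  have e : (v, s) = ∑ l, v l • ((Pi.single l 1 : Fin d → ℝ), (0 : ℝ)) + s • ((0 : Fin d → ℝ), (1 : ℝ)) := by
    ext1
    · simp only [Prod.fst_add, Prod.fst_sum, Prod.smul_fst, smul_zero, add_zero]
      exact pi_eq_sum_univ' v
    · simp [Prod.snd_sum]
  rw [e, map_add, map_sum, map_smul, smul_eq_mul]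
  simp only [map_smul, smul_eq_mul]

variable {m n : ℕ} {t0 : ℝ} {T : Set (Dom m)} {C : Fin n → Fin (m - 1) → Dom m × Cod n → ℝ}
  {D : Fin n → Dom m × Cod n → ℝ} {f g : Dom m → Cod n}

theorem isAddHaarMeasure_volume_prod (d : ℕ) :
    (volume : Measure ((Fin d → ℝ) × ℝ)).IsAddHaarMeasure :=
  inferInstanceAs ((volume : Measure (Fin d → ℝ)).prod (volume : Measure ℝ)).IsAddHaarMeasure

/-- A Lipschitz function that satisfies the system wherever it is differentiable coincides with
every function that solves the system along its own characteristics. -/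
theorem eqOn_of_transported (hT : Convex ℝ T) (hTc : IsCompact T) (hTi : (interior T).Nonempty)
    {KC KD : ℝ} {Kg : NNReal}
    (hKC : ∀ z ∈ T, ∀ i l, |C i l (z, f z) - C i l (z, g z)| ≤ KC * ‖f z - g z‖)
    (hKD : ∀ z ∈ T, ∀ i, |D i (z, f z) - D i (z, g z)| ≤ KD * ‖f z - g z‖)
    (hcC : ∀ i, ContinuousOn (vf C g i) T) (hcD : ∀ i, ContinuousOn (fun z => D i (z, g z)) T)
    (hcDf : ∀ i, ContinuousOn (fun z => D i (z, f z)) T)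
    (hf : ContinuousOn f T) (hg : LipschitzOnWith Kg g T)
    (hcd : ∀ i, CharDomain t0 T (vf C f i))
    (htr : ∀ i, Transported t0 T (vf C f i) (fun z => D i (z, f z)) (fun z => f z i))
    (hinit : ∀ x, (x, t0) ∈ T → g (x, t0) = f (x, t0))
    (heq : ∀ z ∈ interior T, DifferentiableAt ℝ g z → ∀ i,
      (∑ l, C i l (z, g z) * fderiv ℝ g z (Pi.single l 1, 0) i) + fderiv ℝ g z (0, 1) i =
        D i (z, g z)) : EqOn g f T := by
  obtain ⟨Mτ, hMτ⟩ := hTc.exists_bound_of_continuousOn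
    (f := fun z : Dom m => z.2 - t0) (by fun_prop)
  obtain ⟨MΦ, hMΦ⟩ := hTc.exists_bound_of_continuousOn (f := fun z => f z - g z)
    (hf.sub hg.continuousOn)
  set Q : ℝ := |KD| + Kg * |KC| with hQ
  have hQ0 : 0 ≤ Q := by positivity
  set κ : ℝ := 2 * Q + 1 with hκ
  have hκ0 : 0 < κ := by positivity
  have main := le_of_weighted_bound (A := T) (Φ := fun z => ‖f z - g z‖)
    (τ := fun z => |(z : Dom m).2 - t0|) (η := 0) (κ := κ) (M := MΦ) (T := Mτ) hκ0.le le_rfl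
    (fun _ => abs_nonneg _) (fun z => hMτ z z.2) (fun z => hMΦ z z.2) ?_
  · intro z hz
    have := main ⟨z, hz⟩
    simp only [mul_zero, zero_mul] at this
    exact (sub_eq_zero.1 (norm_le_zero_iff.1 this)).symm
  rintro B hB0 hB ⟨z, hz⟩
  simp only [zero_add]
  refine (pi_norm_le_iff_of_nonneg (by positivity)).2 fun i => ?_
  obtain ⟨Y, hY⟩ := (hcd i).exists_char z hz
  have hmem := (hcd i).mem z hz Y hY
  set τ := |z.2 - t0| with hτ
  have hpt : ∀ σ ∈ Icc (0 : ℝ) 1, HasDerivWithinAt (pt t0 z Y)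
      ((z.2 - t0) • vf C f i (pt t0 z Y σ), z.2 - t0) (Icc 0 1) σ := by
    intro σ hσ
    have h1 : HasDerivAt (fun s : ℝ => t0 + s * (z.2 - t0)) (z.2 - t0) σ := by
      simpa using ((hasDerivAt_id σ).mul_const (z.2 - t0)).const_add t0
    exact (hY.deriv σ hσ).prodMk h1.hasDerivWithinAt
  obtain ⟨Kc, hKc⟩ := (hcd i).lip
  have hvfc : ContinuousOn (fun σ => vf C f i (pt t0 z Y σ)) (Icc 0 1) :=
    hKc.continuousOn.comp hY.continuousOn_pt hmem
  have hvgc : ContinuousOn (fun σ => vf C g i (pt t0 z Y σ)) (Icc 0 1) :=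
    (hcC i).comp hY.continuousOn_pt hmem
  have hγ'c : ContinuousOn (fun σ => ((z.2 - t0) • vf C f i (pt t0 z Y σ), z.2 - t0))
      (Icc 0 1) := ContinuousOn.prodMk (hvfc.const_smul (z.2 - t0)) continuousOn_const
  have hgi : LipschitzOnWith Kg (fun z => g z i) T := fun x hx y hy =>
    (edist_le_pi_edist (g x) (g y) i).trans (hg hx hy)
  have := isAddHaarMeasure_volume_prod (m - 1)
  have hrad : ∀ᵐ p ∂(volume : Measure (Dom m)), p ∈ interior T → DifferentiableAt ℝ g p := by
    filter_upwards [hg.ae_differentiableWithinAt_of_mem (μ := (volume : Measure (Dom m)))] with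
      p hp hpi
    exact (hp (interior_subset hpi)).differentiableAt (mem_interior_iff_mem_nhds.1 hpi)
  -- Where `g` is differentiable, the system gives its derivative in direction `(C(g), 1)`. In a
  -- direction `(v, s)` this accounts for `s D(g)`, and the remaining spatial part `v - s C(g)`
  -- costs the Lipschitz constant `Kg`. Along a characteristic of `f` that part is a multiple of
  -- `C(f) - C(g)`, hence controlled by `f - g`.
  have hinc := abs_increment_sub_integral_le (μ := (volume : Measure (Dom m))) hT hTc hTi hgi
    (b := fun q => q.2.2 * D i (q.1, g q.1)) (e := fun q => Kg * ‖q.2.1 - q.2.2 • vf C g i q.1‖)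
    (by
      refine ContinuousOn.mul continuous_snd.snd.continuousOn ((hcD i).comp continuousOn_fst fun q hq => hq.1))
    (by
      refine ContinuousOn.mul continuousOn_const (ContinuousOn.norm ?_)
      refine ContinuousOn.sub continuous_snd.fst.continuousOn
        (ContinuousOn.smul continuous_snd.snd.continuousOn ?_)
      exact (hcC i).comp continuousOn_fst fun q hq => hq.1)
    (by
      filter_upwards [hrad] with p hp hpi A hA v
      have hd := hp hpi
      have hA' : A = (ContinuousLinearMap.proj i : Cod n →L[ℝ] ℝ).comp (fderiv ℝ g p) :=
        hA.unique ((ContinuousLinearMap.proj i : Cod n →L[ℝ] ℝ).hasFDerivAt.comp p hd.hasFDerivAt)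
      have hAc : A (vf C g i p, 1) = D i (p, g p) := by
        rw [clm_apply_prod, ← heq p hpi hd i, one_mul, hA']
        rfl
      have e : A v - v.2 * D i (p, g p) = A (v.1 - v.2 • vf C g i p, 0) := by
        rw [← hAc, ← smul_eq_mul, ← A.map_smul, ← A.map_sub]
        congr 1
        ext1 <;> simp
      rw [e, ← Real.norm_eq_abs]
      refine (A.le_opNorm _).trans (mul_le_mul (hA.le_of_lipschitzOn
        (mem_interior_iff_mem_nhds.1 hpi) hgi) ?_ (norm_nonneg _) Kg.2)
      rw [Prod.norm_def]
      simp)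
    hpt hγ'c hmem
  simp only [hY.pt_one, pt_zero] at hinc
  have hDfc : ContinuousOn (fun σ => D i (pt t0 z Y σ, f (pt t0 z Y σ))) (Icc 0 1) :=
    (hcDf i).comp hY.continuousOn_pt hmem
  have hDgc : ContinuousOn (fun σ => D i (pt t0 z Y σ, g (pt t0 z Y σ))) (Icc 0 1) :=
    (hcD i).comp hY.continuousOn_pt hmem
  have hfi : IntervalIntegrable (fun σ => (z.2 - t0) * D i (pt t0 z Y σ, f (pt t0 z Y σ)))
      volume 0 1 := (continuousOn_const.mul hDfc).intervalIntegrable_of_Icc zero_le_one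
  have hgi' : IntervalIntegrable (fun σ => (z.2 - t0) * D i (pt t0 z Y σ, g (pt t0 z Y σ)))
      volume 0 1 := (continuousOn_const.mul hDgc).intervalIntegrable_of_Icc zero_le_one
  have hfint : f z i - f (Y 0, t0) i =
      ∫ σ in (0 : ℝ)..1, (z.2 - t0) * D i (pt t0 z Y σ, f (pt t0 z Y σ)) := by
    have h1 : ∀ σ ∈ Icc (0 : ℝ) 1, HasDerivWithinAt (fun s => f (pt t0 z Y s) i)
      ((z.2 - t0) * D i (pt t0 z Y σ, f (pt t0 z Y σ))) (Icc 0 1) σ := htr i z hz Y hY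
    rw [intervalIntegral.integral_eq_sub_of_hasDerivAt_of_le zero_le_one
      (f := fun s => f (pt t0 z Y s) i)
      (fun σ hσ => (h1 σ hσ).continuousWithinAt)
      (fun σ hσ => (h1 σ (Ioo_subset_Icc_self hσ)).hasDerivAt (Icc_mem_nhds hσ.1 hσ.2))
      hfi, hY.pt_one, pt_zero]
  have h00 : g (Y 0, t0) = f (Y 0, t0) := by
    refine hinit _ ?_
    have := hmem 0 (by simp)
    rwa [pt_zero] at this
  have hB' : ∀ σ ∈ Icc (0 : ℝ) 1,
      ‖f (pt t0 z Y σ) - g (pt t0 z Y σ)‖ ≤ B * Real.exp (κ * (σ * τ)) := fun σ hσ => by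
    have := hB ⟨_, hmem σ hσ⟩
    rwa [abs_pt_snd_sub hσ] at this
  have hexpi : IntervalIntegrable (fun σ => τ * Real.exp (κ * (σ * τ))) volume 0 1 :=
    (by fun_prop : Continuous fun σ => τ * Real.exp (κ * (σ * τ))).intervalIntegrable _ _
  have hI1 : |∫ σ in (0 : ℝ)..1, ((z.2 - t0) * D i (pt t0 z Y σ, f (pt t0 z Y σ)) -
      (z.2 - t0) * D i (pt t0 z Y σ, g (pt t0 z Y σ)))| ≤
      ∫ σ in (0 : ℝ)..1, |KD| * B * (τ * Real.exp (κ * (σ * τ))) := by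
    rw [← Real.norm_eq_abs]
    refine intervalIntegral.norm_integral_le_of_norm_le zero_le_one
      (Eventually.of_forall fun σ hσ => ?_) (hexpi.const_mul _)
    have hσ' := Ioc_subset_Icc_self hσ
    rw [← mul_sub, norm_mul, Real.norm_eq_abs, ← hτ]
    calc _ ≤ τ * (|KD| * (B * Real.exp (κ * (σ * τ)))) := by
          refine mul_le_mul_of_nonneg_left ((hKD _ (hmem σ hσ') i).trans ?_) (abs_nonneg _)
          exact mul_le_mul (le_abs_self _) (hB' σ hσ') (norm_nonneg _) (abs_nonneg _)
      _ = _ := by ring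
  have hI2 : ∫ σ in (0 : ℝ)..1, Kg * ‖(z.2 - t0) • vf C f i (pt t0 z Y σ) -
      (z.2 - t0) • vf C g i (pt t0 z Y σ)‖ ≤
      ∫ σ in (0 : ℝ)..1, Kg * |KC| * B * (τ * Real.exp (κ * (σ * τ))) := by
    refine intervalIntegral.integral_mono_on zero_le_one ?_ (hexpi.const_mul _) fun σ hσ => ?_
    · have hcn : ContinuousOn (fun σ => ‖(z.2 - t0) • vf C f i (pt t0 z Y σ) -
          (z.2 - t0) • vf C g i (pt t0 z Y σ)‖) (Icc 0 1) := by
        refine ContinuousOn.norm (ContinuousOn.sub ?_ ?_)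
        · exact ContinuousOn.const_smul hvfc (z.2 - t0)
        · exact ContinuousOn.const_smul hvgc (z.2 - t0)
      exact (hcn.intervalIntegrable_of_Icc zero_le_one).const_mul _
    · rw [← smul_sub, norm_smul, Real.norm_eq_abs, ← hτ]
      calc _ ≤ (Kg : ℝ) * (τ * (|KC| * (B * Real.exp (κ * (σ * τ))))) := by
            refine mul_le_mul_of_nonneg_left (mul_le_mul_of_nonneg_left ?_ (abs_nonneg _)) Kg.2
            refine (pi_norm_le_iff_of_nonneg (by positivity)).2 fun l => ?_
            refine (hKC _ (hmem σ hσ) i l).trans ?_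
            exact mul_le_mul (le_abs_self _) (hB' σ hσ) (norm_nonneg _) (abs_nonneg _)
        _ = _ := by ring
  have hsub : ∫ σ in (0 : ℝ)..1, ((z.2 - t0) * D i (pt t0 z Y σ, f (pt t0 z Y σ)) -
      (z.2 - t0) * D i (pt t0 z Y σ, g (pt t0 z Y σ))) =
      (∫ σ in (0 : ℝ)..1, (z.2 - t0) * D i (pt t0 z Y σ, f (pt t0 z Y σ))) -
      ∫ σ in (0 : ℝ)..1, (z.2 - t0) * D i (pt t0 z Y σ, g (pt t0 z Y σ)) :=
    intervalIntegral.integral_sub hfi hgi'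
  rw [hsub, ← hfint] at hI1
  replace hI1 := hI1.trans_eq (intervalIntegral.integral_const_mul _ _)
  replace hI2 := hI2.trans_eq (intervalIntegral.integral_const_mul _ _)
  have hE := integral_mul_exp_le (T := τ) hκ0
  have hE1 : |KD| * B * (∫ σ in (0 : ℝ)..1, τ * Real.exp (κ * (σ * τ))) ≤
      |KD| * B * (Real.exp (κ * τ) / κ) := by gcongr
  have hE2 : Kg * |KC| * B * (∫ σ in (0 : ℝ)..1, τ * Real.exp (κ * (σ * τ))) ≤
      Kg * |KC| * B * (Real.exp (κ * τ) / κ) := by gcongr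
  rw [h00] at hinc
  have htri : |f z i - g z i| ≤
      |f z i - f (Y 0, t0) i - ∫ σ in (0 : ℝ)..1, (z.2 - t0) * D i (pt t0 z Y σ, g (pt t0 z Y σ))| +
      |g z i - f (Y 0, t0) i -
        ∫ σ in (0 : ℝ)..1, (z.2 - t0) * D i (pt t0 z Y σ, g (pt t0 z Y σ))| := by
    refine le_trans (le_of_eq ?_) (abs_sub _ _)
    congr 1
    ring
  have hQκ : Q / κ ≤ 1 / 2 := by
    rw [div_le_iff₀ hκ0, hκ]
    linarith
  have hinc2 := hinc.trans (hI2.trans hE2)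
  calc ‖(f z - g z) i‖ = |f z i - g z i| := rfl
    _ ≤ |KD| * B * (Real.exp (κ * τ) / κ) + Kg * |KC| * B * (Real.exp (κ * τ) / κ) :=
        htri.trans (add_le_add (hI1.trans hE1) hinc2)
    _ = Q / κ * (B * Real.exp (κ * τ)) := by rw [hQ]; field_simp
    _ ≤ 1 / 2 * (B * Real.exp (κ * τ)) := by gcongr
    _ = _ := by ring

end Uniqueness

/-! ### Continuous solutions along prescribed characteristics. -/

section Semilinear

set_option linter.unusedSectionVars false

variable {E : Type*} [NormedAddCommGroup E] [NormedSpace ℝ E]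
  {t0 : ℝ} {S : Set (E × ℝ)}

theorem CharDomain.exists_bound {c : E × ℝ → E} (h : CharDomain t0 S c) (hS : IsCompact S) :
    ∃ M, ∀ z ∈ S, ‖c z‖ ≤ M := by
  obtain ⟨K, hK⟩ := h.lip
  exact hS.exists_bound_of_continuousOn hK.continuousOn

theorem exists_time_bound (hS : IsCompact S) (t0 : ℝ) : ∃ α, 0 ≤ α ∧ ∀ z ∈ S, |z.2 - t0| ≤ α := by
  obtain ⟨α, hα⟩ := hS.exists_bound_of_continuousOn
    (f := fun z : E × ℝ => z.2 - t0) (by fun_prop)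
  exact ⟨|α|, abs_nonneg _, fun z hz => (hα z hz).trans (le_abs_self α)⟩

/-- Continuity in the parameter and a Lipschitz bound in the end point, uniform in the parameter,
give joint continuity. -/
theorem CharDomain.continuousOn_pt_flow {c : E × ℝ → E} (h : CharDomain t0 S c)
    (hS : IsCompact S) :
    ContinuousOn (fun q : (E × ℝ) × ℝ => pt t0 q.1 (flow t0 c q.1) q.2) (S ×ˢ Icc 0 1) := by
  obtain ⟨K, hK⟩ := h.lip
  obtain ⟨M, hM⟩ := h.exists_bound hS
  obtain ⟨α, hα0, hα⟩ := exists_time_bound hS t0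
  set B : ℝ := (1 + (α * K + |M|)) * Real.exp (α * K) + 1 with hB
  have hB0 : 0 ≤ B := by positivity
  refine continuousOn_prod_of_continuousOn_lipschitzOnWith _ B.toNNReal
    (fun z hz => (h.isChar_flow hz).continuousOn_pt) fun σ hσ => ?_
  refine LipschitzOnWith.of_dist_le_mul fun z hz z' hz' => ?_
  rw [Real.coe_toNNReal _ hB0, dist_eq_norm, dist_eq_norm, Prod.norm_def]
  have h2 : |z.2 - z'.2| ≤ ‖z - z'‖ := norm_snd_le (z - z')
  have h1 : ‖z.1 - z'.1‖ ≤ ‖z - z'‖ := norm_fst_le (z - z')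
  refine max_le ?_ ?_
  · have := IsChar.norm_sub_le hK hM (hα z hz) (h.isChar_flow hz) (h.isChar_flow hz')
      (h.mem z hz _ (h.isChar_flow hz)) (h.mem z' hz' _ (h.isChar_flow hz')) σ hσ
    refine this.trans ?_
    have hM0 : 0 ≤ M := (norm_nonneg _).trans (hM z hz)
    have h3 : Real.exp (α * K * (1 - σ)) ≤ Real.exp (α * K) := by
      refine Real.exp_le_exp.2 (mul_le_of_le_one_right (by positivity) (by linarith [hσ.1]))
    calc _ ≤ (‖z - z'‖ + ‖z - z'‖ * (α * K + M)) * Real.exp (α * K) := by gcongr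
      _ = (1 + (α * K + |M|)) * Real.exp (α * K) * ‖z - z'‖ := by rw [abs_of_nonneg hM0]; ring
      _ ≤ _ := by
        rw [hB, add_mul]
        linarith [norm_nonneg (z - z')]
  · have e : (pt t0 z (flow t0 c z) σ - pt t0 z' (flow t0 c z') σ).2 = σ * (z.2 - z'.2) := by
      simp; ring
    rw [e, norm_mul, Real.norm_of_nonneg hσ.1, Real.norm_eq_abs]
    calc σ * |z.2 - z'.2| ≤ 1 * ‖z - z'‖ := by
          have := hσ.2
          gcongr
      _ ≤ B * ‖z - z'‖ := by
          gcongr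
          rw [hB]
          have : 0 ≤ (1 + (α * K + |M|)) * Real.exp (α * K) := by positivity
          linarith

/-- Joint continuity of the characteristics passes through the integral. Projecting the parameter to
`[0,1]` makes the integrand continuous on `S × ℝ`, as continuity of parametric integrals demands. -/
theorem CharDomain.continuousOn_duhamel {c : E × ℝ → E} (h : CharDomain t0 S c)
    (hS : IsCompact S) {J : E → ℝ} {g : E × ℝ → ℝ} (hg : ContinuousOn g S)
    (hJ : ContinuousOn J {x | (x, t0) ∈ S}) : ContinuousOn (duhamel t0 c J g) S := by
  have hΨ := h.continuousOn_pt_flow hS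
  have hmem : ∀ z ∈ S, ∀ σ ∈ Icc (0 : ℝ) 1, pt t0 z (flow t0 c z) σ ∈ S := fun z hz =>
    h.mem z hz _ (h.isChar_flow hz)
  have h0 : ContinuousOn (fun z => flow t0 c z 0) S := by
    have : ContinuousOn (fun z : E × ℝ => (pt t0 z (flow t0 c z) 0).1) S :=
      continuous_fst.comp_continuousOn (hΨ.comp (f := fun z : E × ℝ => (z, (0 : ℝ)))
        (by fun_prop) fun z hz => ⟨hz, by simp⟩)
    exact this
  have hJc : ContinuousOn (fun z => J (flow t0 c z 0)) S := by
    refine hJ.comp h0 fun z hz => ?_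
    have := hmem z hz 0 (by simp)
    rwa [pt_zero] at this
  refine hJc.add (ContinuousOn.mul (by fun_prop) ?_)
  rw [continuousOn_iff_continuous_domRestrict]
  set F : S → ℝ → ℝ := fun z σ =>
    g (pt t0 z.1 (flow t0 c z.1) (projIcc (0 : ℝ) 1 zero_le_one σ)) with hF
  have hFc : Continuous (Function.uncurry F) := by
    have hin : Continuous fun q : S × ℝ =>
        ((q.1 : E × ℝ), ((projIcc (0 : ℝ) 1 zero_le_one q.2 : Icc (0 : ℝ) 1) : ℝ)) :=
      (continuous_subtype_val.comp continuous_fst).prodMk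
        (continuous_subtype_val.comp (continuous_projIcc.comp continuous_snd))
    have h1 : Continuous fun q : S × ℝ => pt t0 q.1.1 (flow t0 c q.1.1)
        (projIcc (0 : ℝ) 1 zero_le_one q.2) :=
      hΨ.comp_continuous hin fun q => ⟨q.1.2, (projIcc (0 : ℝ) 1 zero_le_one q.2).2⟩
    exact hg.comp_continuous h1 fun q => hmem _ q.1.2 _ (projIcc (0 : ℝ) 1 zero_le_one q.2).2
  have := intervalIntegral.continuous_parametric_intervalIntegral_of_continuous' (μ := volume)
    hFc 0 1
  refine this.congr fun z => intervalIntegral.integral_congr fun σ hσ => ?_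
  rw [uIcc_of_le zero_le_one] at hσ
  simp only [hF, projIcc_of_mem zero_le_one hσ]

/-- Continuous solutions of semilinear systems along given characteristics. -/
theorem exists_semilinear_solution {ι : Type*} [Fintype ι] (hS : IsCompact S)
    {c : ι → E × ℝ → E} (hc : ∀ j, CharDomain t0 S (c j))
    {G : ι → E × ℝ → (ι → ℝ) → ℝ} {K : ℝ}
    (hGc : ∀ j, ContinuousOn (fun q : (E × ℝ) × (ι → ℝ) => G j q.1 q.2) (S ×ˢ univ))
    (hGl : ∀ j, ∀ z ∈ S, ∀ v w, |G j z v - G j z w| ≤ K * ‖v - w‖)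
    {J : ι → E → ℝ} (hJ : ∀ j, ContinuousOn (J j) {x | (x, t0) ∈ S}) :
    ∃ v : E × ℝ → ι → ℝ, ContinuousOn v S ∧
      (∀ j, Transported t0 S (c j) (fun z => G j z (v z)) (fun z => v z j)) ∧
      ∀ x, (x, t0) ∈ S → ∀ j, v (x, t0) j = J j x := by
  classical
  set κ : ℝ := 2 * |K| + 1 with hκ
  have hκ0 : 0 < κ := by positivity
  set T : (E × ℝ → ι → ℝ) → E × ℝ → ι → ℝ := fun v z =>
    if z ∈ S then fun j => duhamel t0 (c j) (J j) (fun z => G j z (v z)) z else 0 with hT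
  have hTm : ∀ v, ∀ z ∈ S, ∀ j, T v z j =
      duhamel t0 (c j) (J j) (fun z => G j z (v z)) z := fun v z hz j => by
    simp only [hT, if_pos hz]
  have hGv : ∀ v, ContinuousOn v S → ∀ j, ContinuousOn (fun z => G j z (v z)) S := fun v hv j =>
    (hGc j).comp (continuousOn_id.prodMk hv) fun z hz => ⟨hz, mem_univ _⟩
  have hTtr : ∀ v, ContinuousOn v S → ∀ j,
      Transported t0 S (c j) (fun z => G j z (v z)) (fun z => T v z j) := by
    intro v hv j z hz Y hY σ hσ
    have hmem := (hc j).mem z hz Y hY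
    exact ((hc j).transported_duhamel ((hc j).exists_bound hS) (hGv v hv j) z hz Y hY σ hσ).congr
      (fun s hs => hTm v _ (hmem s hs) j) (hTm v _ (hmem σ hσ) j)
  have hTinit : ∀ v, ∀ x, (x, t0) ∈ S → ∀ j, T v (x, t0) j = J j x := fun v x hx j => by
    rw [hTm v _ hx]
    exact (hc j).duhamel_initial hx rfl
  have hTcont : ∀ v, ContinuousOn v S → ContinuousOn (T v) S := fun v hv =>
    continuousOn_pi.2 fun j => ((hc j).continuousOn_duhamel hS (hGv v hv j) (hJ j)).congr
      fun z hz => hTm v z hz j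
  obtain ⟨α, hα0, hα⟩ := exists_time_bound hS t0
  suffices h : ∃ v, ContinuousOn v S ∧ T v = v by
    obtain ⟨v, hv, hfix⟩ := h
    refine ⟨v, hv, fun j => ?_, fun x hx j => ?_⟩
    · have := hTtr v hv j
      rwa [hfix] at this
    · rw [← hTinit v x hx j, hfix]
  obtain ⟨B₀, hB₀⟩ := hS.exists_bound_of_continuousOn (hTcont (fun _ => 0) continuousOn_const)
  refine exists_fixedPoint_of_weighted (fun z : E × ℝ => Real.exp (κ * |z.2 - t0|)) T
    (fun v => ContinuousOn v S) hTcont ?_ (fun _ => 0) continuousOn_const |B₀| ?_ ?_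
  · intro u f B hu hB
    have hB0 : ∀ z ∈ S, ∀ k, ‖f z - u k z‖ ≤ |B| * Real.exp (κ * α) * (1 / 2) ^ k := by
      intro z hz k
      refine (hB k z).trans ?_
      have h1 : Real.exp (κ * |z.2 - t0|) ≤ Real.exp (κ * α) := by
        have := hα z hz
        gcongr
      calc _ ≤ |B| * (1 / 2) ^ k * Real.exp (κ * α) := by
            gcongr
            exact le_abs_self B
        _ = _ := by ring
    have hlim : Tendsto (fun k : ℕ => |B| * Real.exp (κ * α) * (1 / 2 : ℝ) ^ k) atTop (𝓝 0) := by
      simpa using (tendsto_pow_atTop_nhds_zero_of_lt_one (by norm_num : (0 : ℝ) ≤ 1 / 2)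
        (by norm_num)).const_mul (|B| * Real.exp (κ * α))
    refine TendstoUniformlyOn.continuousOn (F := u) (p := atTop) ?_
      (Eventually.of_forall hu).frequently
    rw [Metric.tendstoUniformlyOn_iff]
    intro ε hε
    filter_upwards [hlim.eventually_lt_const hε] with k hk z hz
    rw [dist_eq_norm]
    exact (hB0 z hz k).trans_lt hk
  · intro z
    have h1 : 1 ≤ Real.exp (κ * |z.2 - t0|) :=
      Real.one_le_exp (mul_nonneg hκ0.le (abs_nonneg _))
    have h2 : ‖T (fun _ => 0) z - 0‖ ≤ |B₀| := by
      rw [sub_zero]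
      by_cases hz : z ∈ S
      · exact (hB₀ z hz).trans (le_abs_self _)
      · simp [hT, if_neg hz]
    calc _ ≤ |B₀| * 1 := by rw [mul_one]; exact h2
      _ ≤ _ := by gcongr
  · intro f g B hf hg hB z
    have hB0 : 0 ≤ B := nonneg_of_mul_nonneg_left ((norm_nonneg _).trans (hB z)) (Real.exp_pos _)
    by_cases hz : z ∈ S
    swap
    · simp only [hT, if_neg hz, sub_self, norm_zero]
      positivity
    refine (pi_norm_le_iff_of_nonneg (by positivity)).2 fun j => ?_
    obtain ⟨Y, hY⟩ := (hc j).exists_char z hz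
    have hmem := (hc j).mem z hz Y hY
    have := norm_le_of_norm_deriv_le_exp (τ := |z.2 - t0|) (a := 0) (b := |K| * B) (κ := κ)
      (f := fun s => T f (pt t0 z Y s) j - T g (pt t0 z Y s) j)
      (abs_nonneg _) le_rfl (by positivity) hκ0
      (fun s hs => (hTtr f hf j z hz Y hY s hs).sub (hTtr g hg j z hz Y hY s hs))
      (fun s hs => ?_) 1 (by simp)
    · have h0 := hmem 0 (by simp)
      rw [pt_zero] at h0
      rw [hY.pt_one, pt_zero, hTinit f _ h0, hTinit g _ h0, sub_self, norm_zero, mul_zero,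
        zero_add, zero_add, one_mul] at this
      refine this.trans ?_
      have hK : |K| / κ ≤ 1 / 2 := by
        rw [div_le_iff₀ hκ0, hκ]
        linarith
      calc _ = |K| / κ * B * Real.exp (κ * |z.2 - t0|) := by ring
        _ ≤ 1 / 2 * B * Real.exp (κ * |z.2 - t0|) := by gcongr
        _ = _ := by ring
    · rw [← mul_sub, norm_mul, Real.norm_eq_abs, zero_add]
      refine mul_le_mul_of_nonneg_left ?_ (abs_nonneg _)
      refine (hGl j _ (hmem s hs) _ _).trans ?_
      have h1 := hB (pt t0 z Y s)
      rw [abs_pt_snd_sub hs] at h1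
      rw [mul_assoc]
      exact mul_le_mul (le_abs_self K) h1 (norm_nonneg _) (abs_nonneg _)

end Semilinear

/-! ### Uniform first order expansion. -/

section Taylor

variable {X : Type*} [NormedAddCommGroup X] [NormedSpace ℝ X]

/-- First order Taylor expansion, uniformly on a compact convex set. -/
theorem uniform_taylor {W : Set X} (hW : Convex ℝ W) (hWc : IsCompact W) {F : X → ℝ}
    {F' : X → X →L[ℝ] ℝ} (hF : ∀ w ∈ W, HasFDerivWithinAt F (F' w) W w)
    (hF' : ContinuousOn F' W) {η : ℝ} (hη : 0 < η) :
    ∃ δ > 0, ∀ w ∈ W, ∀ w' ∈ W, ‖w' - w‖ ≤ δ → |F w' - F w - F' w (w' - w)| ≤ η * ‖w' - w‖ := by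
  have huc := hWc.uniformContinuousOn_of_continuous hF'
  obtain ⟨δ, hδ, h⟩ := Metric.uniformContinuousOn_iff.1 huc η hη
  refine ⟨δ / 2, by positivity, fun w hw w' hw' hle => ?_⟩
  have hconv : Convex ℝ (W ∩ Metric.ball w δ) := hW.inter (convex_ball w δ)
  refine hconv.norm_image_sub_le_of_norm_hasFDerivWithin_le' (f' := F')
    (fun x hx => (hF x hx.1).mono inter_subset_left) (fun x hx => ?_)
    ⟨hw, Metric.mem_ball_self hδ⟩ ⟨hw', ?_⟩
  · rw [← dist_eq_norm]
    exact (h x hx.1 w hw hx.2).le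
  · rw [mem_ball_iff_norm]
    linarith

end Taylor

/-! ### Gronwall estimates for pairs of characteristics. -/

section Pairs

variable {m : ℕ} {t0 : ℝ} {S : Set (Dom m)} {ι : Type*} [Fintype ι]

/-- Pairs of points of `S` at equal times in `N` whose characteristics stay `ε`-close. -/
def ClosePair (t0 : ℝ) (S : Set (Dom m)) (N : Set ℝ) (M ε : ℝ) (y y' : Dom m) : Prop :=
  y ∈ S ∧ y' ∈ S ∧ y.2 = y'.2 ∧ y.2 ∈ N ∧ ‖y'.1 - y.1‖ ≤ ε * Real.exp (-(M * |y.2 - t0|))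

theorem ClosePair.norm_sub_le {N : Set ℝ} {M ε : ℝ} (hM : 0 ≤ M) (hε : 0 ≤ ε) {y y' : Dom m}
    (h : ClosePair t0 S N M ε y y') : ‖y'.1 - y.1‖ ≤ ε := by
  refine h.2.2.2.2.trans (mul_le_of_le_one_right hε (Real.exp_le_one_iff.2 ?_))
  have := mul_nonneg hM (abs_nonneg (y.2 - t0))
  linarith

/-- The admitted distance `ε exp(-M|t - t0|)` grows towards the initial plane at rate `M`, at least
as fast as characteristics can separate backward. Closeness is therefore inherited along every
family of characteristics. -/
theorem ClosePair.pt {N : Set ℝ} (hN : ∀ t ∈ N, ∀ σ ∈ Icc (0 : ℝ) 1, t0 + σ * (t - t0) ∈ N)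
    {M ε : ℝ} {K : NNReal} {c : Dom m → Fin (m - 1) → ℝ} (hcd : CharDomain t0 S c)
    {B : ℝ} (hB : ∀ z ∈ S, ‖c z‖ ≤ B) (hK : LipschitzOnWith K c S) (hKM : K ≤ M) {y y' : Dom m}
    (h : ClosePair t0 S N M ε y y') {Y Y' : ℝ → Fin (m - 1) → ℝ} (hY : IsChar t0 c y Y)
    (hY' : IsChar t0 c y' Y') {σ : ℝ} (hσ : σ ∈ Icc (0 : ℝ) 1) :
    ClosePair t0 S N M ε (pt t0 y Y σ) (pt t0 y' Y' σ) := by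
  obtain ⟨hy, hy', heq, hn, hle⟩ := h
  refine ⟨hcd.mem y hy Y hY σ hσ, hcd.mem y' hy' Y' hY' σ hσ, by simp [heq], hN _ hn σ hσ, ?_⟩
  have h1 := IsChar.norm_sub_le_of_eq hK hB heq hY hY' (hcd.mem y hy Y hY) (hcd.mem y' hy' Y' hY')
    σ hσ
  rw [abs_pt_snd_sub hσ, pt_fst, pt_fst, norm_sub_rev]
  rw [norm_sub_rev] at hle
  have h2 : |y.2 - t0| * K * (1 - σ) ≤ |y.2 - t0| * M * (1 - σ) := by
    have := hσ.2
    have : 0 ≤ 1 - σ := by linarith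
    gcongr
  calc _ ≤ ε * Real.exp (-(M * |y.2 - t0|)) * Real.exp (|y.2 - t0| * M * (1 - σ)) :=
        h1.trans (mul_le_mul hle (Real.exp_le_exp.2 h2) (Real.exp_pos _).le
          ((norm_nonneg _).trans hle))
    _ = _ := by
      rw [mul_assoc, ← Real.exp_add]
      congr 2
      ring

/-- A Gronwall estimate for functions of pairs of points that move along characteristics. -/
theorem pair_gronwall {N : Set ℝ} (hN : ∀ t ∈ N, ∀ σ ∈ Icc (0 : ℝ) 1, t0 + σ * (t - t0) ∈ N)
    {α : ℝ} (hα0 : 0 ≤ α) (hα : ∀ z ∈ S, |z.2 - t0| ≤ α) {c : ι → Dom m → Fin (m - 1) → ℝ}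
    (hcd : ∀ i, CharDomain t0 S (c i)) {B₀ : ι → ℝ} (hB : ∀ i, ∀ z ∈ S, ‖c i z‖ ≤ B₀ i)
    {K : ι → NNReal} (hK : ∀ i, LipschitzOnWith (K i) (c i) S) {M ε : ℝ}
    (hKM : ∀ i, K i ≤ M) {R : Dom m → Dom m → ι → ℝ} {G : ι → Dom m → Dom m → ℝ}
    {M₀ a b K₁ : ℝ} (ha : 0 ≤ a) (hb : 0 ≤ b) (hK₁ : 0 ≤ K₁)
    (hbdd : ∀ y y', ClosePair t0 S N M ε y y' → ‖R y y'‖ ≤ M₀)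
    (hinit : ∀ y y', ClosePair t0 S N M ε y y' → y.2 = t0 → ‖R y y'‖ ≤ a)
    (hder : ∀ i y y', ClosePair t0 S N M ε y y' → ∀ Y Y', IsChar t0 (c i) y Y →
      IsChar t0 (c i) y' Y' → ∀ σ ∈ Icc (0 : ℝ) 1,
      HasDerivWithinAt (fun s => R (pt t0 y Y s) (pt t0 y' Y' s) i)
        ((y.2 - t0) * G i (pt t0 y Y σ) (pt t0 y' Y' σ)) (Icc 0 1) σ)
    (hG : ∀ B, 0 ≤ B → (∀ y y', ClosePair t0 S N M ε y y' →
        ‖R y y'‖ ≤ B * Real.exp ((2 * K₁ + 1) * |y.2 - t0|)) →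
      ∀ i y y', ClosePair t0 S N M ε y y' →
        |G i y y'| ≤ b + K₁ * (B * Real.exp ((2 * K₁ + 1) * |y.2 - t0|)))
    {y y' : Dom m} (hyy : ClosePair t0 S N M ε y y') :
    ‖R y y'‖ ≤ 2 * (a + α * b) * Real.exp ((2 * K₁ + 1) * α) := by
  have hκ0 : 0 < 2 * K₁ + 1 := by linarith
  -- The bound ranges over all close pairs at once, because `G` at one pair may depend on `R` at
  -- others: each component has its own characteristics, and the clamp is controlled through
  -- auxiliary pairs.
  have := le_of_weighted_bound (A := {q : Dom m × Dom m // ClosePair t0 S N M ε q.1 q.2})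
    (Φ := fun q => ‖R q.1.1 q.1.2‖) (τ := fun q => |q.1.1.2 - t0|) (η := a + α * b)
    (κ := 2 * K₁ + 1) (M := M₀) (T := α) hκ0.le (by positivity) (fun q => abs_nonneg _)
    (fun q => hα _ q.2.1) (fun q => hbdd _ _ q.2) ?_ ⟨(y, y'), hyy⟩
  · exact this
  rintro B hB0 hBall ⟨⟨z, z'⟩, hz⟩
  replace hBall : ∀ y y', ClosePair t0 S N M ε y y' →
      ‖R y y'‖ ≤ B * Real.exp ((2 * K₁ + 1) * |y.2 - t0|) := fun y y' h => hBall ⟨(y, y'), h⟩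
  simp only
  refine (pi_norm_le_iff_of_nonneg (by positivity)).2 fun i => ?_
  obtain ⟨Y, hY⟩ := (hcd i).exists_char z hz.1
  obtain ⟨Y', hY'⟩ := (hcd i).exists_char z' hz.2.1
  have hpair : ∀ σ ∈ Icc (0 : ℝ) 1, ClosePair t0 S N M ε (pt t0 z Y σ) (pt t0 z' Y' σ) :=
    fun σ hσ => hz.pt hN (hcd i) (hB i) (hK i) (hKM i) hY hY' hσ
  have := norm_le_of_norm_deriv_le_exp (τ := |z.2 - t0|) (a := b) (b := K₁ * B)
    (κ := 2 * K₁ + 1) (f := fun s => R (pt t0 z Y s) (pt t0 z' Y' s) i)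
    (abs_nonneg _) hb (by positivity) hκ0 (hder i z z' hz Y Y' hY hY')
    (fun σ hσ => ?_) 1 (by simp)
  · have h0 : ‖R (pt t0 z Y 0) (pt t0 z' Y' 0) i‖ ≤ a :=
      (norm_le_pi_norm _ i).trans (hinit _ _ (hpair 0 (by simp)) (by simp))
    rw [hY.pt_one, hY'.pt_one, one_mul] at this
    have h1 : |z.2 - t0| * b ≤ α * b := by
      have := hα z hz.1
      gcongr
    have h2 : K₁ * B / (2 * K₁ + 1) * Real.exp ((2 * K₁ + 1) * |z.2 - t0|) ≤
        B / 2 * Real.exp ((2 * K₁ + 1) * |z.2 - t0|) := by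
      gcongr ?_ * _
      rw [div_le_iff₀ hκ0]
      nlinarith
    linarith
  · rw [norm_mul, Real.norm_eq_abs]
    refine mul_le_mul_of_nonneg_left ?_ (abs_nonneg _)
    have := hG B hB0 hBall i _ _ (hpair σ hσ)
    rw [abs_pt_snd_sub hσ] at this
    rw [mul_assoc]
    exact this

/-- A family of functions is Lipschitz if it has Lipschitz derivatives along characteristics and
Lipschitz initial values. -/
theorem exists_lipschitzOnWith_of_transported (hS : IsCompact S)
    {c : ι → Dom m → Fin (m - 1) → ℝ} (hcd : ∀ i, CharDomain t0 S (c i)) {Q : Set (ι → ℝ)}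
    {v : Dom m → ι → ℝ} (hvQ : MapsTo v S Q) (hv : ContinuousOn v S)
    {D : ι → Dom m × (ι → ℝ) → ℝ} (hD : ∀ i, ∃ K, LipschitzOnWith K (D i) (S ×ˢ Q))
    (htr : ∀ i, Transported t0 S (c i) (fun z => D i (z, v z)) (fun z => v z i))
    (hinit : ∃ K, LipschitzOnWith K (fun x => v (x, t0)) {x | (x, t0) ∈ S}) :
    ∃ K, LipschitzOnWith K v S := by
  obtain ⟨α, hα0, hα⟩ := exists_time_bound hS t0
  choose B₀ hB using fun i => (hcd i).exists_bound hS
  choose K hK using fun i => (hcd i).lip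
  choose KD hKD using hD
  obtain ⟨KJ, hKJ⟩ := hinit
  obtain ⟨M₁, hM₁⟩ := hS.exists_bound_of_continuousOn hv
  set M : ℝ := ∑ i, (K i : ℝ) with hMdef
  have hM : 0 ≤ M := Finset.sum_nonneg fun i _ => (K i).2
  have hKM : ∀ i, (K i : ℝ) ≤ M := fun i =>
    Finset.single_le_sum (f := fun i => (K i : ℝ)) (fun i _ => (K i).2) (Finset.mem_univ i)
  set K₁ : ℝ := ∑ i, (KD i : ℝ) with hK₁def
  have hK₁ : 0 ≤ K₁ := Finset.sum_nonneg fun i _ => (KD i).2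
  have hKK : ∀ i, (KD i : ℝ) ≤ K₁ := fun i =>
    Finset.single_le_sum (f := fun i => (KD i : ℝ)) (fun i _ => (KD i).2) (Finset.mem_univ i)
  set Λ : ℝ := 2 * (KJ + α * K₁) * Real.exp ((2 * K₁ + 1) * α) * Real.exp (M * α) with hΛ
  have hΛ0 : 0 ≤ Λ := by positivity
  have hslice : ∀ y ∈ S, ∀ y' ∈ S, y.2 = y'.2 → ‖v y' - v y‖ ≤ Λ * ‖y'.1 - y.1‖ := by
    intro y hy y' hy' heq
    -- The smallest `ε` for which the given pair is close; the resulting bound is linear in `ε`,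
    -- hence in the distance.
    set ε : ℝ := ‖y'.1 - y.1‖ * Real.exp (M * |y.2 - t0|) with hε
    have hε0 : 0 ≤ ε := by positivity
    have hpair : ClosePair t0 S univ M ε y y' := by
      refine ⟨hy, hy', heq, mem_univ _, ?_⟩
      rw [hε, mul_assoc, ← Real.exp_add, add_neg_cancel, Real.exp_zero, mul_one]
    have := pair_gronwall (N := univ) (R := fun y y' => v y' - v y)
      (G := fun i y y' => D i (y', v y') - D i (y, v y)) (M₀ := M₁ + M₁) (a := KJ * ε)
      (b := K₁ * ε) (fun _ _ _ _ => mem_univ _) hα0 hα hcd hB hK hKM (by positivity)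
      (by positivity) hK₁ ?_ ?_ ?_ ?_ hpair
    · refine this.trans ?_
      have h1 : Real.exp (M * |y.2 - t0|) ≤ Real.exp (M * α) := by
        have := hα y hy
        gcongr
      calc _ = 2 * (KJ + α * K₁) * Real.exp ((2 * K₁ + 1) * α) *
            Real.exp (M * |y.2 - t0|) * ‖y'.1 - y.1‖ := by rw [hε]; ring
        _ ≤ _ := by rw [hΛ]; gcongr
    · intro z z' h
      exact (norm_sub_le _ _).trans (add_le_add (hM₁ _ h.2.1) (hM₁ _ h.1))
    · rintro ⟨x, t⟩ ⟨x', t'⟩ h ht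
      have htt : t = t' := h.2.2.1
      have ht0 : t = t0 := ht
      subst htt
      subst ht0
      have := hKJ.dist_le_mul x' h.2.1 x h.1
      rw [dist_eq_norm, dist_eq_norm] at this
      refine this.trans ?_
      have := h.norm_sub_le hM hε0
      gcongr
    · intro i z z' h Y Y' hY hY' σ hσ
      refine ((htr i z' h.2.1 Y' hY' σ hσ).sub (htr i z h.1 Y hY σ hσ)).congr_deriv ?_
      rw [← h.2.2.1, mul_sub]
    · intro B _ hBall i z z' h
      have h1 := (hKD i).dist_le_mul (z', v z') ⟨h.2.1, hvQ h.2.1⟩ (z, v z) ⟨h.1, hvQ h.1⟩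
      rw [Real.dist_eq, dist_eq_norm] at h1
      refine h1.trans ?_
      have h2 : ‖((z', v z') : Dom m × (ι → ℝ)) - (z, v z)‖ ≤ ‖z'.1 - z.1‖ + ‖v z' - v z‖ := by
        rw [Prod.norm_def, Prod.norm_def]
        refine max_le (max_le ?_ ?_) ?_
        · simp
        · simp [h.2.2.1]
          positivity
        · simp
      calc _ ≤ K₁ * (ε + B * Real.exp ((2 * K₁ + 1) * |z.2 - t0|)) := by
            have h3 := h2.trans (add_le_add (h.norm_sub_le hM hε0) (hBall _ _ h))
            exact mul_le_mul (hKK i) h3 (norm_nonneg _) hK₁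
        _ = _ := by ring
  choose MD hMD using fun i => hS.exists_bound_of_continuousOn
    ((hKD i).continuousOn.comp (continuousOn_id.prodMk hv) fun z hz => ⟨hz, hvQ hz⟩)
  have hcomp : ∀ i, ∀ z ∈ S, ∀ z' ∈ S, |v z i - v z' i| ≤
      max Λ (|MD i| + Λ * ((m - 1 : ℕ) * |B₀ i|)) * dist1 z z' := by
    intro i
    refine abs_sub_le_of_slice (t0 := t0) hΛ0 (abs_nonneg _) (by positivity) ?_ ?_
    · intro z hz z' hz' heq
      have h1 := (norm_le_pi_norm _ i).trans (hslice z' hz' z hz heq.symm)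
      refine h1.trans ?_
      gcongr
      exact (norm_fst_le (z - z')).trans (norm_sub_le_dist1 z z')
    · intro z hz ρ hρ
      obtain ⟨Y, hY⟩ := (hcd i).exists_char z hz
      have hmem := (hcd i).mem z hz Y hY
      refine ⟨Y ρ, hmem ρ hρ, ?_, ?_⟩
      · have h1 := norm_sub_le_of_norm_deriv_le (B := |MD i| * |z.2 - t0|) (htr i z hz Y hY)
          (fun σ hσ => ?_) hρ (σ := 1) (by simp)
        · rw [hY.pt_one, Real.norm_eq_abs, abs_of_nonneg (by linarith [hρ.2] : 0 ≤ 1 - ρ)] at h1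
          refine h1.trans_eq ?_
          ring
        · rw [norm_mul, mul_comm, Real.norm_eq_abs (z.2 - t0)]
          have := (hMD i _ (hmem σ hσ)).trans (le_abs_self _)
          exact mul_le_mul_of_nonneg_right this (abs_nonneg _)
      · have h1 := norm_sub_le_of_norm_deriv_le (B := |B₀ i| * |z.2 - t0|) hY.deriv
          (fun σ hσ => ?_) hρ (σ := 1) (by simp)
        · rw [hY.end_eq, abs_of_nonneg (by linarith [hρ.2] : 0 ≤ 1 - ρ)] at h1
          calc ∑ l, |z.1 l - Y ρ l| ≤ ∑ l : Fin (m - 1), |B₀ i| * |z.2 - t0| * (1 - ρ) :=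
                Finset.sum_le_sum fun l _ => (norm_le_pi_norm (z.1 - Y ρ) l).trans h1
            _ = _ := by simp; ring
        · rw [norm_smul, mul_comm, Real.norm_eq_abs (z.2 - t0)]
          have := (hB i _ (hmem σ hσ)).trans (le_abs_self _)
          exact mul_le_mul_of_nonneg_right this (abs_nonneg _)
  set Ki : ι → ℝ := fun i =>
    max Λ (|MD i| + Λ * ((m - 1 : ℕ) * |B₀ i|)) * ((m - 1 : ℕ) + 1) with hKi
  have hKi0 : ∀ i, 0 ≤ Ki i := fun i => mul_nonneg (hΛ0.trans (le_max_left _ _)) (by positivity)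
  refine ⟨(∑ i, Ki i).toNNReal, LipschitzOnWith.of_dist_le_mul fun z hz z' hz' => ?_⟩
  rw [Real.coe_toNNReal _ (Finset.sum_nonneg fun i _ => hKi0 i), dist_eq_norm, dist_eq_norm]
  refine (pi_norm_le_iff_of_nonneg
    (mul_nonneg (Finset.sum_nonneg fun i _ => hKi0 i) (norm_nonneg _))).2 fun i => ?_
  calc _ ≤ Ki i * ‖z - z'‖ := by
        refine (hcomp i z hz z' hz').trans ?_
        refine (mul_le_mul_of_nonneg_left (dist1_le_norm_sub z z')
          (hΛ0.trans (le_max_left _ _))).trans_eq ?_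
        rw [← mul_assoc]
    _ ≤ _ := by
      gcongr
      exact Finset.single_le_sum (f := Ki) (fun i _ => hKi0 i) (Finset.mem_univ i)

end Pairs

/-! ### Geometry of the domains used for regularity. -/

section RegularDomain

variable {m : ℕ}

/-- Compact convex domains with nonempty slice interior in which the coordinates of two points at
equal times may be mixed. -/
structure RegularDomain (t0 : ℝ) (S : Set (Dom m)) : Prop where
  convex : Convex ℝ S
  isCompact : IsCompact S
  mix : ∀ x y t l, (x, t) ∈ S → (y, t) ∈ S → (Function.update x l (y l), t) ∈ S
  center : ∃ x, (x, t0) ∈ interior S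

variable {t0 : ℝ} {S : Set (Dom m)}

theorem RegularDomain.convex_slice (hS : RegularDomain t0 S) : Convex ℝ {x | (x, t0) ∈ S} := by
  intro x hx y hy a b ha hb hab
  have := hS.convex hx hy ha hb hab
  have e : a • ((x, t0) : Dom m) + b • ((y, t0) : Dom m) = (a • x + b • y, t0) := by
    ext1
    · simp
    · simp [← add_mul, hab]
  rwa [e] at this

theorem RegularDomain.isCompact_slice (hS : RegularDomain t0 S) :
    IsCompact {x | (x, t0) ∈ S} := by
  have : {x | (x, t0) ∈ S} = Prod.fst '' (S ∩ {y | y.2 = t0}) := by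
    ext x
    constructor
    · exact fun hx => ⟨(x, t0), ⟨hx, rfl⟩, rfl⟩
    · rintro ⟨⟨y, t⟩, ⟨hy, ht⟩, rfl⟩
      have ht' : t = t0 := ht
      rw [← ht']
      exact hy
  rw [this]
  exact (hS.isCompact.inter_right (isClosed_eq continuous_snd continuous_const)).image
    continuous_fst

theorem RegularDomain.interior_slice_nonempty (hS : RegularDomain t0 S) :
    (interior {x | (x, t0) ∈ S}).Nonempty := by
  obtain ⟨x, hx⟩ := hS.center
  refine ⟨x, mem_interior_iff_mem_nhds.2 ?_⟩
  have : ContinuousAt (fun x : Fin (m - 1) → ℝ => ((x, t0) : Dom m)) x := by fun_prop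
  exact this (mem_interior_iff_mem_nhds.1 hx)

theorem RegularDomain.exists_time (hS : RegularDomain t0 S) :
    (∃ o ∈ S, t0 < o.2) ∧ ∃ o ∈ S, o.2 < t0 := by
  obtain ⟨x, hx⟩ := hS.center
  have hc : ContinuousAt (fun t : ℝ => ((x, t) : Dom m)) t0 := by fun_prop
  have h := hc (mem_interior_iff_mem_nhds.1 hx)
  obtain ⟨t₁, h₁, h₁'⟩ := ((eventually_nhdsWithin_of_eventually_nhds h).and
    (self_mem_nhdsWithin (s := Ioi t0))).exists
  obtain ⟨t₂, h₂, h₂'⟩ := ((eventually_nhdsWithin_of_eventually_nhds h).and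
    (self_mem_nhdsWithin (s := Iio t0))).exists
  exact ⟨⟨_, h₁, h₁'⟩, _, h₂, h₂'⟩

theorem RegularDomain.interior_nonempty (hS : RegularDomain t0 S) : (interior S).Nonempty :=
  let ⟨_, hx⟩ := hS.center
  ⟨_, hx⟩

theorem exists_update_mem {z : Dom m} (hz : z ∈ interior S) :
    ∃ w > 0, ∀ l s, |s| ≤ w → (Function.update z.1 l (z.1 l + s), z.2) ∈ S := by
  obtain ⟨r, hr, h⟩ := Metric.mem_nhds_iff.1 (mem_interior_iff_mem_nhds.1 hz)
  refine ⟨r / 2, by positivity, fun l s hs => h ?_⟩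
  rw [mem_ball_iff_norm, Prod.norm_def, max_lt_iff]
  refine ⟨?_, by simpa using hr⟩
  refine (pi_norm_lt_iff hr).2 fun k => ?_
  by_cases hk : k = l
  · subst hk
    simp only [Prod.fst_sub, Pi.sub_apply, Function.update_self, add_sub_cancel_left]
    rw [Real.norm_eq_abs]
    linarith
  · simpa [Function.update_of_ne hk] using hr

/-- Between the initial plane and an interior point, every point can be moved by a fixed length
in each coordinate direction or its opposite. -/
theorem RegularDomain.exists_width (h : RegularDomain t0 S) {z : Dom m} (hz : z ∈ interior S) :
    ∃ w > 0, ∀ y ∈ S, ∀ θ ∈ Icc (0 : ℝ) 1, y.2 = t0 + θ * (z.2 - t0) → ∀ l, ∀ s ∈ Icc (0 : ℝ) w,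
      (Function.update y.1 l (y.1 l + s), y.2) ∈ S ∨
        (Function.update y.1 l (y.1 l - s), y.2) ∈ S := by
  obtain ⟨x₀, hx₀⟩ := h.center
  obtain ⟨w₁, hw₁, h₁⟩ := exists_update_mem hz
  obtain ⟨w₀, hw₀, h₀⟩ := exists_update_mem hx₀
  refine ⟨min w₀ w₁, lt_min hw₀ hw₁, ?_⟩
  rintro ⟨y, t⟩ hy θ hθ ht l s hs
  simp only at ht
  -- At time `t` the segment from the central point to `z` has `l`-th coordinate `μ`, with room
  -- `±min w₀ w₁` by convexity. The mixing property transfers this coordinate range to `y`.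
  set μ : ℝ := x₀ l + θ * (z.1 l - x₀ l) with hμ
  have hmid : ∀ s', |s'| ≤ min w₀ w₁ → (Function.update y l (μ + s'), t) ∈ S := by
    intro s' hs'
    have e0 := h₀ l s' (hs'.trans (min_le_left _ _))
    have e1 := h₁ l s' (hs'.trans (min_le_right _ _))
    have e2 := h.convex e0 e1 (by linarith [hθ.2] : 0 ≤ 1 - θ) hθ.1 (by ring)
    have e3 : ((1 - θ) • ((Function.update x₀ l (x₀ l + s'), t0) : Dom m) +
        θ • ((Function.update z.1 l (z.1 l + s'), z.2) : Dom m)).2 = t := by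
      simp [ht]; ring
    have e4 : ((1 - θ) • ((Function.update x₀ l (x₀ l + s'), t0) : Dom m) +
        θ • ((Function.update z.1 l (z.1 l + s'), z.2) : Dom m)).1 l = μ + s' := by
      simp [hμ]; ring
    rw [← e4]
    refine h.mix y _ t l hy ?_
    rw [← e3]
    exact e2
  have hcomb : ∀ s', (Function.update y l (μ + s'), t) ∈ S →
      ∀ v ∈ segment ℝ (y l) (μ + s'), (Function.update y l v, t) ∈ S := by
    rintro s' hs' v ⟨a, b, ha, hb, hab, rfl⟩
    have := h.convex hy hs' ha hb hab
    convert this using 1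
    ext1
    · funext k
      by_cases hk : k = l
      · subst hk; simp
      · simp [Function.update_of_ne hk, ← add_mul, hab]
    · simp [← add_mul, hab]
  have hs1 : |s| ≤ min w₀ w₁ := by rw [abs_of_nonneg hs.1]; exact hs.2
  -- The coordinate is moved towards `μ`: if `y l ≤ μ`, then `y l + s` lies between `y l` and `μ +
  -- s`, and convexity applies. The other case is symmetric.
  rcases le_total (y l) μ with hle | hle
  · left
    refine hcomb s (hmid s hs1) _ ?_
    rw [segment_eq_Icc (by linarith [hs.1])]
    exact ⟨by simp [hs.1], by simpa using hle⟩
  · right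
    refine hcomb (-s) (hmid (-s) (by rwa [abs_neg])) _ ?_
    rw [segment_symm, segment_eq_Icc (by linarith [hs.1])]
    exact ⟨by simp only; linarith, by simp [hs.1]⟩

end RegularDomain

/-! ### The differentiated system and its algebra. -/

section DerivedSystem

set_option linter.unusedSectionVars false

variable {m : ℕ} {ι : Type*} [Fintype ι]

/-- The right hand side of the equation for `∂_l u_i` along the characteristics, as a function of
the spatial derivative `q` of `u`. -/
def derivSource (Cd : ι → Fin (m - 1) → Dom m × (ι → ℝ) → Dom m × (ι → ℝ) →L[ℝ] ℝ)
    (Dd : ι → Dom m × (ι → ℝ) → Dom m × (ι → ℝ) →L[ℝ] ℝ) (i : ι) (l : Fin (m - 1))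
    (w : Dom m × (ι → ℝ)) (q : ι × Fin (m - 1) → ℝ) : ℝ :=
  Dd i w ((Pi.single l 1, 0), fun s => q (s, l)) -
    ∑ k, q (i, k) * Cd i k w ((Pi.single l 1, 0), fun s => q (s, l))

/-- Weighting the coordinate equations by a displacement `ξ` turns them into one directional
derivative, in the direction of `ξ` and of the change of `u` that `q` predicts. -/
theorem sum_mul_apply_single (A : Dom m × (ι → ℝ) →L[ℝ] ℝ) (ξ : Fin (m - 1) → ℝ)
    (q : Fin (m - 1) → ι → ℝ) :
    ∑ l, A ((Pi.single l 1, 0), q l) * ξ l = A ((ξ, 0), fun s => ∑ l, q l s * ξ l) := by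
  have e : (((ξ, 0), fun s => ∑ l, q l s * ξ l) : Dom m × (ι → ℝ)) =
      ∑ l, ξ l • (((Pi.single l 1, 0), q l) : Dom m × (ι → ℝ)) := by
    ext1
    · ext1
      · simp only [Prod.fst_sum, Prod.smul_fst]
        funext k
        simp [Finset.sum_apply, Pi.single_apply]
      · simp [Prod.snd_sum, Prod.fst_sum]
    · funext s
      simp [Prod.snd_sum, Finset.sum_apply, mul_comm]
  rw [e, map_sum]
  refine Finset.sum_congr rfl fun l _ => ?_
  rw [map_smul, smul_eq_mul, mul_comm]

theorem apply_pair_eq_add (A : Dom m × (ι → ℝ) →L[ℝ] ℝ) (v : Dom m) (δ δ' : ι → ℝ) :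
    A (v, δ) = A (v, δ') + A (0, δ - δ') := by
  rw [← map_add]
  simp

theorem norm_pair_single_le (l : Fin (m - 1)) (q : ι → ℝ) :
    ‖(((Pi.single l 1, 0), q) : Dom m × (ι → ℝ))‖ ≤ 1 + ‖q‖ := by
  rw [Prod.norm_def, Prod.norm_def]
  refine max_le (max_le ?_ ?_) ?_
  · simp only
    rw [Pi.norm_single]
    simp
  · simp only [norm_zero]; positivity
  · simp

theorem abs_apply_le {X : Type*} [NormedAddCommGroup X] [NormedSpace ℝ X] {A : X →L[ℝ] ℝ}
    {Md : ℝ} (hA : ‖A‖ ≤ Md) {v : X} {N : ℝ} (hv : ‖v‖ ≤ N) : |A v| ≤ Md * N :=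
  (A.le_opNorm v).trans (mul_le_mul hA hv (norm_nonneg _) ((norm_nonneg _).trans hA))

/-- The remainder in the equation for the first order expansion of `u` at `z`. -/
theorem abs_expansion_remainder_le {Cd : ι → Fin (m - 1) → Dom m × (ι → ℝ) → Dom m × (ι → ℝ) →L[ℝ] ℝ}
    {Dd : ι → Dom m × (ι → ℝ) → Dom m × (ι → ℝ) →L[ℝ] ℝ} {i : ι} {w : Dom m × (ι → ℝ)}
    {Md Mp L e X ΔD : ℝ} (hMd : 0 ≤ Md) (hL : 0 ≤ L) (hX : 0 ≤ X)
    (hC : ∀ l, ‖Cd i l w‖ ≤ Md)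
    (hD : ‖Dd i w‖ ≤ Md) {p q : ι × Fin (m - 1) → ℝ} (hp : ∀ j, |p j| ≤ Mp) (hq : ∀ j, |q j| ≤ L)
    {ξ : Fin (m - 1) → ℝ} {δ : ι → ℝ} {ΔC : Fin (m - 1) → ℝ}
    (heD : |ΔD - Dd i w ((ξ, 0), δ)| ≤ e) (heC : ∀ l, |ΔC l - Cd i l w ((ξ, 0), δ)| ≤ e)
    (hδ : ‖(((ξ, 0), δ) : Dom m × (ι → ℝ))‖ ≤ (1 + L) * ‖ξ‖)
    (hrem : ∀ s, |δ s - ∑ l, p (s, l) * ξ l| ≤ X) (hqp : ∀ j, |q j - p j| * ‖ξ‖ ≤ X) :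
    |ΔD - ∑ l, (derivSource Cd Dd i l w q * ξ l + p (i, l) * ΔC l)| ≤
      e * (1 + (m - 1 : ℕ) * Mp) +
        Md * ((1 + (m - 1 : ℕ) * L) * (1 + (m - 1 : ℕ)) + (m - 1 : ℕ) * (1 + L)) * X := by
  -- The change predicted by `q`, as against the true change `δ`. They differ by the remainder for
  -- `p` and the error `q - p`, both measured by `X`.
  set δ' : ι → ℝ := fun s => ∑ l, q (s, l) * ξ l with hδ'
  have hH : ∑ l, derivSource Cd Dd i l w q * ξ l =
      Dd i w ((ξ, 0), δ') - ∑ k, q (i, k) * Cd i k w ((ξ, 0), δ') := by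
    simp only [derivSource, sub_mul, Finset.sum_sub_distrib]
    rw [sum_mul_apply_single (Dd i w) ξ (fun l s => q (s, l))]
    simp only [Finset.sum_mul]
    rw [Finset.sum_comm]
    congr 1
    refine Finset.sum_congr rfl fun k _ => ?_
    rw [← sum_mul_apply_single (Cd i k w) ξ (fun l s => q (s, l)), Finset.mul_sum]
    exact Finset.sum_congr rfl fun l _ => mul_assoc _ _ _
  -- For exact data everything cancels. What is left are the Taylor errors of `D` and `C`, the
  -- effect of `δ - δ'`, and the effect of `q - p`.
  have hid : ΔD - ∑ l, (derivSource Cd Dd i l w q * ξ l + p (i, l) * ΔC l) =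
      (ΔD - Dd i w ((ξ, 0), δ)) - ∑ l, p (i, l) * (ΔC l - Cd i l w ((ξ, 0), δ)) +
        (Dd i w (0, δ - δ') + ∑ k, (q (i, k) * -Cd i k w (0, δ - δ') +
          (q (i, k) - p (i, k)) * Cd i k w ((ξ, 0), δ))) := by
    rw [Finset.sum_add_distrib, hH, apply_pair_eq_add (Dd i w) (ξ, 0) δ δ']
    have : ∀ k, Cd i k w ((ξ, 0), δ) = Cd i k w ((ξ, 0), δ') + Cd i k w (0, δ - δ') := fun k =>
      apply_pair_eq_add (Cd i k w) (ξ, 0) δ δ'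
    simp only [this, mul_sub, mul_add, sub_mul, mul_neg, Finset.sum_add_distrib,
      Finset.sum_sub_distrib, Finset.sum_neg_distrib]
    ring
  have hd : ((m - 1 : ℕ) : ℝ) = ∑ _l : Fin (m - 1), (1 : ℝ) := by simp
  have hδδ : ‖δ - δ'‖ ≤ (1 + (m - 1 : ℕ)) * X := by
    refine (pi_norm_le_iff_of_nonneg (by positivity)).2 fun s => ?_
    have e1 : (δ - δ') s = (δ s - ∑ l, p (s, l) * ξ l) - ∑ l, (q (s, l) - p (s, l)) * ξ l := by
      simp [hδ', sub_mul, Finset.sum_sub_distrib]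
    rw [e1, Real.norm_eq_abs]
    have e2 : |∑ l, (q (s, l) - p (s, l)) * ξ l| ≤ (m - 1 : ℕ) * X := by
      rw [hd, Finset.sum_mul]
      refine (Finset.abs_sum_le_sum_abs _ _).trans (Finset.sum_le_sum fun l _ => ?_)
      rw [abs_mul, one_mul]
      exact (mul_le_mul_of_nonneg_left (norm_le_pi_norm ξ l) (abs_nonneg _)).trans (hqp (s, l))
    calc _ ≤ _ := abs_sub _ _
      _ ≤ X + (m - 1 : ℕ) * X := add_le_add (hrem s) e2
      _ = _ := by ring
  have h0 : ‖((0, δ - δ') : Dom m × (ι → ℝ))‖ ≤ (1 + (m - 1 : ℕ)) * X := by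
    rw [Prod.norm_def]
    simpa using hδδ
  have t1 : |∑ l, p (i, l) * (ΔC l - Cd i l w ((ξ, 0), δ))| ≤ (m - 1 : ℕ) * (Mp * e) := by
    rw [hd, Finset.sum_mul]
    refine (Finset.abs_sum_le_sum_abs _ _).trans (Finset.sum_le_sum fun l _ => ?_)
    rw [abs_mul, one_mul]
    exact mul_le_mul (hp _) (heC l) (abs_nonneg _) ((abs_nonneg _).trans (hp (i, l)))
  have t2 : |∑ k, (q (i, k) * -Cd i k w (0, δ - δ') +
          (q (i, k) - p (i, k)) * Cd i k w ((ξ, 0), δ))| ≤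
      (m - 1 : ℕ) * (L * (Md * ((1 + (m - 1 : ℕ)) * X)) + Md * (1 + L) * X) := by
    rw [hd, Finset.sum_mul, ← hd]
    refine (Finset.abs_sum_le_sum_abs _ _).trans (Finset.sum_le_sum fun k _ => ?_)
    rw [one_mul]
    refine (abs_add_le _ _).trans (add_le_add ?_ ?_)
    · rw [abs_mul, abs_neg]
      exact mul_le_mul (hq _) (abs_apply_le (hC k) h0) (abs_nonneg _) hL
    · rw [abs_mul]
      calc _ ≤ |q (i, k) - p (i, k)| * (Md * ((1 + L) * ‖ξ‖)) :=
            mul_le_mul_of_nonneg_left (abs_apply_le (hC k) hδ) (abs_nonneg _)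
        _ = Md * (1 + L) * (|q (i, k) - p (i, k)| * ‖ξ‖) := by ring
        _ ≤ _ := by
          have := hqp (i, k)
          gcongr
  have t3 := abs_apply_le hD h0
  rw [hid]
  calc _ ≤ (|ΔD - Dd i w ((ξ, 0), δ)| + |∑ l, p (i, l) * (ΔC l - Cd i l w ((ξ, 0), δ))|) +
        (|Dd i w (0, δ - δ')| + |∑ k, (q (i, k) * -Cd i k w (0, δ - δ') +
          (q (i, k) - p (i, k)) * Cd i k w ((ξ, 0), δ))|) :=
        (abs_add_le _ _).trans (add_le_add (abs_sub _ _) (abs_add_le _ _))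
    _ ≤ (e + (m - 1 : ℕ) * (Mp * e)) + (Md * ((1 + (m - 1 : ℕ)) * X) +
        (m - 1 : ℕ) * (L * (Md * ((1 + (m - 1 : ℕ)) * X)) + Md * (1 + L) * X)) :=
        add_le_add (add_le_add heD t1) (add_le_add t3 t2)
    _ = _ := by ring

/-- The source is quadratic in `q`, hence Lipschitz only on bounded sets; this forces the clamp in
the derived system. -/
theorem abs_derivSource_sub_le
    {Cd : ι → Fin (m - 1) → Dom m × (ι → ℝ) → Dom m × (ι → ℝ) →L[ℝ] ℝ}
    {Dd : ι → Dom m × (ι → ℝ) → Dom m × (ι → ℝ) →L[ℝ] ℝ} {i : ι} {l : Fin (m - 1)}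
    {w : Dom m × (ι → ℝ)} {Md L : ℝ} (hL : 0 ≤ L) (hC : ∀ l, ‖Cd i l w‖ ≤ Md)
    (hD : ‖Dd i w‖ ≤ Md) {q q' : ι × Fin (m - 1) → ℝ} (hq : ‖q‖ ≤ L) (hq' : ‖q'‖ ≤ L) :
    |derivSource Cd Dd i l w q - derivSource Cd Dd i l w q'| ≤
      Md * (1 + (m - 1 : ℕ) * (1 + 2 * L)) * ‖q - q'‖ := by
  have hsub : ‖((0, (fun s => q (s, l)) - fun s => q' (s, l)) : Dom m × (ι → ℝ))‖ ≤ ‖q - q'‖ := by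
    rw [Prod.norm_def]
    simp only [norm_zero]
    rw [max_eq_right (norm_nonneg _)]
    exact (pi_norm_le_iff_of_nonneg (norm_nonneg _)).2 fun s => norm_le_pi_norm (q - q') (s, l)
  have hlq : ‖(fun s => q (s, l))‖ ≤ L :=
    (pi_norm_le_iff_of_nonneg hL).2 fun s => (norm_le_pi_norm q (s, l)).trans hq
  have hid : derivSource Cd Dd i l w q - derivSource Cd Dd i l w q' =
      Dd i w (0, (fun s => q (s, l)) - fun s => q' (s, l)) -
        ∑ k, ((q (i, k) - q' (i, k)) * Cd i k w ((Pi.single l 1, 0), fun s => q (s, l)) +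
          q' (i, k) * Cd i k w (0, (fun s => q (s, l)) - fun s => q' (s, l))) := by
    simp only [derivSource]
    rw [apply_pair_eq_add (Dd i w) _ (fun s => q (s, l)) (fun s => q' (s, l))]
    have : ∀ k, Cd i k w ((Pi.single l 1, 0), fun s => q (s, l)) =
        Cd i k w ((Pi.single l 1, 0), fun s => q' (s, l)) +
          Cd i k w (0, (fun s => q (s, l)) - fun s => q' (s, l)) := fun k =>
      apply_pair_eq_add (Cd i k w) _ _ _
    simp only [this, sub_mul, mul_add, Finset.sum_add_distrib, Finset.sum_sub_distrib]
    ring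
  have hd : ((m - 1 : ℕ) : ℝ) = ∑ _l : Fin (m - 1), (1 : ℝ) := by simp
  rw [hid]
  have h2 : |∑ k, ((q (i, k) - q' (i, k)) * Cd i k w ((Pi.single l 1, 0), fun s => q (s, l)) +
          q' (i, k) * Cd i k w (0, (fun s => q (s, l)) - fun s => q' (s, l)))| ≤
      (m - 1 : ℕ) * (‖q - q'‖ * (Md * (1 + L)) + L * (Md * ‖q - q'‖)) := by
    rw [hd, Finset.sum_mul]
    refine (Finset.abs_sum_le_sum_abs _ _).trans (Finset.sum_le_sum fun k _ => ?_)
    rw [one_mul]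
    refine (abs_add_le _ _).trans (add_le_add ?_ ?_)
    · rw [abs_mul]
      exact mul_le_mul (norm_le_pi_norm (q - q') (i, k)) (abs_apply_le (hC k)
        ((norm_pair_single_le l _).trans (by gcongr))) (abs_nonneg _) (norm_nonneg _)
    · rw [abs_mul]
      exact mul_le_mul ((norm_le_pi_norm q' (i, k)).trans hq') (abs_apply_le (hC k) hsub)
        (abs_nonneg _) hL
  calc _ ≤ Md * ‖q - q'‖ + (m - 1 : ℕ) * (‖q - q'‖ * (Md * (1 + L)) + L * (Md * ‖q - q'‖)) :=
        (abs_sub _ _).trans (add_le_add (abs_apply_le hD hsub) h2)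
    _ = _ := by ring

theorem continuousOn_derivSource {X : Type*} [TopologicalSpace X] {T : Set X}
    {Cd : ι → Fin (m - 1) → Dom m × (ι → ℝ) → Dom m × (ι → ℝ) →L[ℝ] ℝ}
    {Dd : ι → Dom m × (ι → ℝ) → Dom m × (ι → ℝ) →L[ℝ] ℝ} {W : Set (Dom m × (ι → ℝ))}
    (hC : ∀ i l, ContinuousOn (Cd i l) W) (hD : ∀ i, ContinuousOn (Dd i) W)
    {w : X → Dom m × (ι → ℝ)} (hw : ContinuousOn w T) (hwW : MapsTo w T W)
    {q : X → ι × Fin (m - 1) → ℝ} (hq : ContinuousOn q T) (i : ι) (l : Fin (m - 1)) :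
    ContinuousOn (fun x => derivSource Cd Dd i l (w x) (q x)) T := by
  have hqj : ∀ j, ContinuousOn (fun x => q x j) T := fun j => continuousOn_pi.1 hq j
  have hv : ContinuousOn (fun x => (((Pi.single l 1, 0), fun s => q x (s, l)) :
      Dom m × (ι → ℝ))) T :=
    continuousOn_const.prodMk (continuousOn_pi.2 fun s => hqj (s, l))
  refine (((hD i).comp hw hwW).clm_apply hv).sub ?_
  exact continuousOn_finsetSum _ fun k _ => (hqj (i, k)).mul (((hC i k).comp hw hwW).clm_apply hv)

end DerivedSystem

/-! ### Truncation of real numbers. -/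

section Clamp

/-- Projection of `ℝ` onto `[-L, L]`. -/
def clamp (L x : ℝ) : ℝ := max (-L) (min x L)

theorem continuous_clamp (L : ℝ) : Continuous (clamp L) := by
  unfold clamp
  fun_prop

theorem abs_clamp_le {L : ℝ} (hL : 0 ≤ L) (x : ℝ) : |clamp L x| ≤ L :=
  abs_le.2 ⟨le_max_left _ _, max_le (by linarith) (min_le_right _ _)⟩

theorem abs_clamp_sub_clamp_le (L x y : ℝ) : |clamp L x - clamp L y| ≤ |x - y| :=
  (abs_max_sub_max_le_max _ _ _ _).trans <| max_le (by simp) <|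
    (abs_min_sub_min_le_max _ _ _ _).trans (max_le le_rfl (by simp))

theorem abs_clamp_sub_self_le {L a x : ℝ} (ha : 0 ≤ a) (hL : 0 ≤ L) (h : |x| ≤ L + a) :
    |clamp L x - x| ≤ a := by
  have := abs_le.1 h
  unfold clamp
  rw [abs_le]
  constructor <;> cases max_cases (-L) (min x L) <;> cases min_cases x L <;> linarith

theorem clamp_eq_self {L x : ℝ} (h : |x| ≤ L) : clamp L x = x := by
  have := abs_le.1 h
  rw [clamp, min_eq_left this.2, max_eq_right this.1]

end Clamp

/-! ### The solution of the clamped derived system is the spatial derivative. -/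

section Derivative

variable {m : ℕ} {ι : Type*} [Fintype ι]

/-- `u` solves the quasilinear system with coefficients `C` and `D` along characteristics. -/
structure QuasilinearSolution (t0 : ℝ) (S : Set (Dom m)) (Q : Set (ι → ℝ))
    (C : ι → Fin (m - 1) → Dom m × (ι → ℝ) → ℝ) (D : ι → Dom m × (ι → ℝ) → ℝ)
    (u : Dom m → ι → ℝ) : Prop where
  mapsTo : MapsTo u S Q
  lipschitz : ∃ K, LipschitzOnWith K u S
  charDomain : ∀ i, CharDomain t0 S (fun z l => C i l (z, u z))
  transported : ∀ i, Transported t0 S (fun z l => C i l (z, u z)) (fun z => D i (z, u z))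
    (fun z => u z i)

/-- Coefficients with continuous derivatives on a compact convex set. -/
structure SmoothCoefficients (W : Set (Dom m × (ι → ℝ)))
    (C : ι → Fin (m - 1) → Dom m × (ι → ℝ) → ℝ) (D : ι → Dom m × (ι → ℝ) → ℝ)
    (Cd : ι → Fin (m - 1) → Dom m × (ι → ℝ) → Dom m × (ι → ℝ) →L[ℝ] ℝ)
    (Dd : ι → Dom m × (ι → ℝ) → Dom m × (ι → ℝ) →L[ℝ] ℝ) : Prop where
  convex : Convex ℝ W
  isCompact : IsCompact W
  hasC : ∀ i l, ∀ w ∈ W, HasFDerivWithinAt (C i l) (Cd i l w) W w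
  contC : ∀ i l, ContinuousOn (Cd i l) W
  hasD : ∀ i, ∀ w ∈ W, HasFDerivWithinAt (D i) (Dd i w) W w
  contD : ∀ i, ContinuousOn (Dd i) W

variable {t0 : ℝ} {S : Set (Dom m)} {Q : Set (ι → ℝ)}
  {C : ι → Fin (m - 1) → Dom m × (ι → ℝ) → ℝ} {D : ι → Dom m × (ι → ℝ) → ℝ}
  {Cd : ι → Fin (m - 1) → Dom m × (ι → ℝ) → Dom m × (ι → ℝ) →L[ℝ] ℝ}
  {Dd : ι → Dom m × (ι → ℝ) → Dom m × (ι → ℝ) →L[ℝ] ℝ} {W : Set (Dom m × (ι → ℝ))}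
  {u : Dom m → ι → ℝ} {p : Dom m → ι × Fin (m - 1) → ℝ}

theorem SmoothCoefficients.exists_bound (h : SmoothCoefficients W C D Cd Dd) :
    ∃ Md, 0 ≤ Md ∧ (∀ i l, ∀ w ∈ W, ‖Cd i l w‖ ≤ Md) ∧ ∀ i, ∀ w ∈ W, ‖Dd i w‖ ≤ Md := by
  choose MC hMC using fun i l => h.isCompact.exists_bound_of_continuousOn (h.contC i l)
  choose MD hMD using fun i => h.isCompact.exists_bound_of_continuousOn (h.contD i)
  have hC : ∀ i l, MC i l ≤ ∑ i, ∑ l, |MC i l| := fun i l =>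
    (le_abs_self _).trans ((Finset.single_le_sum (f := fun l => |MC i l|)
      (fun _ _ => abs_nonneg _) (Finset.mem_univ l)).trans
        (Finset.single_le_sum (f := fun i => ∑ l, |MC i l|)
          (fun _ _ => Finset.sum_nonneg fun _ _ => abs_nonneg _) (Finset.mem_univ i)))
  have hD : ∀ i, MD i ≤ ∑ i, |MD i| := fun i =>
    (le_abs_self _).trans (Finset.single_le_sum (f := fun i => |MD i|)
      (fun _ _ => abs_nonneg _) (Finset.mem_univ i))
  have h1 : 0 ≤ ∑ i, ∑ l, |MC i l| :=
    Finset.sum_nonneg fun _ _ => Finset.sum_nonneg fun _ _ => abs_nonneg _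
  have h2 : 0 ≤ ∑ i, |MD i| := Finset.sum_nonneg fun _ _ => abs_nonneg _
  refine ⟨(∑ i, ∑ l, |MC i l|) + ∑ i, |MD i|, by positivity, fun i l w hw => ?_,
    fun i w hw => ?_⟩
  · linarith [hMC i l w hw, hC i l]
  · linarith [hMD i w hw, hD i]

theorem SmoothCoefficients.uniform_taylor (h : SmoothCoefficients W C D Cd Dd) {η : ℝ}
    (hη : 0 < η) : ∃ δ > 0, ∀ w ∈ W, ∀ w' ∈ W, ‖w' - w‖ ≤ δ →
      (∀ i l, |C i l w' - C i l w - Cd i l w (w' - w)| ≤ η * ‖w' - w‖) ∧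
      ∀ i, |D i w' - D i w - Dd i w (w' - w)| ≤ η * ‖w' - w‖ := by
  choose δC hδC hC using fun i l =>
    CharSystem.uniform_taylor h.convex h.isCompact (h.hasC i l) (h.contC i l) hη
  choose δD hδD hD using fun i =>
    CharSystem.uniform_taylor h.convex h.isCompact (h.hasD i) (h.contD i) hη
  have e1 : ∀ᶠ δ in 𝓝[>] (0 : ℝ), ∀ i l, δ ≤ δC i l := eventually_all.2 fun i =>
    eventually_all.2 fun l => (eventually_le_nhds (hδC i l)).filter_mono nhdsWithin_le_nhds
  have e2 : ∀ᶠ δ in 𝓝[>] (0 : ℝ), ∀ i, δ ≤ δD i := eventually_all.2 fun i =>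
    (eventually_le_nhds (hδD i)).filter_mono nhdsWithin_le_nhds
  obtain ⟨δ, ⟨h1, h2⟩, hδ⟩ := ((e1.and e2).and self_mem_nhdsWithin).exists
  exact ⟨δ, hδ, fun w hw w' hw' hle => ⟨fun i l => hC i l w hw w' hw' (hle.trans (h1 i l)),
    fun i => hD i w hw w' hw' (hle.trans (h2 i))⟩⟩

/-- The remainder of the first order expansion of `u` with spatial derivative `p`. -/
def remainder (u : Dom m → ι → ℝ) (p : Dom m → ι × Fin (m - 1) → ℝ) (y y' : Dom m) (i : ι) : ℝ :=
  u y' i - u y i - ∑ l, p y (i, l) * (y'.1 l - y.1 l)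

theorem clm_apply_eq_sum_single {d : ℕ} (A : (Fin d → ℝ) →L[ℝ] ℝ) (v : Fin d → ℝ) :
    A v = ∑ l, v l * A (Pi.single l 1) := by
  have e : v = ∑ l, v l • (Pi.single l 1 : Fin d → ℝ) := by
    funext k
    simp [Finset.sum_apply, Pi.single_apply]
  conv_lhs => rw [e, map_sum]
  simp

/-- The solution of the derived system with clamped coefficients is the spatial derivative. -/
theorem remainder_isLittleO (hS : RegularDomain t0 S)
    (hu : QuasilinearSolution t0 S Q C D u) (hW : SmoothCoefficients (S ×ˢ Q) C D Cd Dd)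
    {Jd : ι → (Fin (m - 1) → ℝ) → (Fin (m - 1) → ℝ) →L[ℝ] ℝ}
    (hJ : ∀ i, ∀ x ∈ {x | (x, t0) ∈ S},
      HasFDerivWithinAt (fun x => u (x, t0) i) (Jd i x) {x | (x, t0) ∈ S} x)
    (hJc : ∀ i, ContinuousOn (Jd i) {x | (x, t0) ∈ S})
    {L : NNReal} (hL : LipschitzOnWith L u S) (hp : ContinuousOn p S)
    (hptr : ∀ i l, Transported t0 S (fun z l => C i l (z, u z))
      (fun z => derivSource Cd Dd i l (z, u z) fun j => clamp L (p z j)) fun z => p z (i, l))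
    (hp0 : ∀ x, (x, t0) ∈ S → ∀ i l, p (x, t0) (i, l) = Jd i x (Pi.single l 1))
    {z : Dom m} (hz : z ∈ interior S) {η : ℝ} (hη : 0 < η) :
    ∃ δ > 0, ∀ y ∈ S, y.2 = z.2 → ‖y.1 - z.1‖ ≤ δ → ‖remainder u p z y‖ ≤ η * ‖y.1 - z.1‖ := by
  obtain ⟨α, hα0, hα⟩ := exists_time_bound hS.isCompact t0
  choose B₀ hB using fun i => (hu.charDomain i).exists_bound hS.isCompact
  choose K hK using fun i => (hu.charDomain i).lip
  obtain ⟨Mp, hMp⟩ := hS.isCompact.exists_bound_of_continuousOn hp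
  obtain ⟨Md, hMd0, hMC, hMD⟩ := hW.exists_bound
  obtain ⟨w₀, hw₀, hwidth⟩ := hS.exists_width hz
  have hMp0 : 0 ≤ Mp := (norm_nonneg _).trans (hMp z (interior_subset hz))
  have hL0 : (0 : ℝ) ≤ L := L.2
  set M : ℝ := ∑ i, (K i : ℝ) with hMdef
  have hM : 0 ≤ M := Finset.sum_nonneg fun i _ => (K i).2
  have hKM : ∀ i, (K i : ℝ) ≤ M := fun i =>
    Finset.single_le_sum (f := fun i => (K i : ℝ)) (fun i _ => (K i).2) (Finset.mem_univ i)
  set K₁ : ℝ := Md * ((1 + (m - 1 : ℕ) * (L : ℝ)) * (1 + (m - 1 : ℕ)) +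
    (m - 1 : ℕ) * (1 + (L : ℝ))) with hK₁
  have hK₁0 : 0 ≤ K₁ := by positivity
  -- the remainder is at most `Γ * η' * ε` on `ε`-close pairs
  set Γ : ℝ := 2 * (1 + α * ((1 + L) * (1 + (m - 1 : ℕ) * Mp))) *
    Real.exp ((2 * K₁ + 1) * α) with hΓ
  have hΓ0 : 0 < Γ := by positivity
  -- The estimate loses `Γ` in the Gronwall argument and at most `exp(Mα)` when a pair at `z` is
  -- made close; division by both leaves `η`.
  set η' : ℝ := η / (Γ * Real.exp (M * α)) with hη'
  have hη'0 : 0 < η' := by positivity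
  obtain ⟨δ₁, hδ₁, htay⟩ := hW.uniform_taylor hη'0
  choose δJ hδJ htayJ using fun i => CharSystem.uniform_taylor hS.convex_slice hS.isCompact_slice (hJ i) (hJc i) hη'0
  obtain ⟨δ₂, hδJ₂, hδ₂⟩ : ∃ δ₂, (∀ i, δ₂ ≤ δJ i) ∧ 0 < δ₂ := by
    have e2 : ∀ᶠ δ in 𝓝[>] (0 : ℝ), ∀ i, δ ≤ δJ i := eventually_all.2 fun i =>
      (eventually_le_nhds (hδJ i)).filter_mono nhdsWithin_le_nhds
    exact (e2.and self_mem_nhdsWithin).exists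
  -- Only times between the initial plane and `z` occur; there `exists_width` provides room, which
  -- may fail towards the far end of `S`.
  set N : Set ℝ := {t | ∃ θ ∈ Icc (0 : ℝ) 1, t = t0 + θ * (z.2 - t0)} with hN
  have hNstar : ∀ t ∈ N, ∀ σ ∈ Icc (0 : ℝ) 1, t0 + σ * (t - t0) ∈ N := by
    rintro t ⟨θ, hθ, rfl⟩ σ hσ
    exact ⟨σ * θ, mul_mem_unit hσ hθ, by ring⟩
  have hΔu : ∀ y ∈ S, ∀ y' ∈ S, y.2 = y'.2 → ‖u y' - u y‖ ≤ L * ‖y'.1 - y.1‖ := by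
    intro y hy y' hy' heq
    have := norm_sub_le_of_lip hL hy' hy
    rwa [heq, sub_self, abs_zero, add_zero] at this
  have main : ∀ ε, 0 < ε → ε ≤ w₀ → (1 + L) * ε ≤ δ₁ → ε ≤ δ₂ → ∀ y y',
      ClosePair t0 S N M ε y y' → ‖remainder u p y y'‖ ≤ Γ * (η' * ε) := by
    intro ε hε hεw hε1 hε2 y y' hyy
    have hpair : ∀ y y', ClosePair t0 S N M ε y y' →
        ‖((y', u y') : Dom m × (ι → ℝ)) - (y, u y)‖ ≤ (1 + L) * ‖y'.1 - y.1‖ := by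
      intro y y' h
      have := hΔu y h.1 y' h.2.1 h.2.2.1
      rw [Prod.norm_def, Prod.norm_def]
      refine max_le (max_le ?_ ?_) ?_
      · simp only [Prod.mk_sub_mk, Prod.fst_sub]
        nlinarith [norm_nonneg (y'.1 - y.1)]
      · simp [h.2.2.1]
        positivity
      · simp only [Prod.mk_sub_mk]
        nlinarith [norm_nonneg (y'.1 - y.1)]
    have hsumle : ∀ y ∈ S, ∀ i, ∀ ξ : Fin (m - 1) → ℝ,
        |∑ l, p y (i, l) * ξ l| ≤ (m - 1 : ℕ) * (Mp * ‖ξ‖) := by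
      intro y hy i ξ
      have hd : ((m - 1 : ℕ) : ℝ) = ∑ _l : Fin (m - 1), (1 : ℝ) := by simp
      rw [hd, Finset.sum_mul]
      refine (Finset.abs_sum_le_sum_abs _ _).trans (Finset.sum_le_sum fun l _ => ?_)
      rw [abs_mul, one_mul]
      exact mul_le_mul ((norm_le_pi_norm (p y) (i, l)).trans (hMp y hy)) (norm_le_pi_norm ξ l)
        (abs_nonneg _) hMp0
    have := pair_gronwall (N := N) (R := remainder u p)
      (G := fun i y y' => D i (y', u y') - D i (y, u y) -
        ∑ l, (derivSource Cd Dd i l (y, u y) (fun j => clamp L (p y j)) * (y'.1 l - y.1 l) +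
          p y (i, l) * (C i l (y', u y') - C i l (y, u y))))
      (M₀ := L * ε + (m - 1 : ℕ) * (Mp * ε)) (a := η' * ε)
      (b := η' * ((1 + L) * ε) * (1 + (m - 1 : ℕ) * Mp)) hNstar hα0 hα hu.charDomain hB hK hKM
      (by positivity) (by positivity) hK₁0 ?_ ?_ ?_ ?_ hyy
    · refine this.trans_eq ?_
      rw [hΓ]
      ring
    · intro y y' h
      refine (pi_norm_le_iff_of_nonneg (by positivity)).2 fun i => ?_
      have h1 := h.norm_sub_le hM hε.le
      have h2 : |u y' i - u y i| ≤ L * ε := by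
        refine ((norm_le_pi_norm (u y' - u y) i).trans (hΔu y h.1 y' h.2.1 h.2.2.1)).trans ?_
        gcongr
      have h3 : |∑ l, p y (i, l) * (y'.1 l - y.1 l)| ≤ (m - 1 : ℕ) * (Mp * ε) := by
        refine (hsumle y h.1 i (y'.1 - y.1)).trans ?_
        gcongr
      exact (abs_sub _ _).trans (add_le_add h2 h3)
    · rintro ⟨x, t⟩ ⟨x', t'⟩ h ht
      have htt : t = t' := h.2.2.1
      have ht0 : t = t0 := ht
      subst htt
      subst ht0
      refine (pi_norm_le_iff_of_nonneg (by positivity)).2 fun i => ?_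
      have h1 : ‖x' - x‖ ≤ ε := h.norm_sub_le hM hε.le
      have h2 := htayJ i x h.1 x' h.2.1 (h1.trans (hε2.trans (hδJ₂ i)))
      have h3 : Jd i x (x' - x) = ∑ l, p (x, t) (i, l) * (x' l - x l) := by
        rw [clm_apply_eq_sum_single]
        refine Finset.sum_congr rfl fun l _ => ?_
        rw [hp0 x h.1 i l, mul_comm, Pi.sub_apply]
      rw [h3] at h2
      refine h2.trans ?_
      gcongr
    · intro i y y' h Y Y' hY hY' σ hσ
      have hm := (hu.charDomain i).mem y h.1 Y hY σ hσ
      have d1 := hu.transported i y h.1 Y hY σ hσ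
      have d2 := hu.transported i y' h.2.1 Y' hY' σ hσ
      have d3 : ∀ l, HasDerivWithinAt
          (fun s => p (pt t0 y Y s) (i, l) * ((pt t0 y' Y' s).1 l - (pt t0 y Y s).1 l))
          ((y.2 - t0) * derivSource Cd Dd i l (pt t0 y Y σ, u (pt t0 y Y σ))
            (fun j => clamp L (p (pt t0 y Y σ) j)) *
              ((pt t0 y' Y' σ).1 l - (pt t0 y Y σ).1 l) +
            p (pt t0 y Y σ) (i, l) *
              ((y'.2 - t0) * C i l (pt t0 y' Y' σ, u (pt t0 y' Y' σ)) -
                (y.2 - t0) * C i l (pt t0 y Y σ, u (pt t0 y Y σ)))) (Icc 0 1) σ := by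
        intro l
        have e1 := hasDerivWithinAt_pi.1 (hY.deriv σ hσ) l
        have e2 := hasDerivWithinAt_pi.1 (hY'.deriv σ hσ) l
        exact (hptr i l y h.1 Y hY σ hσ).mul (e2.sub e1)
      have d4 := HasDerivWithinAt.fun_sum (u := Finset.univ) fun l _ => d3 l
      refine ((d2.sub d1).sub d4).congr_deriv ?_
      rw [← h.2.2.1, mul_sub, mul_sub, Finset.mul_sum]
      congr 1
      refine Finset.sum_congr rfl fun l _ => ?_
      ring
    · intro B hB0 hBall i y y' h
      have hξ := h.norm_sub_le hM hε.le
      set E := Real.exp ((2 * K₁ + 1) * |y.2 - t0|) with hE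
      have hX : 0 ≤ B * E := by positivity
      obtain ⟨θ, hθ, hyθ⟩ := h.2.2.2.1
      set w : ℝ := ε * Real.exp (-(M * |y.2 - t0|)) with hw
      have hw0 : 0 < w := by positivity
      have hwε : w ≤ ε := mul_le_of_le_one_right hε.le (Real.exp_le_one_iff.2 (by
        have := mul_nonneg hM (abs_nonneg (y.2 - t0))
        linarith))
      -- The pair of `y` and its shift by `s` in one coordinate is itself close, so its remainder is
      -- at most `B * E`. Since `u` is `L`-Lipschitz, this bounds `|p| w` by `L w + B E`.
      have hstep : ∀ k l s, |s| = w → (Function.update y.1 l (y.1 l + s), y.2) ∈ S →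
          |p y (k, l)| * w ≤ L * w + B * E := by
        intro k l s hs hmem
        have hsub : Function.update y.1 l (y.1 l + s) - y.1 = Pi.single l s := by
          funext j
          by_cases hj : j = l
          · subst hj; simp
          · simp [Function.update_of_ne hj, Pi.single_eq_of_ne hj]
        have hnorm : ‖Function.update y.1 l (y.1 l + s) - y.1‖ = w := by
          rw [hsub, Pi.norm_single, Real.norm_eq_abs, hs]
        have hcp : ClosePair t0 S N M ε y (Function.update y.1 l (y.1 l + s), y.2) :=
          ⟨h.1, hmem, rfl, h.2.2.2.1, hnorm.le⟩
        have h1 := (norm_le_pi_norm _ k).trans (hBall _ _ hcp)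
        have h2 := (norm_le_pi_norm _ k).trans (hΔu y h.1 _ hmem rfl)
        simp only at h2
        rw [hnorm] at h2
        have h3 : ∑ j, p y (k, j) * (Function.update y.1 l (y.1 l + s) j - y.1 j) =
            p y (k, l) * s := by
          have : ∀ j, Function.update y.1 l (y.1 l + s) j - y.1 j =
              (Pi.single l s : Fin (m - 1) → ℝ) j := fun j => congrFun hsub j
          simp [this, Pi.single_apply]
        rw [remainder, h3] at h1
        rw [← hs, ← abs_mul, hs]
        rw [Real.norm_eq_abs] at h1 h2
        rw [Pi.sub_apply] at h2
        have := abs_sub_abs_le_abs_sub (p y (k, l) * s)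
          (u (Function.update y.1 l (y.1 l + s), y.2) k - u y k)
        rw [abs_sub_comm] at h1
        linarith
      -- Thus `p` exceeds `L` by at most `B E / w`, and so does the clamping error. As the pair is
      -- at distance at most `w`, the product is at most `B E`: the clamp is controlled by the
      -- remainder itself and can be absorbed by Gronwall.
      have hqp : ∀ j, |clamp L (p y j) - p y j| * ‖y'.1 - y.1‖ ≤ B * E := by
        rintro ⟨k, l⟩
        have h1 : |p y (k, l)| * w ≤ L * w + B * E := by
          rcases hwidth y h.1 θ hθ hyθ l w ⟨hw0.le, hwε.trans hεw⟩ with hm | hm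
          · exact hstep k l w (abs_of_pos hw0) hm
          · refine hstep k l (-w) (by rw [abs_neg, abs_of_pos hw0]) ?_
            rwa [← sub_eq_add_neg]
        have h2 : |p y (k, l)| ≤ L + B * E / w := by
          rw [← mul_le_mul_iff_left₀ hw0, add_mul, div_mul_cancel₀ _ hw0.ne']
          exact h1
        calc _ ≤ B * E / w * w := by
              refine mul_le_mul (abs_clamp_sub_self_le (by positivity) hL0 h2) h.2.2.2.2
                (norm_nonneg _) (by positivity)
          _ = _ := div_mul_cancel₀ _ hw0.ne'
      have hyW : ((y, u y) : Dom m × (ι → ℝ)) ∈ S ×ˢ Q := ⟨h.1, hu.mapsTo h.1⟩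
      have hyW' : ((y', u y') : Dom m × (ι → ℝ)) ∈ S ×ˢ Q := ⟨h.2.1, hu.mapsTo h.2.1⟩
      have hn := hpair y y' h
      have hn' : ‖((y', u y') : Dom m × (ι → ℝ)) - (y, u y)‖ ≤ (1 + L) * ε :=
        hn.trans (by gcongr)
      obtain ⟨tC, tD⟩ := htay _ hyW _ hyW' (hn'.trans hε1)
      have hsub : ((y', u y') : Dom m × (ι → ℝ)) - (y, u y) = ((y'.1 - y.1, 0), u y' - u y) := by
        ext1
        · ext1
          · rfl
          · simp [h.2.2.1]
        · rfl
      have hle : η' * ‖((y', u y') : Dom m × (ι → ℝ)) - (y, u y)‖ ≤ η' * ((1 + L) * ε) := by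
        gcongr
      have := abs_expansion_remainder_le (Cd := Cd) (Dd := Dd) (i := i) (w := (y, u y))
        (ΔD := D i (y', u y') - D i (y, u y)) (p := p y) (q := fun j => clamp L (p y j))
        (ξ := y'.1 - y.1) (δ := u y' - u y) (ΔC := fun l => C i l (y', u y') - C i l (y, u y))
        (e := η' * ((1 + L) * ε)) (X := B * E) (Mp := Mp) hMd0 hL0 hX (fun l => hMC i l _ hyW)
        (hMD i _ hyW) (fun j => (norm_le_pi_norm (p y) j).trans (hMp y h.1))
        (fun j => abs_clamp_le hL0 _) (by rw [← hsub]; exact (tD i).trans hle)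
        (fun l => by rw [← hsub]; exact (tC i l).trans hle) (by rw [← hsub]; exact hn)
        (fun s => (norm_le_pi_norm _ s).trans (hBall y y' h)) hqp
      exact this
  -- specialize to pairs that start at `z`
  set ε₀ : ℝ := min w₀ (min (δ₁ / (1 + L)) δ₂) with hε₀
  have hε₀0 : 0 < ε₀ := by positivity
  refine ⟨ε₀ * Real.exp (-(M * α)), by positivity, fun y hy hyz hle => ?_⟩
  rcases eq_or_lt_of_le (norm_nonneg (y.1 - z.1)) with h0 | h0
  · have : y = z := by
      ext1
      · exact sub_eq_zero.1 (norm_eq_zero.1 h0.symm)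
      · exact hyz
    subst this
    have : remainder u p y y = 0 := by
      funext i
      simp [remainder]
    rw [this]
    simp
  -- The smallest `ε` for which `(z, y)` is close, so that the bound is proportional to the distance
  -- of `y` from `z`.
  set ε : ℝ := ‖y.1 - z.1‖ * Real.exp (M * |z.2 - t0|) with hε
  have hεα : ε ≤ ‖y.1 - z.1‖ * Real.exp (M * α) := by
    have := hα z (interior_subset hz)
    rw [hε]
    gcongr
  have hεε₀ : ε ≤ ε₀ := by
    refine hεα.trans ?_
    calc _ ≤ ε₀ * Real.exp (-(M * α)) * Real.exp (M * α) := by gcongr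
      _ = _ := by rw [mul_assoc, ← Real.exp_add, neg_add_cancel, Real.exp_zero, mul_one]
  have := main ε (by positivity) (hεε₀.trans (min_le_left _ _)) ?_
    (hεε₀.trans ((min_le_right _ _).trans (min_le_right _ _))) z y
    ⟨interior_subset hz, hy, hyz.symm, ⟨1, by simp, by ring⟩, ?_⟩
  · refine this.trans ?_
    calc _ ≤ Γ * (η' * (‖y.1 - z.1‖ * Real.exp (M * α))) := by gcongr
      _ = _ := by rw [hη']; field_simp
  · have := hεε₀.trans ((min_le_right _ _).trans (min_le_left _ _))
    rwa [le_div_iff₀ (by positivity), mul_comm] at this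
  · rw [hε, mul_assoc, ← Real.exp_add, add_neg_cancel, Real.exp_zero, mul_one]

end Derivative

/-! ### Continuous differentiability up to the boundary. -/

section Regularity

variable {m : ℕ} {ι : Type*} [Fintype ι] {t0 : ℝ} {S : Set (Dom m)} {Q : Set (ι → ℝ)}
  {C : ι → Fin (m - 1) → Dom m × (ι → ℝ) → ℝ} {D : ι → Dom m × (ι → ℝ) → ℝ}
  {Cd : ι → Fin (m - 1) → Dom m × (ι → ℝ) → Dom m × (ι → ℝ) →L[ℝ] ℝ}
  {Dd : ι → Dom m × (ι → ℝ) → Dom m × (ι → ℝ) →L[ℝ] ℝ} {W : Set (Dom m × (ι → ℝ))}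
  {u : Dom m → ι → ℝ} {p : Dom m → ι × Fin (m - 1) → ℝ}

/-- The linear form with given spatial and time components. -/
def linearForm (P : Fin (m - 1) → ℝ) (τ : ℝ) : Dom m →L[ℝ] ℝ :=
  (∑ l, P l • (ContinuousLinearMap.proj (R := ℝ) (φ := fun _ : Fin (m - 1) => ℝ) l).comp
    (ContinuousLinearMap.fst ℝ (Fin (m - 1) → ℝ) ℝ)) +
    τ • ContinuousLinearMap.snd ℝ (Fin (m - 1) → ℝ) ℝ

theorem linearForm_apply (P : Fin (m - 1) → ℝ) (τ : ℝ) (v : Dom m) :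
    linearForm P τ v = ∑ l, P l * v.1 l + τ * v.2 := by
  simp [linearForm, sum_apply]

theorem contDiffOn_linearForm {X : Type*} [NormedAddCommGroup X] [NormedSpace ℝ X] {T : Set X}
    {r : WithTop ℕ∞} {P : X → Fin (m - 1) → ℝ} {τ : X → ℝ}
    (hP : ∀ l, ContDiffOn ℝ r (fun x => P x l) T) (hτ : ContDiffOn ℝ r τ T) :
    ContDiffOn ℝ r (fun x => linearForm (P x) (τ x)) T := by
  unfold linearForm
  exact (ContDiffOn.sum fun l _ => (hP l).smul contDiffOn_const).add (hτ.smul contDiffOn_const)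

theorem continuousOn_linearForm {X : Type*} [TopologicalSpace X] {T : Set X}
    {P : X → Fin (m - 1) → ℝ} {τ : X → ℝ} (hP : ∀ l, ContinuousOn (fun x => P x l) T)
    (hτ : ContinuousOn τ T) : ContinuousOn (fun x => linearForm (P x) (τ x)) T := by
  unfold linearForm
  exact (continuousOn_finsetSum _ fun l _ => (hP l).smul continuousOn_const).add
    (hτ.smul continuousOn_const)

/-- The pair estimate expands `w` only within a plane. At a point of total differentiability,
uniqueness of the derivative of the restriction to that plane identifies the spatial components. -/
theorem hasFDerivAt_apply_spatial {w : Dom m → ℝ} {P : Fin (m - 1) → ℝ} {z : Dom m}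
    (hz : z ∈ interior S)
    (h : ∀ η > 0, ∃ δ > 0, ∀ y ∈ S, y.2 = z.2 → ‖y.1 - z.1‖ ≤ δ →
      |w y - w z - ∑ l, P l * (y.1 l - z.1 l)| ≤ η * ‖y.1 - z.1‖)
    {A : Dom m →L[ℝ] ℝ} (hA : HasFDerivAt w A z) (l : Fin (m - 1)) : A (Pi.single l 1, 0) = P l := by
  have h1 : HasFDerivAt (fun x => w (x, z.2))
      (A.comp (ContinuousLinearMap.inl ℝ (Fin (m - 1) → ℝ) ℝ)) z.1 :=
    HasFDerivAt.comp z.1 (f := fun x => ((x, z.2) : Dom m)) hA (hasFDerivAt_prodMk_left z.1 z.2)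
  have h2 : HasFDerivAt (fun x => w (x, z.2))
      (∑ l, P l • ContinuousLinearMap.proj (R := ℝ) (φ := fun _ : Fin (m - 1) => ℝ) l) z.1 := by
    rw [hasFDerivAt_iff_isLittleO, Asymptotics.isLittleO_iff]
    intro η hη
    obtain ⟨δ, hδ, hδ'⟩ := h η hη
    have hc : ContinuousAt (fun x : Fin (m - 1) → ℝ => ((x, z.2) : Dom m)) z.1 := by fun_prop
    filter_upwards [hc (mem_interior_iff_mem_nhds.1 hz), Metric.closedBall_mem_nhds z.1 hδ]
      with x hx hxδ
    rw [mem_closedBall_iff_norm] at hxδ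
    have := hδ' (x, z.2) hx rfl hxδ
    simpa [sum_apply] using this
  have := DFunLike.congr_fun (h1.unique h2) (Pi.single l 1)
  simpa [sum_apply, Pi.single_apply] using this

/-- Solutions of systems with `C¹` data are `C¹`, and the spatial derivatives solve the derived
system. -/
theorem QuasilinearSolution.exists_derivative (hS : RegularDomain t0 S)
    (hu : QuasilinearSolution t0 S Q C D u) (hW : SmoothCoefficients (S ×ˢ Q) C D Cd Dd)
    {Jd : ι → (Fin (m - 1) → ℝ) → (Fin (m - 1) → ℝ) →L[ℝ] ℝ}
    (hJ : ∀ i, ∀ x ∈ {x | (x, t0) ∈ S},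
      HasFDerivWithinAt (fun x => u (x, t0) i) (Jd i x) {x | (x, t0) ∈ S} x)
    (hJc : ∀ i, ContinuousOn (Jd i) {x | (x, t0) ∈ S}) :
    ∃ p : Dom m → ι × Fin (m - 1) → ℝ, ContinuousOn p S ∧
      (∀ i l, Transported t0 S (fun z l => C i l (z, u z))
        (fun z => derivSource Cd Dd i l (z, u z) (p z)) fun z => p z (i, l)) ∧
      (∀ x, (x, t0) ∈ S → ∀ i l, p (x, t0) (i, l) = Jd i x (Pi.single l 1)) ∧
      ∀ i, ∀ z ∈ S, HasFDerivWithinAt (fun z => u z i) (linearForm (fun l => p z (i, l))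
        (D i (z, u z) - ∑ l, C i l (z, u z) * p z (i, l))) S z := by
  obtain ⟨L, hL⟩ := hu.lipschitz
  have hL0 : (0 : ℝ) ≤ L := L.2
  obtain ⟨Md, hMd0, hMC, hMD⟩ := hW.exists_bound
  have hgraph : MapsTo (fun z => ((z, u z) : Dom m × (ι → ℝ))) S (S ×ˢ Q) :=
    fun z hz => ⟨hz, hu.mapsTo hz⟩
  have hgc : ContinuousOn (fun z => ((z, u z) : Dom m × (ι → ℝ))) S :=
    continuousOn_id.prodMk hL.continuousOn
  have hcl : ∀ v : ι × Fin (m - 1) → ℝ, ‖fun j => clamp L (v j)‖ ≤ L := fun v =>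
    (pi_norm_le_iff_of_nonneg hL0).2 fun j => abs_clamp_le hL0 _
  obtain ⟨p, hp, hptr, hp0⟩ := exists_semilinear_solution (t0 := t0)
    (ι := ι × Fin (m - 1)) hS.isCompact
    (c := fun j z l => C j.1 l (z, u z)) (fun j => hu.charDomain j.1)
    (G := fun j z v => derivSource Cd Dd j.1 j.2 (z, u z) fun k => clamp L (v k))
    (K := Md * (1 + (m - 1 : ℕ) * (1 + 2 * L))) (fun j => by
      refine continuousOn_derivSource hW.contC hW.contD
        (hgc.comp continuousOn_fst fun q hq => hq.1) (fun q hq => hgraph hq.1) ?_ j.1 j.2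
      refine continuousOn_pi.2 fun k => (continuous_clamp L).comp_continuousOn ?_
      fun_prop) (fun j z hz v w => by
      refine (abs_derivSource_sub_le hL0 (fun l => hMC _ l _ (hgraph hz)) (hMD _ _ (hgraph hz))
        (hcl v) (hcl w)).trans ?_
      gcongr
      exact (pi_norm_le_iff_of_nonneg (norm_nonneg _)).2 fun k =>
        (abs_clamp_sub_clamp_le L (v k) (w k)).trans (norm_le_pi_norm (v - w) k))
    (J := fun j x => Jd j.1 x (Pi.single j.2 1))
    (fun j => (hJc j.1).clm_apply continuousOn_const)
  have hCc : ∀ i l, ContinuousOn (fun z => C i l (z, u z)) S := fun i l =>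
    ContinuousOn.comp (t := S ×ˢ Q) (fun w hw => (hW.hasC i l w hw).continuousWithinAt) hgc hgraph
  have hDc : ∀ i, ContinuousOn (fun z => D i (z, u z)) S := fun i =>
    ContinuousOn.comp (t := S ×ˢ Q) (fun w hw => (hW.hasD i w hw).continuousWithinAt) hgc hgraph
  have hpj : ∀ j, ContinuousOn (fun z => p z j) S := fun j => continuousOn_pi.1 hp j
  set A : ι → Dom m → Dom m →L[ℝ] ℝ := fun i z => linearForm (fun l => p z (i, l))
        (D i (z, u z) - ∑ l, C i l (z, u z) * p z (i, l)) with hA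
  have hAc : ∀ i, ContinuousOn (A i) S := fun i =>
    continuousOn_linearForm (fun l => hpj (i, l))
      ((hDc i).sub (continuousOn_finsetSum _ fun l _ => (hCc i l).mul (hpj (i, l))))
  obtain ⟨hpos, hneg⟩ := hS.exists_time
  -- At interior points of differentiability, which are almost all, the spatial part is `p` by the
  -- expansion and the time part follows from transport. Since `A i` is continuous, this extends to
  -- every point of `S`.
  have hAeq : ∀ i, ∀ z ∈ interior S, ∀ A' : Dom m →L[ℝ] ℝ, HasFDerivAt (fun z => u z i) A' z →
      A' = A i z := by
    intro i z hz A' hA'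
    have hzS := interior_subset hz
    have h1 : ∀ l, A' (Pi.single l 1, 0) = p z (i, l) := by
      refine hasFDerivAt_apply_spatial hz (fun η hη => ?_) hA'
      obtain ⟨δ, hδ, h⟩ := remainder_isLittleO hS hu hW hJ hJc hL hp
        (fun i l => hptr (i, l)) (fun x hx i l => hp0 x hx (i, l)) hz hη
      exact ⟨δ, hδ, fun y hy hyz hle => (norm_le_pi_norm _ i).trans (h y hy hyz hle)⟩
    obtain ⟨B, hB⟩ := (hu.charDomain i).exists_bound hS.isCompact
    have h2 := (hu.transported i).apply_fderivWithin hS.convex (hu.charDomain i) hB (hDc i)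
      hpos hneg hzS hA'.hasFDerivWithinAt
    rw [clm_apply_prod, one_mul] at h2
    simp only [h1] at h2
    ext v
    · simp only [ContinuousLinearMap.comp_apply, ContinuousLinearMap.inl_apply]
      rw [clm_apply_prod, hA]
      simp only [linearForm_apply, h1, zero_mul, mul_zero, add_zero]
      exact Finset.sum_congr rfl fun l _ => mul_comm _ _
    · simp only [ContinuousLinearMap.comp_apply, ContinuousLinearMap.inr_apply, hA,
        linearForm_apply, Pi.zero_apply, mul_zero, Finset.sum_const_zero, zero_add, mul_one]
      linarith
  have := isAddHaarMeasure_volume_prod (m - 1)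
  have hder : ∀ i, ∀ z ∈ S, HasFDerivWithinAt (fun z => u z i) (A i z) S z := by
    intro i z hz
    refine hasFDerivWithinAt_of_ae (μ := (volume : Measure (Dom m))) hS.convex hS.isCompact
      hS.interior_nonempty (K := L)
      (fun x hx y hy => (edist_le_pi_edist (u x) (u y) i).trans (hL hx hy)) (hAc i)
      (Eventually.of_forall (hAeq i)) hz
  -- Now `p` is a derivative of an `L`-Lipschitz function, so it is bounded by `L` in the interior
  -- and, by continuity, on `S`. The clamp is inactive and `p` solves the genuine derived system.
  have hbound : ∀ z ∈ S, ∀ j, |p z j| ≤ L := by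
    rintro z hz ⟨i, l⟩
    have hcl : z ∈ closure (interior S) := by
      rw [hS.convex.closure_interior_eq_closure_of_nonempty_interior hS.interior_nonempty]
      exact subset_closure hz
    refine ContinuousWithinAt.closure_le hcl (f := fun z => |p z (i, l)|)
      ((hpj (i, l)).abs z hz |>.mono interior_subset) continuousWithinAt_const fun y hy => ?_
    have hyS := mem_interior_iff_mem_nhds.1 hy
    have h1 := (hder i y (interior_subset hy)).hasFDerivAt hyS
    have h2 := h1.le_of_lipschitzOn hyS (C := L)
      (fun x hx y hy => (edist_le_pi_edist (u x) (u y) i).trans (hL hx hy))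
    have h3 := abs_apply_le h2 (v := ((Pi.single l 1, 0) : Dom m)) (N := 1) (by
      rw [Prod.norm_def]
      simp [Pi.norm_single])
    simpa [hA, linearForm_apply, Pi.single_apply] using h3
  refine ⟨p, hp, fun i l z hz Y hY σ hσ => ?_, fun x hx i l => hp0 x hx (i, l), hder⟩
  have h1 := hptr (i, l) z hz Y hY σ hσ
  have hmem := (hu.charDomain i).mem z hz Y hY σ hσ
  have h2 : (fun j => clamp L (p (pt t0 z Y σ) j)) = p (pt t0 z Y σ) :=
    funext fun j => clamp_eq_self (hbound _ hmem j)
  simp only [h2] at h1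
  exact h1

end Regularity

/-! ### Induction on the order of differentiability. -/

section HigherRegularity

variable {m : ℕ} {t0 : ℝ} {S : Set (Dom m)}

theorem contDiffOn_derivSource {ι : Type*} [Fintype ι] {X : Type*} [NormedAddCommGroup X]
    [NormedSpace ℝ X] {T : Set X} {r : WithTop ℕ∞}
    {Cd : ι → Fin (m - 1) → Dom m × (ι → ℝ) → Dom m × (ι → ℝ) →L[ℝ] ℝ}
    {Dd : ι → Dom m × (ι → ℝ) → Dom m × (ι → ℝ) →L[ℝ] ℝ} {W : Set (Dom m × (ι → ℝ))}
    (hC : ∀ i l, ContDiffOn ℝ r (Cd i l) W) (hD : ∀ i, ContDiffOn ℝ r (Dd i) W)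
    {w : X → Dom m × (ι → ℝ)} (hw : ContDiffOn ℝ r w T) (hwW : MapsTo w T W)
    {q : X → ι × Fin (m - 1) → ℝ} (hq : ContDiffOn ℝ r q T) (i : ι) (l : Fin (m - 1)) :
    ContDiffOn ℝ r (fun x => derivSource Cd Dd i l (w x) (q x)) T := by
  have hqj : ∀ j, ContDiffOn ℝ r (fun x => q x j) T := fun j => contDiffOn_pi.1 hq j
  have hv : ContDiffOn ℝ r (fun x => (((Pi.single l 1, 0), fun s => q x (s, l)) :
      Dom m × (ι → ℝ))) T :=
    contDiffOn_const.prodMk (contDiffOn_pi.2 fun s => hqj (s, l))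
  refine (((hD i).comp hw hwW).clm_apply hv).sub ?_
  exact ContDiffOn.sum fun k _ => (hqj (i, k)).mul (((hC i k).comp hw hwW).clm_apply hv)

/-- Lipschitz solutions with `C^r` data are `C^r`. -/
theorem QuasilinearSolution.contDiffOn (hS : RegularDomain t0 S) (r : ℕ) :
    ∀ (ι : Type) [Fintype ι] (Q : Set (ι → ℝ)) (C : ι → Fin (m - 1) → Dom m × (ι → ℝ) → ℝ)
      (D : ι → Dom m × (ι → ℝ) → ℝ) (u : Dom m → ι → ℝ), Convex ℝ Q → IsCompact Q →
      (interior Q).Nonempty → QuasilinearSolution t0 S Q C D u →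
      (∀ i l, ContDiffOn ℝ r (C i l) (S ×ˢ Q)) → (∀ i, ContDiffOn ℝ r (D i) (S ×ˢ Q)) →
      ContDiffOn ℝ r (fun x => u (x, t0)) {x | (x, t0) ∈ S} → ContDiffOn ℝ r u S := by
  have hSu : UniqueDiffOn ℝ S := uniqueDiffOn_convex hS.convex hS.interior_nonempty
  have hVu : UniqueDiffOn ℝ {x | (x, t0) ∈ S} :=
    uniqueDiffOn_convex hS.convex_slice hS.interior_slice_nonempty
  -- The index type and the coefficients are quantified inside the induction, since the hypothesis
  -- is applied to an enlarged system.
  induction r with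
  | zero =>
    intro ι _ Q C D u _ _ _ hu _ _ _
    obtain ⟨K, hK⟩ := hu.lipschitz
    exact contDiffOn_zero.2 hK.continuousOn
  | succ r ih =>
    intro ι _ Q C D u hQ hQc hQi hu hC hD hI
    have hr1 : ((r + 1 : ℕ) : WithTop ℕ∞) = (r : WithTop ℕ∞) + 1 := by norm_cast
    have hrle : (r : WithTop ℕ∞) ≤ ((r + 1 : ℕ) : WithTop ℕ∞) := by exact_mod_cast r.le_succ
    have hne : ((r + 1 : ℕ) : WithTop ℕ∞) ≠ 0 := by exact_mod_cast r.succ_ne_zero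
    have hur : ContDiffOn ℝ r u S := ih ι Q C D u hQ hQc hQi hu (fun i l => (hC i l).of_le hrle)
      (fun i => (hD i).of_le hrle) (hI.of_le hrle)
    have hWu : UniqueDiffOn ℝ (S ×ˢ Q) := hSu.prod (uniqueDiffOn_convex hQ hQi)
    set Cd : ι → Fin (m - 1) → Dom m × (ι → ℝ) → Dom m × (ι → ℝ) →L[ℝ] ℝ :=
      fun i l => fderivWithin ℝ (C i l) (S ×ˢ Q) with hCd
    set Dd : ι → Dom m × (ι → ℝ) → Dom m × (ι → ℝ) →L[ℝ] ℝ :=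
      fun i => fderivWithin ℝ (D i) (S ×ˢ Q) with hDd
    have hCdr : ∀ i l, ContDiffOn ℝ r (Cd i l) (S ×ˢ Q) := fun i l =>
      (hC i l).fderivWithin hWu hr1.ge
    have hDdr : ∀ i, ContDiffOn ℝ r (Dd i) (S ×ˢ Q) := fun i => (hD i).fderivWithin hWu hr1.ge
    have hW : SmoothCoefficients (S ×ˢ Q) C D Cd Dd :=
      { convex := hS.convex.prod hQ
        isCompact := hS.isCompact.prod hQc
        hasC := fun i l w hw => ((hC i l).differentiableOn hne w hw).hasFDerivWithinAt
        contC := fun i l => (hCdr i l).continuousOn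
        hasD := fun i w hw => ((hD i).differentiableOn hne w hw).hasFDerivWithinAt
        contD := fun i => (hDdr i).continuousOn }
    have hIi : ∀ i, ContDiffOn ℝ (r + 1 : ℕ) (fun x => u (x, t0) i) {x | (x, t0) ∈ S} := fun i =>
      contDiffOn_pi.1 hI i
    have hJr : ∀ i, ContDiffOn ℝ r
        (fderivWithin ℝ (fun x => u (x, t0) i) {x | (x, t0) ∈ S}) {x | (x, t0) ∈ S} := fun i =>
      (hIi i).fderivWithin hVu hr1.ge
    obtain ⟨p, hp, hptr, hp0, hder⟩ := hu.exists_derivative hS hW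
      (Jd := fun i => fderivWithin ℝ (fun x => u (x, t0) i) {x | (x, t0) ∈ S})
      (fun i x hx => ((hIi i).differentiableOn hne x hx).hasFDerivWithinAt)
      (fun i => (hJr i).continuousOn)
    have hpr : ContDiffOn ℝ r p S := by
      -- For `r = 0` continuity of `p` is all that is needed. For `r ≥ 1` the enlarged system has at
      -- least `C¹` data, which makes its solution Lipschitz, as the induction hypothesis demands.
      rcases Nat.eq_zero_or_pos r with hr0 | hrpos
      · subst hr0
        exact contDiffOn_zero.2 hp
      have hrne : (r : WithTop ℕ∞) ≠ 0 := by exact_mod_cast hrpos.ne'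
      -- The index `none` carries `u i`, the index `some l` its derivative in direction `l`. All
      -- components with the same `i` move along the characteristics of the `i`-th equation, so the
      -- system keeps its form.
      set w : Dom m → ι × Option (Fin (m - 1)) → ℝ :=
        fun z j => j.2.elim (u z j.1) fun l => p z (j.1, l) with hw
      have hwc : ContinuousOn w S := by
        refine continuousOn_pi.2 fun j => ?_
        obtain ⟨i, _ | l⟩ := j
        · exact continuousOn_pi.1 hur.continuousOn i
        · exact continuousOn_pi.1 hp (i, l)
      obtain ⟨R₀, hR₀⟩ := hS.isCompact.exists_bound_of_continuousOn hwc
      obtain ⟨y₀, hy₀⟩ := hQi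
      -- Large enough to contain the values of `w`, and to keep `y₀`, completed by zero derivatives,
      -- in the interior of the new value set.
      set R : ℝ := max R₀ (‖y₀‖ + 1) with hR
      set E : (ι × Option (Fin (m - 1)) → ℝ) →L[ℝ] (ι → ℝ) :=
        ContinuousLinearMap.pi fun s => ContinuousLinearMap.proj (s, none) with hE
      set Q' : Set (ι × Option (Fin (m - 1)) → ℝ) := E ⁻¹' Q ∩ Metric.closedBall 0 R with hQ'
      have hQ'conv : Convex ℝ Q' :=
        (hQ.linear_preimage E.toLinearMap).inter (convex_closedBall _ _)
      have hQ'c : IsCompact Q' :=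
        (isCompact_closedBall _ _).inter_left (hQc.isClosed.preimage E.continuous)
      have hQ'i : (interior Q').Nonempty := by
        refine ⟨fun j => j.2.elim (y₀ j.1) fun _ => 0, mem_interior_iff_mem_nhds.2
          (inter_mem ?_ ?_)⟩
        · exact E.continuous.continuousAt (mem_interior_iff_mem_nhds.1 hy₀)
        · refine Metric.closedBall_mem_nhds_of_mem ?_
          rw [mem_ball_zero_iff]
          refine (pi_norm_lt_iff (by positivity)).2 fun j => ?_
          obtain ⟨i, _ | l⟩ := j
          · exact ((norm_le_pi_norm y₀ i).trans_lt (lt_add_one _)).trans_le (le_max_right _ _)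
          · simp only [Option.elim_some, norm_zero]
            positivity
      set Pr : Dom m × (ι × Option (Fin (m - 1)) → ℝ) → Dom m × (ι → ℝ) :=
        fun q => (q.1, E q.2) with hPr
      have hPrc : ∀ n : WithTop ℕ∞, ContDiff ℝ n Pr := fun n =>
        contDiff_fst.prodMk (E.contDiff.comp contDiff_snd)
      have hPrm : MapsTo Pr (S ×ˢ Q') (S ×ˢ Q) := fun q hq => ⟨hq.1, hq.2.1⟩
      have hwQ : MapsTo w S Q' := fun z hz =>
        ⟨hu.mapsTo hz, mem_closedBall_zero_iff.2 ((hR₀ z hz).trans (le_max_left _ _))⟩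
      set D' : ι × Option (Fin (m - 1)) → Dom m × (ι × Option (Fin (m - 1)) → ℝ) → ℝ :=
        fun j q => j.2.elim (D j.1 (Pr q)) fun l =>
          derivSource Cd Dd j.1 l (Pr q) fun k => q.2 (k.1, some k.2) with hD'
      have hD'r : ∀ j, ContDiffOn ℝ r (D' j) (S ×ˢ Q') := by
        rintro ⟨i, _ | l⟩
        · exact ((hD i).of_le hrle).comp (hPrc r).contDiffOn hPrm
        · refine contDiffOn_derivSource (q := fun q k => q.2 (k.1, some k.2)) hCdr hDdr
            (hPrc r).contDiffOn hPrm ?_ i l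
          exact contDiffOn_pi.2 fun k => (by fun_prop : ContDiff ℝ r
            fun q : Dom m × (ι × Option (Fin (m - 1)) → ℝ) => q.2 (k.1, some k.2)).contDiffOn
      have hwI : ContDiffOn ℝ r (fun x => w (x, t0)) {x | (x, t0) ∈ S} := by
        refine contDiffOn_pi.2 fun j => ?_
        obtain ⟨i, _ | l⟩ := j
        · exact (hIi i).of_le hrle
        · exact ((hJr i).clm_apply (contDiffOn_const (c := Pi.single l 1))).congr
            fun x hx => hp0 x hx i l
      have htr : ∀ j : ι × Option (Fin (m - 1)),
          Transported t0 S (fun z l => C j.1 l (z, u z)) (fun z => D' j (z, w z))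
            (fun z => w z j) := by
        rintro ⟨i, _ | l⟩
        · exact hu.transported i
        · exact hptr i l
      have hwsol : QuasilinearSolution t0 S Q' (fun j l q => C j.1 l (Pr q)) D' w :=
        { mapsTo := hwQ
          lipschitz := exists_lipschitzOnWith_of_transported hS.isCompact
            (fun j => hu.charDomain j.1) hwQ hwc
            (fun j => (hD'r j).exists_lipschitzOnWith hrne (hS.convex.prod hQ'conv)
              (hS.isCompact.prod hQ'c)) htr
            (hwI.exists_lipschitzOnWith hrne hS.convex_slice hS.isCompact_slice)
          charDomain := fun j => hu.charDomain j.1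
          transported := htr }
      have := ih _ Q' _ D' w hQ'conv hQ'c hQ'i hwsol
        (fun j l => ((hC j.1 l).of_le hrle).comp (hPrc r).contDiffOn hPrm) hD'r hwI
      exact contDiffOn_pi.2 fun j => contDiffOn_pi.1 this (j.1, some j.2)
    have hgr : ContDiffOn ℝ r (fun z => ((z, u z) : Dom m × (ι → ℝ))) S :=
      contDiffOn_id.prodMk hur
    have hgm : MapsTo (fun z => ((z, u z) : Dom m × (ι → ℝ))) S (S ×ˢ Q) :=
      fun z hz => ⟨hz, hu.mapsTo hz⟩
    have hpj : ∀ j, ContDiffOn ℝ r (fun z => p z j) S := fun j => contDiffOn_pi.1 hpr j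
    refine contDiffOn_pi.2 fun i => ?_
    rw [hr1, contDiffOn_succ_iff_fderivWithin hSu]
    refine ⟨fun z hz => (hder i z hz).differentiableWithinAt, fun h => ?_, ?_⟩
    · exact absurd h (by simp)
    · have hτ : ContDiffOn ℝ r (fun z => D i (z, u z) - ∑ l, C i l (z, u z) * p z (i, l)) S :=
        (((hD i).of_le hrle).comp hgr hgm).sub (ContDiffOn.sum fun l _ =>
          (((hC i l).of_le hrle).comp hgr hgm).mul (hpj (i, l)))
      refine (contDiffOn_linearForm (fun l => hpj (i, l)) hτ).congr fun z hz => ?_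
      exact (hder i z hz).fderivWithin (hSu z hz)

end HigherRegularity

/-! ### One coordinate of the standard domain. -/

section ConeSlice

/-- The range of a coordinate at time `t` in the standard domain. -/
def coneSlice (a abar lo up t ξ : ℝ) : Prop :=
  |ξ| ≤ a ∧ -abar + up * t ≤ ξ ∧ -abar + lo * t ≤ ξ ∧ ξ ≤ abar + lo * t ∧ ξ ≤ abar + up * t

variable {a abar lo up t ξ ξ' t' d σ : ℝ}

theorem coneSlice_of_nonneg (hlu : lo ≤ up) (ht : 0 ≤ t) :
    coneSlice a abar lo up t ξ ↔ |ξ| ≤ a ∧ -abar + up * t ≤ ξ ∧ ξ ≤ abar + lo * t := by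
  have := mul_le_mul_of_nonneg_right hlu ht
  unfold coneSlice
  constructor
  · rintro ⟨h1, h2, h3, h4, h5⟩
    exact ⟨h1, h2, h4⟩
  · rintro ⟨h1, h2, h3⟩
    exact ⟨h1, h2, by linarith, h3, by linarith⟩

theorem coneSlice_of_nonpos (hlu : lo ≤ up) (ht : t ≤ 0) :
    coneSlice a abar lo up t ξ ↔ |ξ| ≤ a ∧ -abar + lo * t ≤ ξ ∧ ξ ≤ abar + up * t := by
  have := mul_le_mul_of_nonpos_right hlu ht
  unfold coneSlice
  constructor
  · rintro ⟨h1, h2, h3, h4, h5⟩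
    exact ⟨h1, h3, h5⟩
  · rintro ⟨h1, h2, h3⟩
    exact ⟨h1, by linarith, h2, by linarith, h3⟩

theorem coneSlice.combo (h : coneSlice a abar lo up t ξ) (h' : coneSlice a abar lo up t' ξ')
    {r s : ℝ} (hr : 0 ≤ r) (hs : 0 ≤ s) (hrs : r + s = 1) :
    coneSlice a abar lo up (r * t + s * t') (r * ξ + s * ξ') := by
  obtain ⟨h1, h2, h3, h4, h5⟩ := h
  obtain ⟨h1', h2', h3', h4', h5'⟩ := h'
  rw [abs_le] at h1 h1'
  obtain rfl : s = 1 - r := by linarith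
  refine ⟨abs_le.2 ⟨?_, ?_⟩, ?_, ?_, ?_, ?_⟩
  · linarith [mul_le_mul_of_nonneg_left h1.1 hr, mul_le_mul_of_nonneg_left h1'.1 hs]
  · linarith [mul_le_mul_of_nonneg_left h1.2 hr, mul_le_mul_of_nonneg_left h1'.2 hs]
  · linarith [mul_le_mul_of_nonneg_left h2 hr, mul_le_mul_of_nonneg_left h2' hs]
  · linarith [mul_le_mul_of_nonneg_left h3 hr, mul_le_mul_of_nonneg_left h3' hs]
  · linarith [mul_le_mul_of_nonneg_left h4 hr, mul_le_mul_of_nonneg_left h4' hs]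
  · linarith [mul_le_mul_of_nonneg_left h5 hr, mul_le_mul_of_nonneg_left h5' hs]

/-- Moving towards time `0` with a velocity between `lo` and `up` stays in the cone. -/
theorem coneSlice.trace (h : coneSlice a abar lo up t ξ) (ha : abar ≤ a) (hlu : lo ≤ up)
    (hσ : σ ∈ Icc (0 : ℝ) 1)
    (hd : 0 ≤ t → (1 - σ) * t * lo ≤ d ∧ d ≤ (1 - σ) * t * up)
    (hd' : t ≤ 0 → (1 - σ) * t * up ≤ d ∧ d ≤ (1 - σ) * t * lo) :
    coneSlice a abar lo up (σ * t) (ξ - d) := by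
  have hσ1 : 0 ≤ 1 - σ := by linarith [hσ.2]
  rcases le_total 0 t with ht | ht
  · obtain ⟨d1, d2⟩ := hd ht
    rw [coneSlice_of_nonneg hlu ht, abs_le] at h
    obtain ⟨⟨h1, h1'⟩, h2, h3⟩ := h
    have hσt : 0 ≤ σ * t := mul_nonneg hσ.1 ht
    have hσt' : 0 ≤ (1 - σ) * t := mul_nonneg hσ1 ht
    rw [coneSlice_of_nonneg hlu hσt, abs_le]
    refine ⟨⟨?_, ?_⟩, by linarith, by linarith⟩
    -- The bound by `a` must be checked besides the slanted sides. If `up ≥ 0`, the left slanted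
    -- side lies to the right of `-abar`; otherwise the backward motion is to the right and the
    -- bound at `ξ` persists.
    · rcases le_total 0 up with hu | hu
      · linarith [mul_nonneg hu hσt]
      · linarith [mul_nonpos_of_nonneg_of_nonpos hσt' hu]
    · rcases le_total 0 lo with hu | hu
      · linarith [mul_nonneg hσt' hu]
      · linarith [mul_nonpos_of_nonneg_of_nonpos hσt hu]
  · obtain ⟨d1, d2⟩ := hd' ht
    rw [coneSlice_of_nonpos hlu ht, abs_le] at h
    obtain ⟨⟨h1, h1'⟩, h2, h3⟩ := h
    have hσt : σ * t ≤ 0 := mul_nonpos_of_nonneg_of_nonpos hσ.1 ht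
    have hσt' : (1 - σ) * t ≤ 0 := mul_nonpos_of_nonneg_of_nonpos hσ1 ht
    rw [coneSlice_of_nonpos hlu hσt, abs_le]
    refine ⟨⟨?_, ?_⟩, by linarith, by linarith⟩
    · rcases le_total 0 lo with hu | hu
      · linarith [mul_nonpos_of_nonneg_of_nonpos hu hσt']
      · linarith [mul_nonneg_of_nonpos_of_nonpos hu hσt]
    · rcases le_total 0 up with hu | hu
      · linarith [mul_nonpos_of_nonneg_of_nonpos hu hσt]
      · linarith [mul_nonneg_of_nonpos_of_nonpos hu hσt']

end ConeSlice

/-! ### Boxes and a uniform description of the standard domain. -/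

namespace Problem

variable {m n : ℕ} {p : Problem m n} {c : Constants m} {α : ℝ}

theorem mem_P1_iff (ha : 0 ≤ p.a) {z : Dom m} :
    z ∈ p.P1 ↔ (∀ l, |z.1 l - p.x0.1 l| ≤ p.a) ∧ |z.2 - p.x0.2| ≤ p.a := by
  rw [P1, mem_ofPred_eq, Prod.norm_def, max_le_iff, pi_norm_le_iff_of_nonneg ha]
  rfl

theorem mem_P2_iff (hb : 0 ≤ p.b) {y : Cod n} : y ∈ p.P2 ↔ ∀ i, |y i - p.y0 i| ≤ p.b := by
  rw [P2, mem_ofPred_eq, pi_norm_le_iff_of_nonneg hb]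
  rfl

theorem P1_eq_closedBall : p.P1 = Metric.closedBall p.x0 p.a := by
  ext z
  rw [mem_closedBall_iff_norm]
  rfl

theorem P2_eq_closedBall : p.P2 = Metric.closedBall p.y0 p.b := by
  ext z
  rw [mem_closedBall_iff_norm]
  rfl

theorem isCompact_P1 : IsCompact p.P1 := P1_eq_closedBall (p := p) ▸ isCompact_closedBall _ _

theorem isCompact_P2 : IsCompact p.P2 := P2_eq_closedBall (p := p) ▸ isCompact_closedBall _ _

theorem convex_P1 : Convex ℝ p.P1 := P1_eq_closedBall (p := p) ▸ convex_closedBall _ _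

theorem convex_P2 : Convex ℝ p.P2 := P2_eq_closedBall (p := p) ▸ convex_closedBall _ _

/-- On either side of the plane two of the four slanted inequalities imply the others because `lowC
≤ uppC`. Imposing all four everywhere shows the union of the two halves to be a single polyhedron,
constrained coordinate by coordinate. -/
theorem mem_S_iff (ha : 0 ≤ p.a) (hα0 : 0 ≤ α) (hα : α ≤ p.a) (hlu : ∀ l, c.lowC l ≤ c.uppC l)
    {z : Dom m} : z ∈ p.S c α ↔ |z.2 - p.x0.2| ≤ α ∧
      ∀ l, coneSlice p.a p.abar (c.lowC l) (c.uppC l) (z.2 - p.x0.2) (z.1 l - p.x0.1 l) := by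
  constructor
  · rintro (⟨h1, h2, h3, h4⟩ | ⟨h1, h2, h3, h4⟩)
    · exact ⟨abs_le.2 ⟨by linarith, h3⟩, fun l => (coneSlice_of_nonneg (hlu l) h2).2
        ⟨((mem_P1_iff ha).1 h1).1 l, h4 l⟩⟩
    · exact ⟨abs_le.2 ⟨h2, by linarith⟩, fun l => (coneSlice_of_nonpos (hlu l) h3).2
        ⟨((mem_P1_iff ha).1 h1).1 l, h4 l⟩⟩
  · rintro ⟨h1, h2⟩
    have hP : z ∈ p.P1 := (mem_P1_iff ha).2 ⟨fun l => (h2 l).1, h1.trans hα⟩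
    rw [abs_le] at h1
    rcases le_total 0 (z.2 - p.x0.2) with ht | ht
    · exact Or.inl ⟨hP, ht, h1.2, fun l => ((coneSlice_of_nonneg (hlu l) ht).1 (h2 l)).2⟩
    · exact Or.inr ⟨hP, h1.1, ht, fun l => ((coneSlice_of_nonpos (hlu l) ht).1 (h2 l)).2⟩

theorem S_subset_P1 : p.S c α ⊆ p.P1 := by
  rintro z (h | h) <;> exact h.1

/-- The hypotheses on the box, and on the range of the velocities. -/
structure Standard (p : Problem m n) (c : Constants m) (α : ℝ) : Prop where
  abar_pos : 0 < p.abar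
  abar_le : p.abar ≤ p.a
  pos : 0 < α
  le_a : α ≤ p.a
  low_le_upp : ∀ l, c.lowC l ≤ c.uppC l

namespace Standard

theorem a_nonneg (h : p.Standard c α) : 0 ≤ p.a := h.abar_pos.le.trans h.abar_le

theorem mem_S (h : p.Standard c α) {z : Dom m} : z ∈ p.S c α ↔ |z.2 - p.x0.2| ≤ α ∧
    ∀ l, coneSlice p.a p.abar (c.lowC l) (c.uppC l) (z.2 - p.x0.2) (z.1 l - p.x0.1 l) :=
  mem_S_iff h.a_nonneg h.pos.le h.le_a h.low_le_upp

end Standard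

end Problem

/-- Subtracting the mean slope `(A + B) / 2` turns the two one-sided bounds into one bound for an
absolute value. -/
theorem mul_le_sub_of_deriv_mem {f f' : ℝ → ℝ} {A B : ℝ}
    (hf : ∀ σ ∈ Icc (0 : ℝ) 1, HasDerivWithinAt f (f' σ) (Icc 0 1) σ)
    (hA : ∀ σ ∈ Icc (0 : ℝ) 1, A ≤ f' σ) (hB : ∀ σ ∈ Icc (0 : ℝ) 1, f' σ ≤ B) {σ : ℝ}
    (hσ : σ ∈ Icc (0 : ℝ) 1) : (1 - σ) * A ≤ f 1 - f σ ∧ f 1 - f σ ≤ (1 - σ) * B := by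
  have h := norm_sub_le_of_norm_deriv_le (f := fun s => f s - s * ((A + B) / 2))
    (f' := fun s => f' s - (A + B) / 2) (B := (B - A) / 2)
    (fun s hs => ((hf s hs).sub ((hasDerivWithinAt_id s _).mul_const _)).congr_deriv (by simp))
    (fun s hs => ?_) hσ (σ := 1) (by simp)
  · rw [Real.norm_eq_abs, abs_of_nonneg (by linarith [hσ.2] : 0 ≤ 1 - σ), abs_le] at h
    constructor <;> linarith [h.1, h.2]
  · rw [Real.norm_eq_abs, abs_le]
    constructor <;> linarith [hA s hs, hB s hs]

/-! ### The standard domain is regular and contains its characteristics. -/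

namespace Problem.Standard

variable {m n : ℕ} {p : Problem m n} {c : Constants m} {α : ℝ}

theorem convex_S (h : p.Standard c α) : Convex ℝ (p.S c α) := by
  intro x hx y hy r s hr hs hrs
  rw [h.mem_S] at hx hy ⊢
  obtain rfl : s = 1 - r := by linarith
  have e2 : (r • x + (1 - r) • y).2 - p.x0.2 = r * (x.2 - p.x0.2) + (1 - r) * (y.2 - p.x0.2) := by
    simp; ring
  refine ⟨?_, fun l => ?_⟩
  · rw [e2]
    have hx1 := abs_le.1 hx.1
    have hy1 := abs_le.1 hy.1
    rw [abs_le]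
    constructor
    · linarith [mul_le_mul_of_nonneg_left hx1.1 hr, mul_le_mul_of_nonneg_left hy1.1 hs]
    · linarith [mul_le_mul_of_nonneg_left hx1.2 hr, mul_le_mul_of_nonneg_left hy1.2 hs]
  · have e1 : (r • x + (1 - r) • y).1 l - p.x0.1 l =
        r * (x.1 l - p.x0.1 l) + (1 - r) * (y.1 l - p.x0.1 l) := by
      simp; ring
    rw [e1, e2]
    exact (hx.2 l).combo (hy.2 l) hr hs hrs

theorem isCompact_S (h : p.Standard c α) : IsCompact (p.S c α) := by
  have hcl : IsClosed (p.S c α) := by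
    have e : p.S c α = {z : Dom m | |z.2 - p.x0.2| ≤ α} ∩ ⋂ l, {z : Dom m |
        coneSlice p.a p.abar (c.lowC l) (c.uppC l) (z.2 - p.x0.2) (z.1 l - p.x0.1 l)} := by
      ext z
      rw [h.mem_S, mem_inter_iff, mem_iInter]
      rfl
    rw [e]
    refine (isClosed_le (f := fun z : Dom m => |z.2 - p.x0.2|) (by fun_prop)
      continuous_const).inter (isClosed_iInter fun l => ?_)
    have c2 : Continuous fun z : Dom m => z.2 - p.x0.2 := by fun_prop
    have c1 : Continuous fun z : Dom m => z.1 l - p.x0.1 l := by fun_prop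
    exact (isClosed_le c1.abs continuous_const).inter <|
      (isClosed_le (continuous_const.add (continuous_const.mul c2)) c1).inter <|
      (isClosed_le (continuous_const.add (continuous_const.mul c2)) c1).inter <|
      (isClosed_le c1 (continuous_const.add (continuous_const.mul c2))).inter <|
      isClosed_le c1 (continuous_const.add (continuous_const.mul c2))
  exact isCompact_P1.of_isClosed_subset hcl S_subset_P1

/-- On `Vint` the time offset is zero, and all inequalities that describe `S` are strict, except
possibly `|ξ| ≤ a`, which is strict as well since `|ξ| < abar ≤ a`; strictness persists nearby. -/
theorem S_mem_nhds (h : p.Standard c α) {v : Dom m} (hv : v ∈ p.Vint) : p.S c α ∈ 𝓝 v := by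
  obtain ⟨-, hv2, hvl⟩ := hv
  have hlt := fun l => abs_lt.1 (hvl l)
  have c2 : ContinuousAt (fun z : Dom m => z.2 - p.x0.2) v := by fun_prop
  have c1 : ∀ l, ContinuousAt (fun z : Dom m => z.1 l - p.x0.1 l) v := fun l => by fun_prop
  have e0 : ∀ᶠ z in 𝓝 v, |z.2 - p.x0.2| < α :=
    c2.abs.eventually_lt_const (by simpa [hv2] using h.pos)
  have e1 : ∀ᶠ z in 𝓝 v, ∀ l,
      coneSlice p.a p.abar (c.lowC l) (c.uppC l) (z.2 - p.x0.2) (z.1 l - p.x0.1 l) := by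
    refine eventually_all.2 fun l => ?_
    have f1 := (c1 l).abs.eventually_lt_const ((hvl l).trans_le h.abar_le)
    have f2 := (c2.const_mul (c.uppC l) |>.const_add (-p.abar)).eventually_lt (c1 l)
      (by simpa [hv2] using (hlt l).1)
    have f3 := (c2.const_mul (c.lowC l) |>.const_add (-p.abar)).eventually_lt (c1 l)
      (by simpa [hv2] using (hlt l).1)
    have f4 := (c1 l).eventually_lt (c2.const_mul (c.lowC l) |>.const_add p.abar)
      (by simpa [hv2] using (hlt l).2)
    have f5 := (c1 l).eventually_lt (c2.const_mul (c.uppC l) |>.const_add p.abar)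
      (by simpa [hv2] using (hlt l).2)
    filter_upwards [f1, f2, f3, f4, f5] with z g1 g2 g3 g4 g5
    exact ⟨g1.le, g2.le, g3.le, g4.le, g5.le⟩
  filter_upwards [e0, e1] with z h0 h1
  exact h.mem_S.2 ⟨h0.le, h1⟩

theorem x0_mem_Vint (h : p.Standard c α) : p.x0 ∈ p.Vint :=
  ⟨(mem_P1_iff h.a_nonneg).2 ⟨fun l => by simpa using h.a_nonneg,
    by simpa using h.a_nonneg⟩, rfl, fun l => by simpa using h.abar_pos⟩

theorem regularDomain (h : p.Standard c α) : RegularDomain p.x0.2 (p.S c α) where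
  convex := h.convex_S
  isCompact := h.isCompact_S
  mix := by
    intro x y t l hx hy
    rw [h.mem_S] at hx hy ⊢
    refine ⟨hx.1, fun k => ?_⟩
    by_cases hk : k = l
    · subst hk
      simpa using hy.2 k
    · simpa [Function.update_of_ne hk] using hx.2 k
  center := ⟨p.x0.1, mem_interior_iff_mem_nhds.2 (h.S_mem_nhds h.x0_mem_Vint)⟩

theorem mem_V_of_mem_S (h : p.Standard c α) {x : Fin (m - 1) → ℝ} (hx : (x, p.x0.2) ∈ p.S c α) :
    (x, p.x0.2) ∈ p.V := by
  refine ⟨S_subset_P1 hx, rfl, fun l => ?_⟩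
  obtain ⟨-, -, h3, h4, -⟩ := (h.mem_S.1 hx).2 l
  simp only [sub_self, mul_zero, add_zero] at h3 h4
  exact abs_le.2 ⟨h3, h4⟩

theorem V_subset_S (h : p.Standard c α) : p.V ⊆ p.S c α := by
  rintro x ⟨-, h2, h3⟩
  rw [h.mem_S, h2, sub_self]
  refine ⟨by simpa using h.pos.le, fun l => ?_⟩
  have := abs_le.1 (h3 l)
  refine ⟨(h3 l).trans h.abar_le, ?_⟩
  simp only [mul_zero, add_zero]
  exact ⟨this.1, this.1, this.2, this.2⟩

theorem isLocalDomain_S (h : p.Standard c α) : p.IsLocalDomain (p.S c α) :=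
  ⟨h.V_subset_S, S_subset_P1, interior (p.S c α), isOpen_interior,
    fun _ hv => mem_interior_iff_mem_nhds.2 (h.S_mem_nhds hv), interior_subset⟩

theorem uniqueDiffOn_S (h : p.Standard c α) : UniqueDiffOn ℝ (p.S c α) :=
  uniqueDiffOn_convex h.convex_S h.regularDomain.interior_nonempty

theorem S_subset_slab (h : p.Standard c α) : p.S c α ⊆ slab (Fin (m - 1) → ℝ) p.x0.2 α :=
  fun _ hz => (h.mem_S.1 hz).1

/-- Characteristics with velocities in the prescribed range do not leave the standard domain. -/
theorem pt_mem_S (h : p.Standard c α) {v : Dom m → Fin (m - 1) → ℝ}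
    (hlow : ∀ z l, c.lowC l ≤ v z l) (hupp : ∀ z l, v z l ≤ c.uppC l) {z : Dom m}
    (hz : z ∈ p.S c α) {Y : ℝ → Fin (m - 1) → ℝ} (hY : IsChar p.x0.2 v z Y) {σ : ℝ}
    (hσ : σ ∈ Icc (0 : ℝ) 1) : pt p.x0.2 z Y σ ∈ p.S c α := by
  obtain ⟨hzt, hzl⟩ := h.mem_S.1 hz
  refine h.mem_S.2 ⟨?_, fun l => ?_⟩
  · rw [abs_pt_snd_sub hσ]
    exact (mul_le_of_le_one_left (abs_nonneg _) hσ.2).trans hzt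
  have hder := fun s hs => hasDerivWithinAt_pi.1 (hY.deriv s hs) l
  have := (hzl l).trace (σ := σ) (d := Y 1 l - Y σ l) h.abar_le (h.low_le_upp l) hσ ?_ ?_
  · rw [pt_snd_sub, pt_fst]
    rwa [hY.end_eq, show z.1 l - p.x0.1 l - (z.1 l - Y σ l) = Y σ l - p.x0.1 l by ring] at this
  · intro ht
    rw [mul_assoc, mul_assoc]
    exact mul_le_sub_of_deriv_mem hder (fun s _ => mul_le_mul_of_nonneg_left (hlow _ l) ht)
      (fun s _ => mul_le_mul_of_nonneg_left (hupp _ l) ht) hσ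
  · intro ht
    rw [mul_assoc, mul_assoc]
    exact mul_le_sub_of_deriv_mem hder (fun s _ => mul_le_mul_of_nonpos_left (hupp _ l) ht)
      (fun s _ => mul_le_mul_of_nonpos_left (hlow _ l) ht) hσ

end Problem.Standard

theorem CharDomain.mono {E : Type*} [NormedAddCommGroup E] [NormedSpace ℝ E] {t0 : ℝ}
    {S T : Set (E × ℝ)} {v : E × ℝ → E} (h : CharDomain t0 S v) (hTS : T ⊆ S)
    (hmem : ∀ z ∈ T, ∀ Y, IsChar t0 v z Y → ∀ σ ∈ Icc (0 : ℝ) 1, pt t0 z Y σ ∈ T) :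
    CharDomain t0 T v :=
  ⟨fun z hz => h.exists_char z (hTS hz), hmem, h.lip.imp fun _ hK => hK.mono hTS⟩

theorem Transported.mono {E : Type*} [NormedAddCommGroup E] [NormedSpace ℝ E] {t0 : ℝ}
    {S T : Set (E × ℝ)} {v : E × ℝ → E} {D w : E × ℝ → ℝ} (h : Transported t0 S v D w)
    (hTS : T ⊆ S) : Transported t0 T v D w :=
  fun z hz => h z (hTS hz)

theorem abs_add_clamp_sub_le {r : ℝ} (hr : 0 ≤ r) (x₀ x : ℝ) :
    |x₀ + clamp r (x - x₀) - x₀| ≤ r := by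
  rw [add_sub_cancel_left]
  exact abs_clamp_le hr _

theorem add_clamp_eq_self {r x₀ x : ℝ} (h : |x - x₀| ≤ r) : x₀ + clamp r (x - x₀) = x := by
  rw [clamp_eq_self h, add_sub_cancel]

theorem abs_add_clamp_sub_add_clamp_le (r x₀ x y : ℝ) :
    |x₀ + clamp r (x - x₀) - (x₀ + clamp r (y - x₀))| ≤ |x - y| := by
  rw [add_sub_add_left_eq_sub]
  refine (abs_clamp_sub_clamp_le _ _ _).trans_eq ?_
  rw [sub_sub_sub_cancel_right]

/-! ### Extension of the data and solutions along characteristics. -/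

namespace Problem

variable {m n : ℕ} (p : Problem m n)

/-- The projection onto `P`. -/
def proj (w : Dom m × Cod n) : Dom m × Cod n :=
  ((fun l => p.x0.1 l + clamp p.a (w.1.1 l - p.x0.1 l), p.x0.2 + clamp p.a (w.1.2 - p.x0.2)),
    fun i => p.y0 i + clamp p.b (w.2 i - p.y0 i))

/-- The projection onto `V`. -/
def projV (x : Fin (m - 1) → ℝ) : Dom m :=
  (fun l => p.x0.1 l + clamp p.abar (x l - p.x0.1 l), p.x0.2)

/-- The extension of the coefficients `C` to the whole space. -/
def extC (i : Fin n) (l : Fin (m - 1)) (w : Dom m × Cod n) : ℝ := p.C i l (p.proj w)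

/-- The extension of the coefficients `D` to the whole space. -/
def extD (i : Fin n) (w : Dom m × Cod n) : ℝ := p.D i (p.proj w)

/-- The extension of the initial values to the whole initial plane. -/
def extI (x : Fin (m - 1) → ℝ) : Cod n := p.I (p.projV x)

variable {p}

theorem proj_mem (ha : 0 ≤ p.a) (hb : 0 ≤ p.b) (w : Dom m × Cod n) : p.proj w ∈ p.P :=
  ⟨(mem_P1_iff ha).2 ⟨fun _ => abs_add_clamp_sub_le ha _ _, abs_add_clamp_sub_le ha _ _⟩,
    (mem_P2_iff hb).2 fun _ => abs_add_clamp_sub_le hb _ _⟩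

theorem proj_eq_self (ha : 0 ≤ p.a) (hb : 0 ≤ p.b) {w : Dom m × Cod n} (hw : w ∈ p.P) :
    p.proj w = w := by
  obtain ⟨h1, h2⟩ := hw
  rw [mem_P1_iff ha] at h1
  rw [mem_P2_iff hb] at h2
  ext1
  · ext1
    · exact funext fun l => add_clamp_eq_self (h1.1 l)
    · exact add_clamp_eq_self h1.2
  · exact funext fun i => add_clamp_eq_self (h2 i)

/-- Clamping acts on each coordinate separately and does not increase differences. The 1-norm
constants therefore survive the extension unchanged, which the explicit bounds require. -/
theorem dist1Prod_proj_le (z w : Dom m × Cod n) :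
    dist1Prod (p.proj z) (p.proj w) ≤ dist1Prod z w :=
  add_le_add (add_le_add (Finset.sum_le_sum fun _ _ => abs_add_clamp_sub_add_clamp_le _ _ _ _)
    (abs_add_clamp_sub_add_clamp_le _ _ _ _))
    (Finset.sum_le_sum fun _ _ => abs_add_clamp_sub_add_clamp_le _ _ _ _)

theorem projV_eq {x : Dom m} (hx : x ∈ p.V) : p.projV x.1 = x := by
  ext1
  · exact funext fun l => add_clamp_eq_self (hx.2.2 l)
  · exact hx.2.1.symm

/-- The hypotheses on the problem, the constants and the height of the standard domain. -/
structure Setting (p : Problem m n) (c : Constants m) (α : ℝ) : Prop where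
  two_le : 2 ≤ m
  one_le : 1 ≤ n
  abar_pos : 0 < p.abar
  abar_le : p.abar ≤ p.a
  b_pos : 0 < p.b
  isFor : c.IsFor p
  adm : p.Admissible c α

variable {c : Constants m} {α : ℝ}

namespace Setting

theorem a_pos (h : p.Setting c α) : 0 < p.a := h.abar_pos.trans_le h.abar_le

theorem proj_mem (h : p.Setting c α) (w : Dom m × Cod n) : p.proj w ∈ p.P :=
  Problem.proj_mem h.a_pos.le h.b_pos.le w

theorem center_mem (h : p.Setting c α) : (p.x0, p.y0) ∈ p.P :=
  ⟨(mem_P1_iff h.a_pos.le).2 ⟨fun l => by simpa using h.a_pos.le, by simpa using h.a_pos.le⟩,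
    (mem_P2_iff h.b_pos.le).2 fun i => by simpa using h.b_pos.le⟩

theorem projV_mem (h : p.Setting c α) (x : Fin (m - 1) → ℝ) : p.projV x ∈ p.V :=
  ⟨(mem_P1_iff h.a_pos.le).2 ⟨fun _ => (abs_add_clamp_sub_le h.abar_pos.le _ _).trans h.abar_le,
    by simpa [projV] using h.a_pos.le⟩, rfl, fun _ => abs_add_clamp_sub_le h.abar_pos.le _ _⟩

theorem extC_eq (h : p.Setting c α) {w : Dom m × Cod n} (hw : w ∈ p.P) (i : Fin n)
    (l : Fin (m - 1)) : p.extC i l w = p.C i l w := by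
  rw [extC, proj_eq_self h.a_pos.le h.b_pos.le hw]

theorem extD_eq (h : p.Setting c α) {w : Dom m × Cod n} (hw : w ∈ p.P) (i : Fin n) :
    p.extD i w = p.D i w := by
  rw [extD, proj_eq_self h.a_pos.le h.b_pos.le hw]

theorem standard (h : p.Setting c α) : p.Standard c α where
  abar_pos := h.abar_pos
  abar_le := h.abar_le
  pos := h.adm.pos
  le_a := h.adm.le_a
  low_le_upp l := (h.isFor.low_le ⟨0, h.one_le⟩ l _ h.center_mem).trans
    (h.isFor.le_upp ⟨0, h.one_le⟩ l _ h.center_mem)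

theorem globalData (h : p.Setting c α) : GlobalData c p.extC p.extD p.extI := by
  have hm := h.two_le
  have ha := h.a_pos
  -- Nonnegativity of the constants is not assumed. It follows by testing the Lipschitz conditions
  -- on pairs of distinct points; the pair in `V` differs in a spatial coordinate, which exists
  -- because `m ≥ 2`.
  set i₀ : Fin n := ⟨0, h.one_le⟩
  set l₀ : Fin (m - 1) := ⟨0, by omega⟩ with hl₀
  have hedge : (((p.x0.1, p.x0.2 + p.a), p.y0) : Dom m × Cod n) ∈ p.P := by
    refine ⟨(mem_P1_iff ha.le).2 ⟨fun l => by simpa using ha.le, ?_⟩, h.center_mem.2⟩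
    simp [abs_of_pos ha]
  have hd : dist1Prod (p.x0, p.y0) ((p.x0.1, p.x0.2 + p.a), p.y0) = p.a := by
    simp [dist1Prod, dist1, abs_of_pos ha]
  have hLC := (abs_nonneg _).trans (h.isFor.lipC i₀ l₀ _ h.center_mem _ hedge)
  have hLD := (abs_nonneg _).trans (h.isFor.lipD i₀ _ h.center_mem _ hedge)
  rw [hd] at hLC hLD
  set x₁ : Fin (m - 1) → ℝ := fun l => p.x0.1 l + if l = l₀ then p.abar else 0 with hx₁
  have hx₁V : ((x₁, p.x0.2) : Dom m) ∈ p.V := by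
    have hb : ∀ l, |x₁ l - p.x0.1 l| ≤ p.abar := by
      intro l
      simp only [hx₁, add_sub_cancel_left]
      split_ifs
      · exact (abs_of_pos h.abar_pos).le
      · simpa using h.abar_pos.le
    exact ⟨(mem_P1_iff ha.le).2 ⟨fun l => (hb l).trans h.abar_le, by simpa using ha.le⟩, rfl, hb⟩
  have hdV : dist1 ((x₁, p.x0.2) : Dom m) p.x0 = p.abar := by
    simp only [dist1, hx₁, add_sub_cancel_left, sub_self, abs_zero, add_zero]
    rw [Finset.sum_eq_single l₀ (fun l _ hl => by simp [hl]) (by simp)]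
    simp [abs_of_pos h.abar_pos]
  have hx0V : p.x0 ∈ p.V := by
    have := h.projV_mem p.x0.1
    have e : p.projV p.x0.1 = p.x0 := by
      ext1
      · exact funext fun l => add_clamp_eq_self (by simpa using h.abar_pos.le)
      · rfl
    rwa [e] at this
  have hLI := (abs_nonneg _).trans (h.isFor.lipI i₀ _ hx₁V _ hx0V)
  rw [hdV] at hLI
  have hLC0 : 0 ≤ c.LC := nonneg_of_mul_nonneg_left hLC ha
  have hLD0 : 0 ≤ c.LD := nonneg_of_mul_nonneg_left hLD ha
  have hLI0 : 0 ≤ c.LI := nonneg_of_mul_nonneg_left hLI h.abar_pos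
  exact
    { lipC := fun i l z w => (h.isFor.lipC i l _ (h.proj_mem z) _ (h.proj_mem w)).trans
        (mul_le_mul_of_nonneg_left (dist1Prod_proj_le z w) hLC0)
      lipD := fun i z w => (h.isFor.lipD i _ (h.proj_mem z) _ (h.proj_mem w)).trans
        (mul_le_mul_of_nonneg_left (dist1Prod_proj_le z w) hLD0)
      lipI := fun i x y => by
        refine (h.isFor.lipI i _ (h.projV_mem x) _ (h.projV_mem y)).trans
          (mul_le_mul_of_nonneg_left ?_ hLI0)
        rw [dist1]
        simp only [projV, sub_self, abs_zero, add_zero]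
        exact Finset.sum_le_sum fun _ _ => abs_add_clamp_sub_add_clamp_le _ _ _ _
      boundC := fun i l z => h.isFor.boundC i l _ (h.proj_mem z)
      boundD := fun i z => h.isFor.boundD i _ (h.proj_mem z)
      boundI := ⟨c.MI + ‖p.y0‖, fun x => by
        have h1 := h.isFor.boundI _ (h.projV_mem x)
        have h2 := norm_add_le (p.I (p.projV x) - p.y0) p.y0
        rw [sub_add_cancel] at h2
        exact h2.trans (by gcongr)⟩
      LC_nonneg := hLC0
      LD_nonneg := hLD0
      LI_nonneg := hLI0
      MC_nonneg := (abs_nonneg _).trans (h.isFor.boundC i₀ l₀ _ h.center_mem)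
      MD_nonneg := (abs_nonneg _).trans (h.isFor.boundD i₀ _ h.center_mem) }

end Setting

/-- Solutions along characteristics of the extended system in a layer around the initial plane. -/
structure IsCharSolution (p : Problem m n) (c : Constants m) (α : ℝ) (f : Dom m → Cod n) :
    Prop where
  lipClass : LipClass p.x0.2 α (fun _ => c.Lf n α) (c.LUfs n α) f
  mem_P2 : ∀ z ∈ slab (Fin (m - 1) → ℝ) p.x0.2 α, f z ∈ p.P2
  initial : EqOn f p.I p.V
  transported : ∀ i, Transported p.x0.2 (slab _ p.x0.2 α) (vf p.extC f i)
    (fun z => p.extD i (z, f z)) (fun z => f z i)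

theorem Setting.exists_isCharSolution (h : p.Setting c α) : ∃ f, p.IsCharSolution c α f := by
  have G := h.globalData
  have hα := h.adm.pos.le
  obtain ⟨f, hf, hfix⟩ := G.exists_solution p.x0.2 h.two_le h.one_le hα h.adm.locality
  have htr := fun i => G.transported_picard hf i
  have hinit := G.picard_initial hf hα
  rw [hfix] at htr hinit
  refine ⟨f, hf, fun z hz => (mem_P2_iff h.b_pos.le).2 fun i => ?_, fun x hx => ?_, htr⟩
  · obtain ⟨Y, hY⟩ := (G.charDomain hf i).exists_char z hz
    have hz' : |z.2 - p.x0.2| ≤ α := hz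
    have h1 := norm_sub_le_of_norm_deriv_le (B := α * c.MD) (htr i z hz Y hY) (fun σ _ => by
      rw [norm_mul]
      exact mul_le_mul hz' (G.boundD i _) (norm_nonneg _) hα) (ρ := 0) (σ := 1) (by simp) (by simp)
    beta_reduce at h1
    rw [hY.pt_one, pt_zero, hinit, Real.norm_eq_abs] at h1
    -- Along a characteristic `f` starts within `MI` of `y0` and changes by at most `α * MD`;
    -- together this is at most `b`.
    have h2 := (norm_le_pi_norm _ i).trans (h.isFor.boundI _ (h.projV_mem (Y 0)))
    have h3 : |p.extI (Y 0) i - p.y0 i| ≤ c.MI := h2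
    have h4 := abs_add_le (f z i - p.extI (Y 0) i) (p.extI (Y 0) i - p.y0 i)
    rw [sub_add_sub_cancel] at h4
    have h5 := h.adm.le_b
    simp only [sub_zero, abs_one, mul_one] at h1
    linarith
  · have h1 := hinit x.1
    rw [extI, projV_eq hx] at h1
    rwa [← hx.2.1] at h1

end Problem

/-! ### Existence, uniqueness and regularity on the standard domain. -/

namespace Problem

variable {m n : ℕ} {p : Problem m n} {c : Constants m} {α : ℝ} {f g : Dom m → Cod n}

theorem IsCharSolution.exists_lipschitzOnWith (hf : p.IsCharSolution c α f) {T : Set (Dom m)}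
    (hT : T ⊆ slab _ p.x0.2 α) : ∃ K, LipschitzOnWith K f T := by
  refine ⟨(|c.LUfs n α| * ((m - 1 : ℕ) + 1)).toNNReal,
    LipschitzOnWith.of_dist_le_mul fun z hz z' hz' => ?_⟩
  rw [Real.coe_toNNReal _ (by positivity), dist_eq_norm, dist_eq_norm]
  refine (pi_norm_le_iff_of_nonneg (by positivity)).2 fun i => ?_
  refine (hf.lipClass.total z (hT hz) z' (hT hz') i).trans ?_
  rw [mul_assoc]
  exact mul_le_mul (le_abs_self _) (dist1_le_norm_sub z z') (dist1_nonneg _ _) (abs_nonneg _)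

namespace Setting

theorem charDomain_S (h : p.Setting c α) (hf : p.IsCharSolution c α f) (i : Fin n) :
    CharDomain p.x0.2 (p.S c α) (vf p.extC f i) :=
  (h.globalData.charDomain hf.lipClass i).mono h.standard.S_subset_slab fun _ hz _ hY _ hσ =>
    h.standard.pt_mem_S (fun _ l => h.isFor.low_le i l _ (h.proj_mem _))
      (fun _ l => h.isFor.le_upp i l _ (h.proj_mem _)) hz hY hσ

theorem graph_mem (h : p.Setting c α) (hf : p.IsCharSolution c α f) {z : Dom m}
    (hz : z ∈ p.S c α) : (z, f z) ∈ p.P :=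
  ⟨S_subset_P1 hz, hf.mem_P2 z (h.standard.S_subset_slab hz)⟩

theorem continuousOn_extD (h : p.Setting c α) (hf : p.IsCharSolution c α f) (i : Fin n) :
    ContinuousOn (fun z => p.extD i (z, f z)) (p.S c α) :=
  (h.globalData.lipschitz_D hf.lipClass i).continuousOn.mono h.standard.S_subset_slab

theorem isSolution (h : p.Setting c α) (hf : p.IsCharSolution c α f) :
    p.IsSolution (p.S c α) f where
  mapsTo _ hz := (h.graph_mem hf hz).2
  initial := hf.initial
  equations := by
    intro z hz _ hdiff i
    obtain ⟨hpos, hneg⟩ := h.standard.regularDomain.exists_time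
    have hA : HasFDerivWithinAt (fun z => f z i)
        ((ContinuousLinearMap.proj (R := ℝ) (φ := fun _ : Fin n => ℝ) i).comp
          (fderivWithin ℝ f (p.S c α) z)) (p.S c α) z :=
      (ContinuousLinearMap.proj (R := ℝ) (φ := fun _ : Fin n => ℝ) i).hasFDerivAt
        |>.comp_hasFDerivWithinAt z hdiff.hasFDerivWithinAt
    have := ((hf.transported i).mono h.standard.S_subset_slab).apply_fderivWithin
      h.standard.convex_S (h.charDomain_S hf i) (fun z _ => h.globalData.norm_vf_le f i z)
      (h.continuousOn_extD hf i) hpos hneg hz hA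
    rw [clm_apply_prod, one_mul, h.extD_eq (h.graph_mem hf hz)] at this
    rw [← this]
    simp only [vf, h.extC_eq (h.graph_mem hf hz), ContinuousLinearMap.comp_apply,
      ContinuousLinearMap.proj_apply]

theorem abs_extC_sub_le (h : p.Setting c α) (i : Fin n) (l : Fin (m - 1)) (z : Dom m)
    (y y' : Cod n) : |p.extC i l (z, y) - p.extC i l (z, y')| ≤ c.LC * n * ‖y - y'‖ := by
  refine (h.globalData.lipC i l _ _).trans ?_
  rw [mul_assoc]
  refine mul_le_mul_of_nonneg_left ?_ h.globalData.LC_nonneg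
  simp only [dist1Prod, dist1, sub_self, abs_zero, Finset.sum_const_zero, zero_add]
  calc _ ≤ ∑ _i : Fin n, ‖y - y'‖ := Finset.sum_le_sum fun s _ => norm_le_pi_norm (y - y') s
    _ = _ := by simp

theorem abs_extD_sub_le (h : p.Setting c α) (i : Fin n) (z : Dom m)
    (y y' : Cod n) : |p.extD i (z, y) - p.extD i (z, y')| ≤ c.LD * n * ‖y - y'‖ := by
  refine (h.globalData.lipD i _ _).trans ?_
  rw [mul_assoc]
  refine mul_le_mul_of_nonneg_left ?_ h.globalData.LD_nonneg
  simp only [dist1Prod, dist1, sub_self, abs_zero, Finset.sum_const_zero, zero_add]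
  calc _ ≤ ∑ _i : Fin n, ‖y - y'‖ := Finset.sum_le_sum fun s _ => norm_le_pi_norm (y - y') s
    _ = _ := by simp

theorem continuous_of_dist1Prod {F : Dom m × Cod n → ℝ} {L : ℝ} (hL : 0 ≤ L)
    (hF : ∀ z w, |F z - F w| ≤ L * dist1Prod z w) : Continuous F := by
  refine (LipschitzWith.of_dist_le_mul (K := (L * ((m - 1 : ℕ) + 1 + n)).toNNReal)
    fun z w => ?_).continuous
  rw [Real.coe_toNNReal _ (by positivity), Real.dist_eq, dist_eq_norm, mul_assoc]
  refine (hF z w).trans (mul_le_mul_of_nonneg_left ?_ hL)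
  have h1 := (dist1_le_norm_sub z.1 w.1).trans
    (mul_le_mul_of_nonneg_left (norm_fst_le (z - w)) (by positivity))
  have h2 : ∑ s, |z.2 s - w.2 s| ≤ n * ‖z - w‖ := by
    calc _ ≤ ∑ _s : Fin n, ‖z - w‖ := Finset.sum_le_sum fun s _ =>
          (norm_le_pi_norm (z.2 - w.2) s).trans (norm_snd_le (z - w))
      _ = _ := by simp
  rw [dist1Prod, add_mul]
  exact add_le_add h1 h2

/-- Every Lipschitz solution agrees with the solution along characteristics on convex sets that
contain its characteristics. -/
theorem eqOn_of_isSolution (h : p.Setting c α) (hf : p.IsCharSolution c α f) {B T : Set (Dom m)}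
    (hg : p.IsSolution B g) (hTB : T ⊆ B) (hTS : T ⊆ p.S c α) (hT : Convex ℝ T)
    (hTc : IsCompact T) (hTi : (interior T).Nonempty)
    (hcd : ∀ i, CharDomain p.x0.2 T (vf p.extC f i)) {K : NNReal} (hK : LipschitzOnWith K g T) :
    EqOn g f T := by
  have G := h.globalData
  have hgP : ∀ z ∈ T, (z, g z) ∈ p.P := fun z hz => ⟨S_subset_P1 (hTS hz), hg.mapsTo (hTB hz)⟩
  have hTslab := hTS.trans h.standard.S_subset_slab
  have hgraph : ContinuousOn (fun z => (z, g z)) T := continuousOn_id.prodMk hK.continuousOn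
  refine eqOn_of_transported (C := p.extC) (D := p.extD) hT hTc hTi
    (fun z _ i l => h.abs_extC_sub_le i l z _ _) (fun z _ i => h.abs_extD_sub_le i z _ _)
    (fun i => ?_) (fun i => ?_) (fun i => (h.continuousOn_extD hf i).mono hTS)
    (hf.lipClass.continuousOn.mono hTslab) hK hcd (fun i => (hf.transported i).mono hTslab)
    (fun x hx => ?_) (fun z hz hdiff i => ?_)
  · exact continuousOn_pi.2 fun l =>
      (continuous_of_dist1Prod G.LC_nonneg (G.lipC i l)).comp_continuousOn hgraph
  · exact (continuous_of_dist1Prod G.LD_nonneg (G.lipD i)).comp_continuousOn hgraph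
  · have hV := h.standard.mem_V_of_mem_S (hTS hx)
    rw [hg.initial hV, hf.initial hV]
  · have hzT := interior_subset hz
    have hB : B ∈ 𝓝 z := mem_of_superset (mem_interior_iff_mem_nhds.1 hz) hTB
    have := hg.equations z (hTB hzT) (uniqueDiffWithinAt_of_mem_nhds hB)
      hdiff.differentiableWithinAt i
    rw [fderivWithin_of_mem_nhds hB] at this
    rw [h.extD_eq (hgP z hzT), ← this]
    simp only [h.extC_eq (hgP z hzT)]

/-- The solution along characteristics inherits the regularity of the data. -/
theorem contDiffOn_of_crData (h : p.Setting c α) (hf : p.IsCharSolution c α f) {r : ℕ}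
    (hr : p.CrData r) : ContDiffOn ℝ r f (p.S c α) := by
  obtain ⟨hC, hD, hI⟩ := hr
  have hsub : p.S c α ×ˢ p.P2 ⊆ p.P := prod_mono S_subset_P1 subset_rfl
  refine QuasilinearSolution.contDiffOn h.standard.regularDomain r (Fin n) p.P2 p.extC p.extD f
    convex_P2 isCompact_P2 ?_ ?_ (fun i l => ?_) (fun i => ?_) ?_
  · rw [P2_eq_closedBall]
    exact ⟨p.y0, Metric.ball_subset_interior_closedBall (Metric.mem_ball_self h.b_pos)⟩
  · exact
      { mapsTo := fun z hz => (h.graph_mem hf hz).2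
        lipschitz := hf.exists_lipschitzOnWith h.standard.S_subset_slab
        charDomain := h.charDomain_S hf
        transported := fun i => (hf.transported i).mono h.standard.S_subset_slab }
  · exact ((hC i l).mono hsub).congr fun w hw => h.extC_eq (hsub hw) i l
  · exact ((hD i).mono hsub).congr fun w hw => h.extD_eq (hsub hw) i
  · have hm : MapsTo (fun x => ((x, p.x0.2) : Dom m)) {x | (x, p.x0.2) ∈ p.S c α} p.V :=
      fun x hx => h.standard.mem_V_of_mem_S hx
    refine (hI.comp (contDiff_prodMk_left p.x0.2).contDiffOn hm).congr fun x hx => ?_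
    exact hf.initial (hm hx)

/-- A compact convex neighbourhood of a point of the initial plane that contains its
characteristics. -/
theorem exists_charDomain_nhds (h : p.Setting c α) (hf : p.IsCharSolution c α f) {v : Dom m}
    (hv : v.2 = p.x0.2) {U : Set (Dom m)} (hU : U ∈ 𝓝 v) (hUS : U ⊆ p.S c α) :
    ∃ T ⊆ U, Convex ℝ T ∧ IsCompact T ∧ v ∈ interior T ∧
      ∀ i, CharDomain p.x0.2 T (vf p.extC f i) := by
  obtain ⟨ρ, hρ, hball⟩ := Metric.mem_nhds_iff.1 hU
  have hM0 := h.globalData.MC_nonneg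
  set M : ℝ := c.MC + 1 with hM
  -- A double cone over a ball in the initial plane. Its slope `MC + 1` exceeds every speed, so
  -- backward characteristics stay inside; being at least `1`, it also bounds the height by `ρ / 2`.
  set T : Set (Dom m) := {z | ‖z.1 - v.1‖ + M * |z.2 - p.x0.2| ≤ ρ / 2} with hT
  have hcont : Continuous fun z : Dom m => ‖z.1 - v.1‖ + M * |z.2 - p.x0.2| := by fun_prop
  have hTb : T ⊆ Metric.closedBall v (ρ / 2) := by
    intro z hz
    have hz' : ‖z.1 - v.1‖ + M * |z.2 - p.x0.2| ≤ ρ / 2 := hz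
    have h1 : |z.2 - p.x0.2| ≤ M * |z.2 - p.x0.2| :=
      le_mul_of_one_le_left (abs_nonneg _) (by linarith)
    rw [mem_closedBall_iff_norm, Prod.norm_def]
    refine max_le ?_ ?_
    · exact (le_add_of_nonneg_right (by positivity)).trans hz'
    · rw [Prod.snd_sub, hv]
      exact (h1.trans (le_add_of_nonneg_left (norm_nonneg _))).trans hz'
  have hTU : T ⊆ U := (hTb.trans (Metric.closedBall_subset_ball (by linarith))).trans hball
  refine ⟨T, hTU, ?_, ?_, ?_, fun i => ?_⟩
  · intro x hx y hy r s hr hs hrs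
    have hx' : ‖x.1 - v.1‖ + M * |x.2 - p.x0.2| ≤ ρ / 2 := hx
    have hy' : ‖y.1 - v.1‖ + M * |y.2 - p.x0.2| ≤ ρ / 2 := hy
    have e1 : (r • x + s • y).1 - v.1 = r • (x.1 - v.1) + s • (y.1 - v.1) := by
      rw [smul_sub, smul_sub, sub_add_sub_comm, ← add_smul, hrs, one_smul]
      rfl
    have e2 : (r • x + s • y).2 - p.x0.2 = r * (x.2 - p.x0.2) + s * (y.2 - p.x0.2) := by
      obtain rfl : s = 1 - r := by linarith
      simp
      ring
    have n1 : ‖(r • x + s • y).1 - v.1‖ ≤ r * ‖x.1 - v.1‖ + s * ‖y.1 - v.1‖ := by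
      rw [e1]
      refine (norm_add_le _ _).trans_eq ?_
      rw [norm_smul, norm_smul, Real.norm_of_nonneg hr, Real.norm_of_nonneg hs]
    have n2 : |(r • x + s • y).2 - p.x0.2| ≤ r * |x.2 - p.x0.2| + s * |y.2 - p.x0.2| := by
      rw [e2]
      refine (abs_add_le _ _).trans_eq ?_
      rw [abs_mul, abs_mul, abs_of_nonneg hr, abs_of_nonneg hs]
    calc _ ≤ (r * ‖x.1 - v.1‖ + s * ‖y.1 - v.1‖) +
          M * (r * |x.2 - p.x0.2| + s * |y.2 - p.x0.2|) := by gcongr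
      _ = r * (‖x.1 - v.1‖ + M * |x.2 - p.x0.2|) + s * (‖y.1 - v.1‖ + M * |y.2 - p.x0.2|) := by
        ring
      _ ≤ r * (ρ / 2) + s * (ρ / 2) := by gcongr
      _ = ρ / 2 := by rw [← add_mul, hrs, one_mul]
  · exact (isCompact_closedBall v (ρ / 2)).of_isClosed_subset
      (isClosed_le hcont continuous_const) hTb
  · refine mem_interior_iff_mem_nhds.2 ?_
    have : ∀ᶠ z in 𝓝 v, ‖z.1 - v.1‖ + M * |z.2 - p.x0.2| < ρ / 2 :=
      hcont.continuousAt.eventually_lt_const (by simp [hv, hρ])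
    exact this.mono fun z hz => hz.le
  · refine (h.charDomain_S hf i).mono (hTU.trans hUS) fun z hz Y hY σ hσ => ?_
    have hz' : ‖z.1 - v.1‖ + M * |z.2 - p.x0.2| ≤ ρ / 2 := hz
    change ‖(pt p.x0.2 z Y σ).1 - v.1‖ + M * |(pt p.x0.2 z Y σ).2 - p.x0.2| ≤ ρ / 2
    rw [abs_pt_snd_sub hσ, pt_fst]
    have h1 := norm_sub_le_of_norm_deriv_le (B := |z.2 - p.x0.2| * M) hY.deriv (fun s _ => by
      rw [norm_smul, Real.norm_eq_abs]
      refine mul_le_mul_of_nonneg_left ?_ (abs_nonneg _)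
      exact (h.globalData.norm_vf_le f i _).trans (by linarith)) (ρ := 1) (σ := σ) (by simp) hσ
    rw [hY.end_eq, abs_sub_comm σ 1, abs_of_nonneg (by linarith [hσ.2] : 0 ≤ 1 - σ)] at h1
    have h2 := norm_add_le (Y σ - z.1) (z.1 - v.1)
    rw [sub_add_sub_cancel] at h2
    linarith

variable {Reg : Set (Dom m) → (Dom m → Cod n) → Prop}

theorem isUniqueSolution (h : p.Setting c α) (hf : p.IsCharSolution c α f)
    (hReg : ∀ B g, Reg B g → ∀ T ⊆ B, Convex ℝ T → IsCompact T → ∃ K, LipschitzOnWith K g T)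
    (hfR : Reg (p.S c α) f) : p.IsUniqueSolution Reg (p.S c α) f := by
  refine ⟨h.isSolution hf, hfR, fun g hg hgR => ?_⟩
  obtain ⟨K, hK⟩ := hReg _ _ hgR _ subset_rfl h.standard.convex_S h.standard.isCompact_S
  exact h.eqOn_of_isSolution hf hg subset_rfl subset_rfl h.standard.convex_S
    h.standard.isCompact_S h.standard.regularDomain.interior_nonempty (h.charDomain_S hf) hK

/-- An arbitrary local domain need not contain the characteristics of `f`. Around each point of
`Vint` a small double cone inside both domains does, and the interiors of these cones form the
neighbourhood. -/
theorem exists_eqOn_open (h : p.Setting c α) (hf : p.IsCharSolution c α f)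
    (hReg : ∀ B g, Reg B g → ∀ T ⊆ B, Convex ℝ T → IsCompact T → ∃ K, LipschitzOnWith K g T)
    {B : Set (Dom m)} (hB : p.IsLocalDomain B) (hg : p.IsSolution B g) (hgR : Reg B g) :
    ∃ U : Set (Dom m), IsOpen U ∧ p.Vint ⊆ U ∧ U ⊆ p.S c α ∩ B ∧ EqOn g f U := by
  obtain ⟨-, -, W, hW, hVW, hWB⟩ := hB
  have hex : ∀ v ∈ p.Vint, ∃ T ⊆ p.S c α ∩ W, Convex ℝ T ∧ IsCompact T ∧ v ∈ interior T ∧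
      ∀ i, CharDomain p.x0.2 T (vf p.extC f i) := fun v hv =>
    h.exists_charDomain_nhds hf hv.2.1
      (inter_mem (h.standard.S_mem_nhds hv) (hW.mem_nhds (hVW hv))) inter_subset_left
  choose! T hTsub hTconv hTc hTv hTcd using hex
  refine ⟨⋃ v ∈ p.Vint, interior (T v), isOpen_biUnion fun v _ => isOpen_interior,
    fun v hv => mem_biUnion hv (hTv v hv), iUnion₂_subset fun v hv =>
      interior_subset.trans ((hTsub v hv).trans (inter_subset_inter_right _ hWB)),
    fun z hz => ?_⟩
  obtain ⟨v, hv, hzv⟩ := mem_iUnion₂.1 hz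
  have hTB : T v ⊆ B := (hTsub v hv).trans (inter_subset_right.trans hWB)
  obtain ⟨K, hK⟩ := hReg _ _ hgR _ hTB (hTconv v hv) (hTc v hv)
  exact h.eqOn_of_isSolution hf hg hTB ((hTsub v hv).trans inter_subset_left) (hTconv v hv)
    (hTc v hv) ⟨v, hTv v hv⟩ (hTcd v hv) hK (interior_subset hzv)

end Setting

end Problem

/-! ### Choice of constants and assembly of the theorem. -/

namespace Problem

variable {m n : ℕ} {p : Problem m n}

theorem norm_sub_le_dist1Prod (z w : Dom m × Cod n) : ‖z - w‖ ≤ dist1Prod z w := by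
  have h1 := norm_sub_le_dist1 z.1 w.1
  have h2 : ‖z.2 - w.2‖ ≤ ∑ s, |z.2 s - w.2 s| := by
    refine (pi_norm_le_iff_of_nonneg (Finset.sum_nonneg fun _ _ => abs_nonneg _)).2 fun s => ?_
    exact Finset.single_le_sum (f := fun s => |z.2 s - w.2 s|) (fun _ _ => abs_nonneg _)
      (Finset.mem_univ s)
  have h3 := dist1_nonneg z.1 w.1
  have h4 := (norm_nonneg _).trans h2
  rw [Prod.norm_def, dist1Prod]
  exact max_le (h1.trans (by linarith)) (h2.trans (by linarith))

theorem isCompact_P : IsCompact p.P := isCompact_P1.prod isCompact_P2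

theorem convex_P : Convex ℝ p.P := convex_P1.prod convex_P2

theorem V_eq : p.V = p.P1 ∩ {x | x.2 = p.x0.2} ∩ ⋂ l, {x | |x.1 l - p.x0.1 l| ≤ p.abar} := by
  ext x
  simp only [V, mem_ofPred_eq, mem_inter_iff, mem_iInter, and_assoc]

theorem isCompact_V : IsCompact p.V := by
  refine isCompact_P1.of_isClosed_subset ?_ fun x hx => hx.1
  rw [V_eq]
  refine (isCompact_P1.isClosed.inter (isClosed_eq continuous_snd continuous_const)).inter
    (isClosed_iInter fun l => ?_)
  have : Continuous fun x : Dom m => x.1 l - p.x0.1 l := by fun_prop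
  exact isClosed_le this.abs continuous_const

theorem convex_V : Convex ℝ p.V := by
  intro x hx y hy r s hr hs hrs
  refine ⟨convex_P1 hx.1 hy.1 hr hs hrs, ?_, fun l => ?_⟩
  · simp only [Prod.snd_add, Prod.smul_snd, hx.2.1, hy.2.1, ← add_smul, hrs, one_smul]
  · have h1 := abs_le.1 (hx.2.2 l)
    have h2 := abs_le.1 (hy.2.2 l)
    obtain rfl : s = 1 - r := by linarith
    have e : (r • x + (1 - r) • y).1 l - p.x0.1 l =
        r * (x.1 l - p.x0.1 l) + (1 - r) * (y.1 l - p.x0.1 l) := by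
      simp
      ring
    rw [e, abs_le]
    constructor
    · linarith [mul_le_mul_of_nonneg_left h1.1 hr, mul_le_mul_of_nonneg_left h2.1 hs]
    · linarith [mul_le_mul_of_nonneg_left h1.2 hr, mul_le_mul_of_nonneg_left h2.2 hs]

theorem CrData.lipschitzData {r : ℕ} (hr : 1 ≤ r) (h : p.CrData r) : p.LipschitzData := by
  have hne : (r : WithTop ℕ∞) ≠ 0 := by exact_mod_cast (by omega : r ≠ 0)
  exact ⟨fun i l => (h.1 i l).exists_lipschitzOnWith hne convex_P isCompact_P,
    fun i => (h.2.1 i).exists_lipschitzOnWith hne convex_P isCompact_P,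
    h.2.2.exists_lipschitzOnWith hne convex_V isCompact_V⟩

theorem x0_mem_V (habar : 0 < p.abar) (ha : p.abar ≤ p.a) : p.x0 ∈ p.V :=
  ⟨(mem_P1_iff (habar.le.trans ha)).2 ⟨fun l => by simpa using habar.le.trans ha,
    by simpa using habar.le.trans ha⟩, rfl, fun l => by simpa using habar.le⟩

theorem exists_constants (habar : 0 < p.abar) (ha : p.abar ≤ p.a)
    (hI : ∀ u ∈ p.V, ‖p.I u - p.y0‖ < p.b) (hL : p.LipschitzData) :
    ∃ c : Constants m, c.IsFor p ∧ c.MI < p.b := by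
  obtain ⟨hC, hD, KI, hKI⟩ := hL
  choose KC hKC using hC
  choose KD hKD using hD
  choose MC hMC using fun i l => isCompact_P.exists_bound_of_continuousOn (hKC i l).continuousOn
  choose MD hMD using fun i => isCompact_P.exists_bound_of_continuousOn (hKD i).continuousOn
  -- Taking `MI` as an attained maximum keeps the inequality `MI < b` strict, which leaves room for
  -- a positive height.
  obtain ⟨u, huV, humax⟩ := isCompact_V.exists_isMaxOn ⟨p.x0, x0_mem_V habar ha⟩
    (hKI.continuousOn.sub (continuousOn_const (c := p.y0))).norm
  replace humax : ∀ v ∈ p.V, ‖p.I v - p.y0‖ ≤ ‖p.I u - p.y0‖ := fun v hv => humax hv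
  have hle : ∀ (F : Fin n → ℝ), ∀ i, F i ≤ ∑ i, |F i| := fun F i =>
    (le_abs_self _).trans (Finset.single_le_sum (f := fun i => |F i|)
      (fun _ _ => abs_nonneg _) (Finset.mem_univ i))
  have hle2 : ∀ (F : Fin n → Fin (m - 1) → ℝ), ∀ i l, F i l ≤ ∑ i, ∑ l, |F i l| := fun F i l =>
    (le_abs_self _).trans ((Finset.single_le_sum (f := fun l => |F i l|)
      (fun _ _ => abs_nonneg _) (Finset.mem_univ l)).trans
        (Finset.single_le_sum (f := fun i => ∑ l, |F i l|)
          (fun _ _ => Finset.sum_nonneg fun _ _ => abs_nonneg _) (Finset.mem_univ i)))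
  have hC0 : 0 ≤ ∑ i, ∑ l, |(KC i l : ℝ)| :=
    Finset.sum_nonneg fun _ _ => Finset.sum_nonneg fun _ _ => abs_nonneg _
  have hD0 : 0 ≤ ∑ i, |(KD i : ℝ)| := Finset.sum_nonneg fun _ _ => abs_nonneg _
  refine ⟨⟨∑ i, ∑ l, |(KC i l : ℝ)|, ∑ i, |(KD i : ℝ)|, KI, ∑ i, ∑ l, |MC i l|, ∑ i, |MD i|,
    ‖p.I u - p.y0‖, fun _ => -∑ i, ∑ l, |MC i l|, fun _ => ∑ i, ∑ l, |MC i l|⟩, ?_, hI u huV⟩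
  have hbC : ∀ i l, ∀ z ∈ p.P, |p.C i l z| ≤ ∑ i, ∑ l, |MC i l| := fun i l z hz =>
    (hMC i l z hz).trans (hle2 MC i l)
  exact
    { lipC := fun i l z hz w hw => by
        have h1 := (hKC i l).dist_le_mul z hz w hw
        rw [Real.dist_eq, dist_eq_norm] at h1
        exact h1.trans (mul_le_mul (hle2 (fun i l => (KC i l : ℝ)) i l)
          (norm_sub_le_dist1Prod z w) (norm_nonneg _) hC0)
      lipD := fun i z hz w hw => by
        have h1 := (hKD i).dist_le_mul z hz w hw
        rw [Real.dist_eq, dist_eq_norm] at h1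
        exact h1.trans (mul_le_mul (hle (fun i => (KD i : ℝ)) i)
          (norm_sub_le_dist1Prod z w) (norm_nonneg _) hD0)
      lipI := fun i u hu v hv => by
        have h1 := hKI.dist_le_mul u hu v hv
        rw [dist_eq_norm, dist_eq_norm] at h1
        exact (norm_le_pi_norm (p.I u - p.I v) i).trans
          (h1.trans (mul_le_mul_of_nonneg_left (norm_sub_le_dist1 u v) KI.2))
      boundC := hbC
      boundD := fun i z hz => (hMD i z hz).trans (hle MD i)
      boundI := humax
      low_le := fun i l z hz => (abs_le.1 (hbC i l z hz)).1
      le_upp := fun i l z hz => (abs_le.1 (hbC i l z hz)).2 }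

/-- At `α = 0` every condition except positivity holds strictly, so by continuity all of them hold
for small positive `α`. -/
theorem exists_admissible (habar : 0 < p.abar) (ha : p.abar ≤ p.a) {c : Constants m}
    (hc : c.MI < p.b) : ∃ α, p.Admissible c α := by
  have e1 : ∀ᶠ α in 𝓝 (0 : ℝ), c.q n α < 1 := by
    have hq : Continuous (c.q n) := by
      unfold Constants.q
      fun_prop
    exact hq.continuousAt.eventually_lt_const (by simp [Constants.q])
  have e2 : ∀ᶠ α in 𝓝 (0 : ℝ), α ≤ p.a := eventually_le_nhds (habar.trans_le ha)
  have e3 : ∀ᶠ α in 𝓝 (0 : ℝ), α * c.MD < p.b - c.MI := by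
    have hq : Continuous fun α : ℝ => α * c.MD := by fun_prop
    exact hq.continuousAt.eventually_lt_const (by simpa using hc)
  have e4 : ∀ᶠ α in 𝓝 (0 : ℝ), ∀ l, -p.abar + c.uppC l * α < p.abar + c.lowC l * α := by
    refine eventually_all.2 fun l => ?_
    have h1 : Continuous fun α : ℝ => -p.abar + c.uppC l * α := by fun_prop
    have h2 : Continuous fun α : ℝ => p.abar + c.lowC l * α := by fun_prop
    exact h1.continuousAt.eventually_lt h2.continuousAt (by simpa using by linarith)
  obtain ⟨α, ⟨⟨⟨h1, h2⟩, h3⟩, h4⟩, h0⟩ := ((eventually_nhdsWithin_of_eventually_nhds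
    (((e1.and e2).and e3).and e4)).and (self_mem_nhdsWithin (s := Ioi (0 : ℝ)))).exists
  exact ⟨α, h0, h1, h2, h3.le, fun l => (h4 l).le⟩

/-- Local and global existence and uniqueness in a class of functions, from the regularity of the
solution along characteristics. -/
theorem hasUniqueSolutions (hm : 2 ≤ m) (hn : 1 ≤ n) (habar : 0 < p.abar) (ha : p.abar ≤ p.a)
    (hI : ∀ u ∈ p.V, ‖p.I u - p.y0‖ < p.b) (hL : p.LipschitzData)
    {Reg : Set (Dom m) → (Dom m → Cod n) → Prop}
    (hReg : ∀ B g, Reg B g → ∀ T ⊆ B, Convex ℝ T → IsCompact T → ∃ K, LipschitzOnWith K g T)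
    (hsol : ∀ (c : Constants m) (α : ℝ) (f : Dom m → Cod n), p.Setting c α →
      p.IsCharSolution c α f → Reg (p.S c α) f) :
    p.HasUniqueLocalSolution Reg ∧ p.HasUniqueSolutionOnStandardDomains Reg := by
  have hb : 0 < p.b := (norm_nonneg _).trans_lt (hI _ (x0_mem_V habar ha))
  constructor
  · obtain ⟨c, hc, hMI⟩ := exists_constants habar ha hI hL
    obtain ⟨α, hα⟩ := exists_admissible (n := n) habar ha hMI
    have h : p.Setting c α := ⟨hm, hn, habar, ha, hb, hc, hα⟩
    obtain ⟨f, hf⟩ := h.exists_isCharSolution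
    exact ⟨p.S c α, f, h.standard.isLocalDomain_S, h.standard.uniqueDiffOn_S,
      h.isUniqueSolution hf hReg (hsol c α f h hf),
      fun B g hB hg hgR => h.exists_eqOn_open hf hReg hB hg hgR⟩
  · intro c α hc hα
    have h : p.Setting c α := ⟨hm, hn, habar, ha, hb, hc, hα⟩
    obtain ⟨f, hf⟩ := h.exists_isCharSolution
    refine ⟨h.standard.isLocalDomain_S, h.standard.uniqueDiffOn_S, f,
      h.isUniqueSolution hf hReg (hsol c α f h hf), fun x hx x' hx' heq i => ?_,
      fun x hx x' hx' i => ?_⟩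
    · exact hf.lipClass.slice x (h.standard.S_subset_slab hx) x' (h.standard.S_subset_slab hx')
        heq i
    · exact hf.lipClass.total x (h.standard.S_subset_slab hx) x' (h.standard.S_subset_slab hx') i

end Problem

end CharSystem

end

/-- Both classes enter through two properties: members are Lipschitz on compact convex subsets,
which suffices for uniqueness, and the solution along characteristics belongs to the class. -/
theorem theorem3p1 (m n : ℕ) (hm : 2 ≤ m) (hn : 1 ≤ n) (p : CharSystem.Problem m n)
    (habar : 0 < p.abar) (ha : p.abar ≤ p.a) (hI : ∀ u ∈ p.V, ‖p.I u - p.y0‖ < p.b) :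
    (p.LipschitzData →
      p.HasUniqueLocalSolution CharSystem.LipschitzReg ∧
      p.HasUniqueSolutionOnStandardDomains CharSystem.LipschitzReg) ∧
    (∀ r : ℕ, 1 ≤ r → p.CrData r →
      p.HasUniqueLocalSolution (CharSystem.CrReg r) ∧
      p.HasUniqueSolutionOnStandardDomains (CharSystem.CrReg r)) := by
  refine ⟨fun hL => ?_, fun r hr hC => ?_⟩
  · exact CharSystem.Problem.hasUniqueSolutions hm hn habar ha hI hL
      (fun B g hg T hT _ _ => hg.imp fun K hK => hK.mono hT)
      fun c α f h hf => hf.exists_lipschitzOnWith h.standard.S_subset_slab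
  · have hne : (r : WithTop ℕ∞) ≠ 0 := by exact_mod_cast (by omega : r ≠ 0)
    exact CharSystem.Problem.hasUniqueSolutions hm hn habar ha hI
      (CharSystem.Problem.CrData.lipschitzData hr hC)
      (fun B g hg T hT hTc hTk =>
        ContDiffOn.exists_lipschitzOnWith (ContDiffOn.mono hg hT) hne hTc hTk)
      fun c α f h hf => h.contDiffOn_of_crData hf hC
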